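/- Let $n\ge 1$ and $\gamma\in(0,\infty)\setminus\mathbb N$. Let $\lfloor\gamma\rfloor$ and $[\gamma]=\gamma-\lfloor\gamma\rfloor$ be the integer and fractional parts of $\gamma$, and put $k=\lfloor\gamma\rfloor+1$ and $m=1-2[\gamma]$. On $\mathbb R^{n+1}_+=\mathbb R^n\times(0,\infty)$, with coordinates $(x,y)$, let $\overline\Delta$ be the Laplacian in $x$, $T=\partial_y^2+my^{-1}\partial_y$, $\Delta_m=\overline\Delta+T$ and $L_{2k}=\Delta_m^k$. Let $C^\infty_{\rm even}$ be the space of functions smooth on $\mathbb R^n\times[0,\infty)$ whose Taylor expansion in $y$ at $y=0$ contains only even powers, and put $\mathcal C^{2\gamma}=C^\infty_{\rm even}+y^{2[\gamma]}C^\infty_{\rm even}$. Let $\iota^*$ denote restriction to $y=0$ (the limit as $y\to0^+$). For $0\le j\le\lfloor\gamma\rfloor$ define operators $B_{2j}^{2\gamma},B_{2[\gamma]+2j}^{2\gamma}:\mathcal C^{2\gamma}\to C^\infty(\mathbb R^n)$ recursively by $$B_{2j}^{2\gamma}=(-1)^j\iota^*T^j-\sum_{\ell=1}^j\binom j\ell\frac{\Gamma(1+j-[\gamma])\,\Gamma(1+2j-2\ell-\gamma)}{\Gamma(1+j-\ell-[\gamma])\,\Gamma(1+2j-\ell-\gamma)}\overline\Delta^{\ell}B^{2\gamma}_{2j-2\ell},$$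 $$B_{2[\gamma]+2j}^{2\gamma}=(-1)^{j+1}\iota^*y^m\partial_yT^j-\sum_{\ell=1}^j\binom j\ell\frac{\Gamma(1+j+[\gamma])\,\Gamma(1+2j-2\ell-\lfloor\gamma\rfloor+[\gamma])}{\Gamma(1+j-\ell+[\gamma])\,\Gamma(1+2j-\ell-\lfloor\gamma\rfloor+[\gamma])}\overline\Delta^{\ell}B^{2\gamma}_{2[\gamma]+2j-2\ell}.$$ Let $f^{(2j)}\in C^\infty(\mathbb R^n)\cap H^{\gamma-2j}(\mathbb R^n)$ for $0\le j\le\lfloor\gamma/2\rfloor$, and $\phi^{(2j)}\in C^\infty(\mathbb R^n)\cap H^{\lfloor\gamma\rfloor-[\gamma]-2j}(\mathbb R^n)$ for $0\le j\le\lfloor\gamma\rfloor-\lfloor\gamma/2\rfloor-1$. Let $V\in\mathcal C^{2\gamma}$ be a (real- or complex-valued) solution of the Dirichlet problem $$\begin{cases}L_{2k}V=0&\text{in }\mathbb R^{n+1}_+,\\ B^{2\gamma}_{2j}(V)=f^{(2j)},&0\le j\le\lfloor\gamma/2\rfloor,\\ B^{2\gamma}_{2[\gamma]+2j}(V)=\phi^{(2j)},&0\le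 j\le\lfloor\gamma\rfloor-\lfloor\gamma/2\rfloor-1,\end{cases}$$ such that, for some constants $C$ and $N$, $\|V(\cdot,y)\|_{L^2(\mathbb R^n)}\le C(1+y)^N$ for all $y>0$. Then the following hold. (1) For $0\le j\le\lfloor\gamma/2\rfloor$, $\;B^{2\gamma}_{2\gamma-2j}(V)=c_{\gamma,j}(-\overline\Delta)^{\gamma-2j}f^{(2j)}$, where $$c_{\gamma,j}=(-1)^{1+\lfloor\gamma\rfloor}2^{1-2[\gamma]}\frac{(\lfloor\gamma\rfloor-j)!\,\Gamma(1-[\gamma])\,\Gamma(1-j+\gamma)\,\Gamma(2j-\gamma)}{j!\,\Gamma([\gamma])\,\Gamma(1+j-[\gamma])\,\Gamma(-2j+\gamma)}.$$ (2) For $0\le j\le\lfloor\gamma\rfloor-\lfloor\gamma/2\rfloor-1$, $\;B^{2\gamma}_{2\lfloor\gamma\rfloor-2j}(V)=-d_{\gamma,j}(-\overline\Delta)^{\lfloor\gamma\rfloor-[\gamma]-2j}\phi^{(2j)}$, where $$d_{\gamma,j}=(-1)^{\lfloor\gamma\rfloor}2^{2[\gamma]-1}\frac{(\lfloor\gamma\rfloor-j)!\,\Gamma([\gamma])\,\Gamma(1+\lfloor\gamma\rfloor-j-[\gamma])\,\Gamma(2j-\lfloor\gamma\rfloor+[\gamma])}{j!\,\Gamma(1-[\gamma])\,\Gamma(1+j+[\gamma])\,\Gamma(-2j+\lfloor\gamma\rfloor-[\gamma])}.$$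 Here, for $s>0$ and $f\in H^s(\mathbb R^n)$, $(-\overline\Delta)^sf$ is the distribution whose Fourier transform is $|\xi|^{2s}\hat f(\xi)$ (with $\hat f(\xi)=\int f(x)e^{-ix\cdot\xi}\,dx$ for integrable $f$). The left-hand sides are smooth functions, and the equalities hold in the sense of distributions on $\mathbb R^n$. -/

import Mathlib

open MeasureTheory Filter Topology FourierTransform
open scoped SchwartzMap ContDiff Laplacian

noncomputable section

/-- `ℝⁿ` with its Euclidean norm. Functions on the upper half space `ℝⁿ × (0, ∞)` are written in
curried form `V x y` with `x : Rn n` and `y > 0`; no definition below depends on the values `V x y`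
with `y < 0`. Functions are complex valued, which includes the real-valued ones. -/
abbrev Rn (n : ℕ) := EuclideanSpace ℝ (Fin n)

variable {n : ℕ}

/-- The operator `T = ∂_y² + m y⁻¹ ∂_y` on functions of the normal variable `y > 0`. -/
def normalOp (m : ℝ) (u : ℝ → ℂ) : ℝ → ℂ :=
  fun y => deriv (deriv u) y + (m / y : ℝ) • deriv u y

/-- The weighted Laplacian `Δ_m = Δ + m y⁻¹ ∂_y`, where `Δ = Δ̄ + ∂_y²` is the Laplacian of
`ℝⁿ × (0, ∞)` and `Δ̄` is the Laplacian of `ℝⁿ`. -/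
def weightedLaplacian (m : ℝ) (V : Rn n → ℝ → ℂ) : Rn n → ℝ → ℂ :=
  fun x y => Δ (fun x' => V x' y) x + normalOp m (V x) y

/-- The weight `m = 1 - 2[γ]`, where `[γ]` is the fractional part of `γ`. -/
def weight (γ : ℝ) : ℝ := 1 - 2 * Int.fract γ

/-- The weighted poly-Laplacian `L_{2k} = Δ_m ^ k` with `k = ⌊γ⌋ + 1` and `m = 1 - 2[γ]`. -/
def polyLaplacian (γ : ℝ) (V : Rn n → ℝ → ℂ) : Rn n → ℝ → ℂ :=
  (weightedLaplacian (weight γ))^[⌊γ⌋₊ + 1] V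

/-- `C^∞_even`: functions smooth on the closed half space `{y ≥ 0}`, up to the boundary, whose Taylor
expansion in `y` at `y = 0` contains only even powers of `y`. -/
def IsSmoothEven (F : Rn n → ℝ → ℂ) : Prop :=
  ContDiffOn ℝ ∞ (Function.uncurry F) (Set.univ ×ˢ Set.Ici 0) ∧
    ∀ (x : Rn n) (j : ℕ), iteratedDerivWithin (2 * j + 1) (F x) (Set.Ici 0) 0 = 0

/-- The space `C^{2γ} = C^∞_even + y^{2[γ]} C^∞_even`. -/
def MemC (γ : ℝ) (V : Rn n → ℝ → ℂ) : Prop :=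
  ∃ F G : Rn n → ℝ → ℂ, IsSmoothEven F ∧ IsSmoothEven G ∧
    ∀ (x : Rn n) (y : ℝ), 0 < y → V x y = F x y + (y ^ (2 * Int.fract γ) : ℝ) • G x y

/-- The restriction `ι^* U` of `U` to the boundary `ℝⁿ`: the value at `x` is the limit of `U x y` as
`y → 0⁺`. All the restrictions used below exist for `V` in `C^{2γ}`. -/
def boundaryTrace (U : Rn n → ℝ → ℂ) : Rn n → ℂ :=
  fun x => limUnder (𝓝[>] (0 : ℝ)) (U x)

/-- The boundary operators `B_{2j}^{2γ}`, defined by recursion on `j`. With `ℓ = j - i` the sum is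
`∑_{ℓ=1}^{j} binom(j,ℓ) Γ(1+j-[γ]) Γ(1+2j-2ℓ-γ) / (Γ(1+j-ℓ-[γ]) Γ(1+2j-ℓ-γ)) Δ̄^ℓ B_{2j-2ℓ}`. -/
def bEven (γ : ℝ) (j : ℕ) (V : Rn n → ℝ → ℂ) : Rn n → ℂ :=
  ((-1 : ℝ) ^ j) • boundaryTrace (fun x => (normalOp (weight γ))^[j] (V x)) -
    ∑ i : Fin j,
      ((j.choose (j - i) : ℝ) *
        (Real.Gamma (1 + j - Int.fract γ) * Real.Gamma (1 + 2 * (i : ℕ) - γ)) /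
        (Real.Gamma (1 + (i : ℕ) - Int.fract γ) * Real.Gamma (1 + j + (i : ℕ) - γ))) •
      (fun g : Rn n → ℂ => Δ g)^[j - i] (bEven γ i V)
termination_by j
decreasing_by exact i.isLt

/-- The boundary operators `B_{2[γ]+2j}^{2γ}`, defined by recursion on `j`. With `ℓ = j - i` the sum
is `∑_{ℓ=1}^{j} binom(j,ℓ) Γ(1+j+[γ]) Γ(1+2j-2ℓ-⌊γ⌋+[γ]) /
(Γ(1+j-ℓ+[γ]) Γ(1+2j-ℓ-⌊γ⌋+[γ])) Δ̄^ℓ B_{2[γ]+2j-2ℓ}`. -/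
def bOdd (γ : ℝ) (j : ℕ) (V : Rn n → ℝ → ℂ) : Rn n → ℂ :=
  ((-1 : ℝ) ^ (j + 1)) • boundaryTrace
      (fun x y => (y ^ weight γ : ℝ) • deriv ((normalOp (weight γ))^[j] (V x)) y) -
    ∑ i : Fin j,
      ((j.choose (j - i) : ℝ) *
        (Real.Gamma (1 + j + Int.fract γ) *
          Real.Gamma (1 + 2 * (i : ℕ) - ⌊γ⌋₊ + Int.fract γ)) /
        (Real.Gamma (1 + (i : ℕ) + Int.fract γ) *
          Real.Gamma (1 + j + (i : ℕ) - ⌊γ⌋₊ + Int.fract γ))) •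
      (fun g : Rn n → ℂ => Δ g)^[j - i] (bOdd γ i V)
termination_by j
decreasing_by exact i.isLt

/-- `f` belongs to the Sobolev space `H^s(ℝⁿ)` (used for `s > 0`): `f` is in `L²` and the tempered
distribution it defines is a Sobolev distribution of order `s`. -/
def MemHs (s : ℝ) (f : Rn n → ℂ) : Prop :=
  ∃ h : MemLp f 2 volume,
    TemperedDistribution.MemSobolev s 2 ((h.toLp f : Lp ℂ 2 (volume : Measure (Rn n))) : 𝓢'(Rn n, ℂ))

/-- The element of `L²(ℝⁿ)` defined by a function in `H^s(ℝⁿ)`. -/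
def MemHs.toL2 {s : ℝ} {f : Rn n → ℂ} (h : MemHs s f) : Lp ℂ 2 (volume : Measure (Rn n)) :=
  h.choose.toLp f

/-- The fractional Laplacian `(-Δ̄)^s f` of `f` in `H^s(ℝⁿ)`: the distribution with Fourier transform
`|2πξ|^{2s} 𝓕f(ξ)` (for the Fourier transform with kernel `exp(-2πi⟨x,ξ⟩)`). It is given by its
pairing with a test function `ψ`, namely `∫ |2πξ|^{2s} 𝓕f(ξ) 𝓕⁻¹ψ(ξ) dξ`, where the integral is
absolutely convergent because `|ξ|^s 𝓕f` and `|ξ|^s 𝓕⁻¹ψ` are in `L²`. -/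
def fractionalLaplacian (s : ℝ) (f : Rn n → ℂ) (h : MemHs s f) (ψ : 𝓢(Rn n, ℂ)) : ℂ :=
  ∫ ξ : Rn n, ((2 * Real.pi * ‖ξ‖) ^ (2 * s) : ℝ) •
    ((𝓕 h.toL2 : Lp ℂ 2 (volume : Measure (Rn n))) ξ * (𝓕⁻ ψ : 𝓢(Rn n, ℂ)) ξ)

/-- `g` is a smooth function and `g = c (-Δ̄)^s f` in the sense of distributions, that is, tested
against all smooth functions with compact support. -/
def EqSmulFractionalLaplacian (g : Rn n → ℂ) (c s : ℝ) (f : Rn n → ℂ) (h : MemHs s f) : Prop :=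
  ContDiff ℝ ∞ g ∧ ∀ ψ : 𝓢(Rn n, ℂ), HasCompactSupport ψ →
    ∫ x, g x * ψ x = (c : ℂ) * fractionalLaplacian s f h ψ

/-- `V(·, y)` is in `L²(ℝⁿ)` for every `y > 0`, with norm bounded for bounded `y` and growing at most
polynomially as `y → ∞`. -/
def HasModerateL2Growth (V : Rn n → ℝ → ℂ) : Prop :=
  ∃ (C : ℝ) (N : ℕ), ∀ y : ℝ, 0 < y → MemLp (fun x => V x y) 2 volume ∧
    eLpNorm (fun x => V x y) 2 volume ≤ ENNReal.ofReal (C * (1 + y) ^ N)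

/-- `V` solves the Dirichlet problem for `L_{2k}` with data `f j = f^{(2j)}`, `0 ≤ j ≤ ⌊γ/2⌋`, and
`φ j = φ^{(2j)}`, `0 ≤ j ≤ ⌊γ⌋ - ⌊γ/2⌋ - 1` (the other values of `f` and `φ` are irrelevant). Solutions
lie in `C^{2γ}`; the growth condition excludes functions such as `y^{2γ}`, which solve the problem
with zero data. -/
structure IsDirichletSolution (γ : ℝ) (f φ : ℕ → Rn n → ℂ) (V : Rn n → ℝ → ℂ) : Prop where
  memC : MemC γ V
  growth : HasModerateL2Growth V
  eqn : ∀ (x : Rn n) (y : ℝ), 0 < y → polyLaplacian γ V x y = 0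
  bEven_eq : ∀ j : ℕ, j ≤ ⌊γ / 2⌋₊ → bEven γ j V = f j
  bOdd_eq : ∀ j : ℕ, j < ⌊γ⌋₊ - ⌊γ / 2⌋₊ → bOdd γ j V = φ j

/-- The constant `c_{γ,j}`. -/
def cConst (γ : ℝ) (j : ℕ) : ℝ :=
  (-1) ^ (1 + ⌊γ⌋₊) * 2 ^ (1 - 2 * Int.fract γ) *
    ((⌊γ⌋₊ - j).factorial * Real.Gamma (1 - Int.fract γ) * Real.Gamma (1 - j + γ) *
      Real.Gamma (2 * j - γ)) /
    (j.factorial * Real.Gamma (Int.fract γ) * Real.Gamma (1 + j - Int.fract γ) *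
      Real.Gamma (-2 * j + γ))

/-- The constant `d_{γ,j}`. -/
def dConst (γ : ℝ) (j : ℕ) : ℝ :=
  (-1) ^ ⌊γ⌋₊ * 2 ^ (2 * Int.fract γ - 1) *
    ((⌊γ⌋₊ - j).factorial * Real.Gamma (Int.fract γ) *
      Real.Gamma (1 + ⌊γ⌋₊ - j - Int.fract γ) * Real.Gamma (2 * j - ⌊γ⌋₊ + Int.fract γ)) /
    (j.factorial * Real.Gamma (1 - Int.fract γ) * Real.Gamma (1 + j + Int.fract γ) *
      Real.Gamma (-2 * j + ⌊γ⌋₊ - Int.fract γ))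

end

/-! Write `a` for the fractional part of `γ`, `N` for its integer part, `k = N + 1`. At a frequency
of length `R > 0` the equation reads `(T - R²)^k v = 0`, with `v` an even function plus `y^(2a)`
times an even function. Since `T = (T - R²) + R²` and the powers of `T - R²` from the `k`-th on kill
`v`, the trace of `T^n v` is `R^(2n)` times a polynomial in `n` of degree at most `N`; so is the
coefficient of the `n`-th normalized power `y^(2a+2n)` in `v`.

The Gamma quotients in the boundary operators are explained by the polynomials `p_i(x) =
x(x-1)⋯(x-i+1) · (x+b)(x+b-1)⋯(x+b-N+i+1)`, with `b = -a` for the even operators and `b = a` for the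
others. Their values at `0, …, N` are triangular, and the recursion coefficients are the ratios
`p_i(j)/p_i(i)` (`gammaCoeff_mul_eval`). The recursion thus computes, up to explicit factors, the
coordinates of the trace polynomial in the basis `p_i` (`sum_choose_eq_sum_interpPoly`). Moreover
the series with coefficients `p_i(n)/(n! Γ(1+n+b))` is a single modified Bessel function
(`hasSum_besTerm_interpPoly`). With `z = R²y²/4` and `ν_i = γ - 2i`, the data `B_{2i}` multiply `z^i
I_{-ν_i}`, and `B_{2γ-2i}` multiplies `z^i z^(ν_i) I_{ν_i}`, in the normalization of `besI`. The
combination `K_ν` of the two is bounded for large `z` (`besKExpansion`, `exists_besK_le`). After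
subtraction of the `K` terms, polynomial growth of `v` forces the remaining `I` terms to vanish
(`eq_zero_of_isBigO`). This ties `B_{2γ-2j}` to `B_{2j}` by the factor `c_{γ,j} R^(2(γ-2j))`
(`odd_symbol_eq`, `dnConst_eq_cConst`). Part (2) is the same relation solved for the even operator,
since `-d_{γ,j}` is the inverse of `c_{γ,N-j}`.

The analytic difficulty is to reach a fixed frequency: the slices of `V` are in `L²`, but nothing is
assumed about the integrability of its `y`-derivatives or traces. The equation is therefore tested
against `(-Δ̄)^l ψ` with `ψ` compactly supported and integrated in `y`. The Volterra inverse of `T`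
turns it into `(1 - X)^k u =` boundary terms, where `(X u) l = T⁻¹ (u (l+1))`
(`one_sub_invShift_pow_testLoc`). The boundary terms are finite sums of powers of `y` and the other
side is controlled by the `L²` bound, so evaluation at finitely many `y` bounds each trace in a
weighted Fourier norm. Hence the traces are given by symbols (`exists_trace_symbols`).

By density the equation then holds with the Fourier transform of `ψ` replaced by a power of the
frequency cut off to a compact set. There the sequence in `l` has geometric growth, while iterates
of `T⁻¹` decay factorially, so `(1 - X)^k` is injective and an explicit series is the only solution
(`hasSum_of_one_sub_invShift_pow`). Arbitrary compact sets give the series at almost every frequency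
(`sliceFourier_ae_eq`), and square summation over integer heights gives polynomial growth there
(`HasModerateL2Growth.ae_bounded`). The scalar argument then applies. -/

noncomputable section

/-! ### The inverse of the normal operator on locally bounded functions -/

/-- Measurable functions supported in `(0, ∞)` which are bounded on bounded sets. -/
def LocBdd : Submodule ℂ (ℝ → ℂ) where
  carrier := {u | Measurable u ∧ (∀ y ≤ 0, u y = 0) ∧ ∀ Y : ℝ, ∃ M : ℝ, ∀ y ≤ Y, ‖u y‖ ≤ M}
  zero_mem' := ⟨measurable_zero, fun _ _ => rfl, fun _ => ⟨0, fun _ _ => by simp⟩⟩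
  add_mem' := by
    rintro u v ⟨hu, hu0, hub⟩ ⟨hv, hv0, hvb⟩
    refine ⟨hu.add hv, fun y hy => by simp [hu0 y hy, hv0 y hy], fun Y => ?_⟩
    obtain ⟨M, hM⟩ := hub Y
    obtain ⟨M', hM'⟩ := hvb Y
    exact ⟨M + M', fun y hy => (norm_add_le _ _).trans (add_le_add (hM y hy) (hM' y hy))⟩
  smul_mem' := by
    rintro c u ⟨hu, hu0, hub⟩
    refine ⟨hu.const_smul c, fun y hy => by simp [hu0 y hy], fun Y => ?_⟩
    obtain ⟨M, hM⟩ := hub Y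
    refine ⟨‖c‖ * M, fun y hy => ?_⟩
    rw [Pi.smul_apply, norm_smul]
    exact mul_le_mul_of_nonneg_left (hM y hy) (norm_nonneg _)

/-- The Green kernel of `T` on `(0, y)`. -/
def greenKernel (a y t : ℝ) : ℝ := t ^ (1 - 2 * a) * (y ^ (2 * a) - t ^ (2 * a)) / (2 * a)

lemma greenKernel_nonneg {a y t : ℝ} (ha : 0 < a) (ht : 0 < t) (hty : t ≤ y) :
    0 ≤ greenKernel a y t := by
  unfold greenKernel
  have := Real.rpow_le_rpow ht.le hty (by positivity : 0 ≤ 2 * a)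
  have h2 := Real.rpow_nonneg ht.le (1 - 2 * a)
  exact div_nonneg (mul_nonneg h2 (by linarith)) (by positivity)

lemma greenKernel_eq {a y t : ℝ} (ht : 0 < t) :
    greenKernel a y t = (2 * a)⁻¹ * (y ^ (2 * a) * t ^ (1 - 2 * a) - t) := by
  unfold greenKernel
  have : t ^ (1 - 2 * a) * t ^ (2 * a) = t := by
    rw [← Real.rpow_add ht]; simp
  rw [mul_sub, this, div_eq_mul_inv]; ring

lemma integral_Ioc_rpow {p y : ℝ} (hp : -1 < p) (hy : 0 < y) :
    ∫ t in Set.Ioc 0 y, t ^ p = y ^ (p + 1) / (p + 1) := by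
  rw [← intervalIntegral.integral_of_le hy.le, integral_rpow (Or.inl hp),
    Real.zero_rpow (by linarith), sub_zero]

lemma integrableOn_Ioc_rpow {p : ℝ} (hp : -1 < p) (y : ℝ) :
    IntegrableOn (fun t : ℝ => t ^ p) (Set.Ioc 0 y) := by
  rcases le_or_gt y 0 with h | h
  · simp [Set.Ioc_eq_empty_of_le h]
  · exact (intervalIntegrable_iff_integrableOn_Ioc_of_le h.le).1
      (intervalIntegral.intervalIntegrable_rpow' hp)

/-- The denominator comes from `T y^(p+2) = (p+2)(p+2-2a) y^p`; no boundary term appears because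
`y^(p+2)` and its conormal derivative vanish at `0`. -/
lemma integral_greenKernel_rpow {a p y : ℝ} (ha : 0 < a) (ha1 : a < 1) (hp : 0 ≤ p) (hy : 0 < y) :
    ∫ t in Set.Ioc 0 y, greenKernel a y t * t ^ p = y ^ (p + 2) / ((p + 2) * (p + 2 - 2 * a)) := by
  have h1 : ∀ t ∈ Set.Ioc 0 y, greenKernel a y t * t ^ p =
      (2 * a)⁻¹ * (y ^ (2 * a) * t ^ (1 - 2 * a + p) - t ^ (1 + p)) := by
    intro t ht
    rw [greenKernel_eq ht.1, Real.rpow_add ht.1, Real.rpow_add ht.1, Real.rpow_one]; ring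
  rw [setIntegral_congr_fun measurableSet_Ioc h1, integral_const_mul, integral_sub,
    integral_const_mul, integral_Ioc_rpow (by linarith) hy, integral_Ioc_rpow (by linarith) hy]
  · have h2 : y ^ (2 * a) * y ^ (1 - 2 * a + p + 1) = y ^ (p + 2) := by
      rw [← Real.rpow_add hy]; congr 1; ring
    rw [← mul_div_assoc, h2, show 1 + p + 1 = p + 2 by ring]
    have : 1 - 2 * a + p + 1 ≠ 0 := by linarith
    have : p + 2 ≠ 0 := by linarith
    have : p + 2 - 2 * a ≠ 0 := by linarith
    field_simp
    ring
  · exact (integrableOn_Ioc_rpow (by linarith) y).const_mul _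
  · exact integrableOn_Ioc_rpow (by linarith) y

lemma integrableOn_rpow_mul {p : ℝ} (hp : -1 < p) (u : LocBdd) (y : ℝ) :
    IntegrableOn (fun t : ℝ => ((t ^ p : ℝ) : ℂ) * (u : ℝ → ℂ) t) (Set.Ioc 0 y) := by
  obtain ⟨M, hM⟩ := u.2.2.2 y
  refine Integrable.mul_bdd (c := M) (integrableOn_Ioc_rpow hp y).ofReal
    u.2.1.aestronglyMeasurable ?_
  filter_upwards [ae_restrict_mem measurableSet_Ioc] with t ht using hM t ht.2

lemma greenKernel_mul_eq {a y t : ℝ} (ht : 0 < t) (c : ℂ) :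
    (greenKernel a y t : ℂ) * c = (((2 * a)⁻¹ * y ^ (2 * a) : ℝ) : ℂ) *
      (((t ^ (1 - 2 * a) : ℝ) : ℂ) * c) - (((2 * a)⁻¹ : ℝ) : ℂ) * (((t ^ (1 : ℝ) : ℝ) : ℂ) * c) := by
  rw [greenKernel_eq ht, Real.rpow_one]; push_cast; ring

lemma integrableOn_greenKernel_mul {a : ℝ} (ha1 : a < 1) (u : LocBdd) (y : ℝ) :
    IntegrableOn (fun t : ℝ => (greenKernel a y t : ℂ) * (u : ℝ → ℂ) t) (Set.Ioc 0 y) := by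
  refine IntegrableOn.congr_fun (Integrable.sub
    ((integrableOn_rpow_mul (p := 1 - 2 * a) (by linarith) u y).const_mul
      (((2 * a)⁻¹ * y ^ (2 * a) : ℝ) : ℂ))
    ((integrableOn_rpow_mul (p := 1) (by linarith) u y).const_mul (((2 * a)⁻¹ : ℝ) : ℂ)))
    ?_ measurableSet_Ioc
  intro t ht
  exact (greenKernel_mul_eq ht.1 _).symm

lemma measurable_setIntegral_Ioc {f : ℝ → ℂ} (hf : ∀ y, IntegrableOn f (Set.Ioc 0 y)) :
    Measurable fun y => ∫ t in Set.Ioc 0 y, f t := by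
  set g : ℝ → ℂ := (Set.Ioi 0).indicator f with hg
  have hgi : ∀ a b, IntervalIntegrable g volume a b := by
    intro a b
    have : IntegrableOn g (Set.Ioc (min a b) (max a b)) := by
      rw [hg, integrableOn_indicator_iff measurableSet_Ioi]
      refine (hf (max a b)).mono_set ?_
      rintro x ⟨h1, h2⟩
      exact ⟨h1, h2.2⟩
    exact intervalIntegrable_iff.2 this
  have h2 : (fun y => ∫ t in Set.Ioc 0 y, f t) = fun y => ∫ t in (0 : ℝ)..(max y 0), g t := by
    funext y
    rw [intervalIntegral.integral_of_le (le_max_right _ _)]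
    rcases le_or_gt y 0 with h | h
    · simp [h]
    · rw [max_eq_left h.le]
      refine setIntegral_congr_fun measurableSet_Ioc fun t ht => ?_
      simp [hg, ht.1]
  rw [h2]
  exact ((intervalIntegral.continuous_primitive hgi 0).comp
    (continuous_id.max continuous_const)).measurable

/-- The values of the inverse of `T` which vanishes, with its conormal derivative, at `0`. -/
def normalInvFun (a : ℝ) (u : ℝ → ℂ) (y : ℝ) : ℂ :=
  ∫ t in Set.Ioc 0 y, (greenKernel a y t : ℂ) * u t

/-- The Green kernel is nonnegative, so comparison with a power suffices. Each application gains
`y²` and a denominator, which accumulates to a factorial under iteration. -/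
lemma norm_normalInvFun_le {a p M y Y : ℝ} (ha : 0 < a) (ha1 : a < 1) (hp : 0 ≤ p) {u : ℝ → ℂ}
    (hu : ∀ t, 0 < t → t ≤ Y → ‖u t‖ ≤ M * t ^ p) (hy : 0 < y) (hyY : y ≤ Y) :
    ‖normalInvFun a u y‖ ≤ M * (y ^ (p + 2) / ((p + 2) * (p + 2 - 2 * a))) := by
  rw [← integral_greenKernel_rpow ha ha1 hp hy, ← integral_const_mul]
  refine norm_integral_le_of_norm_le (Integrable.const_mul ?_ M) ?_
  · refine IntegrableOn.congr_fun (Integrable.const_mul (c := (2 * a)⁻¹) (Integrable.sub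
      ((integrableOn_Ioc_rpow (p := 1 - 2 * a + p) (by linarith) y).const_mul (y ^ (2 * a)))
      (integrableOn_Ioc_rpow (p := 1 + p) (by linarith) y))) ?_ measurableSet_Ioc
    intro t ht
    simp only [Pi.sub_apply]
    rw [greenKernel_eq ht.1, Real.rpow_add ht.1, Real.rpow_add ht.1, Real.rpow_one]; ring
  · filter_upwards [ae_restrict_mem measurableSet_Ioc] with t ht
    rw [norm_mul, Complex.norm_real, Real.norm_of_nonneg (greenKernel_nonneg ha ht.1 ht.2)]
    calc greenKernel a y t * ‖u t‖ ≤ greenKernel a y t * (M * t ^ p) :=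
          mul_le_mul_of_nonneg_left (hu t ht.1 (ht.2.trans hyY)) (greenKernel_nonneg ha ht.1 ht.2)
      _ = _ := by ring

lemma normalInvFun_of_nonpos (a : ℝ) (u : ℝ → ℂ) {y : ℝ} (hy : y ≤ 0) : normalInvFun a u y = 0 := by
  simp [normalInvFun, Set.Ioc_eq_empty_of_le hy]

lemma normalInvFun_mem {a : ℝ} (ha : 0 < a) (ha1 : a < 1) (u : LocBdd) :
    normalInvFun a u ∈ LocBdd := by
  refine ⟨?_, fun y hy => normalInvFun_of_nonpos a _ hy, fun Y => ?_⟩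
  -- Expanding the kernel takes `y` out of the integrands and leaves two primitives, which are
  -- measurable in `y`.
  · have h : normalInvFun a u = fun y => (((2 * a)⁻¹ * y ^ (2 * a) : ℝ) : ℂ) *
        (∫ t in Set.Ioc 0 y, ((t ^ (1 - 2 * a) : ℝ) : ℂ) * (u : ℝ → ℂ) t) -
        (((2 * a)⁻¹ : ℝ) : ℂ) * ∫ t in Set.Ioc 0 y, ((t ^ (1 : ℝ) : ℝ) : ℂ) * (u : ℝ → ℂ) t := by
      funext y
      rw [normalInvFun, setIntegral_congr_fun measurableSet_Ioc
        (fun t ht => greenKernel_mul_eq (a := a) (y := y) ht.1 _), integral_sub,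
        integral_const_mul, integral_const_mul]
      · exact (integrableOn_rpow_mul (by linarith) u y).const_mul _
      · exact (integrableOn_rpow_mul (by linarith) u y).const_mul _
    rw [h]
    refine Measurable.sub (Measurable.mul ?_ ?_) (Measurable.mul measurable_const ?_)
    · exact Complex.measurable_ofReal.comp (by fun_prop)
    · exact measurable_setIntegral_Ioc fun y => integrableOn_rpow_mul (by linarith) u y
    · exact measurable_setIntegral_Ioc fun y => integrableOn_rpow_mul (by linarith) u y
  · obtain ⟨M, hM⟩ := u.2.2.2 Y
    refine ⟨max 0 (M * (Y ^ ((0 : ℝ) + 2) / ((0 + 2) * (0 + 2 - 2 * a)))), fun y hy => ?_⟩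
    rcases le_or_gt y 0 with h | h
    · simp [normalInvFun_of_nonpos a _ h]
    · refine (norm_normalInvFun_le ha ha1 le_rfl (Y := Y) (M := M) ?_ h hy).trans ?_
      · intro t _ ht; simpa using hM t ht
      · refine le_trans ?_ (le_max_right _ _)
        have hM0 : 0 ≤ M := (norm_nonneg _).trans (hM y hy)
        have := Real.rpow_le_rpow h.le hy (by norm_num : (0 : ℝ) ≤ 0 + 2)
        have h3 : (0 : ℝ) ≤ (0 + 2) * (0 + 2 - 2 * a) := by nlinarith
        gcongr

/-- The fractional weight exponent `a` of the normal operator, as an element of `(0, 1)`. -/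
abbrev UnitExp := {a : ℝ // 0 < a ∧ a < 1}

/-- The inverse of `T` as a linear operator. -/
def normalInv (a : UnitExp) : Module.End ℂ LocBdd where
  toFun u := ⟨normalInvFun a u, normalInvFun_mem a.2.1 a.2.2 u⟩
  map_add' u v := by
    ext y
    simp only [normalInvFun, Submodule.coe_add, Pi.add_apply, mul_add]
    exact integral_add (integrableOn_greenKernel_mul a.2.2 u y)
      (integrableOn_greenKernel_mul a.2.2 v y)
  map_smul' c u := by
    ext y
    simp only [normalInvFun, Submodule.coe_smul, Pi.smul_apply, smul_eq_mul, RingHom.id_apply]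
    rw [← integral_const_mul]
    congr 1; ext t; ring

lemma normalInv_apply (a : UnitExp) (u : LocBdd) (y : ℝ) :
    (normalInv a u : ℝ → ℂ) y = normalInvFun a u y := rfl

/-- The constants `T ^ n y ^ (b + 2 n) / y ^ b`, for `b = 0` or `b = 2 a`. -/
def powConst (a b : ℝ) (n : ℕ) : ℝ :=
  ∏ i ∈ Finset.range n, ((2 * i + 2 + b) * (2 * i + 2 + b - 2 * a))

lemma powConst_succ (a b : ℝ) (n : ℕ) :
    powConst a b (n + 1) = powConst a b n * ((2 * n + 2 + b) * (2 * n + 2 + b - 2 * a)) :=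
  Finset.prod_range_succ _ _

/-- The factor with index `i` is at least `(2i+2)(2-2a) = 4(1-a)(i+1)`. This factorial growth makes
every series below converge. -/
lemma powConst_ge {a b : ℝ} (ha : 0 < a) (ha1 : a < 1) (hb : 0 ≤ b) (n : ℕ) :
    (4 * (1 - a)) ^ n * n.factorial ≤ powConst a b n := by
  induction n with
  | zero => simp [powConst]
  | succ n ih =>
    rw [powConst_succ, pow_succ, Nat.factorial_succ]
    push_cast
    have hn : (0 : ℝ) ≤ n := Nat.cast_nonneg n
    calc (4 * (1 - a)) ^ n * (4 * (1 - a)) * (((n : ℝ) + 1) * n.factorial)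
        = ((4 * (1 - a)) ^ n * n.factorial) * ((2 * n + 2) * (2 - 2 * a)) := by ring
      _ ≤ _ := by
        have h0 : 0 ≤ (4 * (1 - a)) ^ n * (n.factorial : ℝ) := by
          have : 0 ≤ 4 * (1 - a) := by linarith
          positivity
        refine mul_le_mul ih ?_ ?_ (h0.trans ih)
        · refine mul_le_mul ?_ ?_ ?_ ?_ <;> linarith
        · have : (0 : ℝ) ≤ 2 - 2 * a := by linarith
          positivity

lemma powConst_pos {a b : ℝ} (ha : 0 < a) (ha1 : a < 1) (hb : 0 ≤ b) (n : ℕ) :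
    0 < powConst a b n := by
  refine lt_of_lt_of_le ?_ (powConst_ge ha ha1 hb n)
  have : 0 < 4 * (1 - a) := by linarith
  positivity

/-- The normalized power `y ^ (b + 2 n) / powConst a b n`. -/
def powFun (a b : ℝ) (n : ℕ) (y : ℝ) : ℝ := y ^ (b + 2 * n) / powConst a b n

lemma powFun_nonneg {a b : ℝ} (ha : 0 < a) (ha1 : a < 1) (hb : 0 ≤ b) (n : ℕ) {y : ℝ}
    (hy : 0 ≤ y) : 0 ≤ powFun a b n y :=
  div_nonneg (Real.rpow_nonneg hy _) (powConst_pos ha ha1 hb n).le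

lemma powFun_le {a b : ℝ} (ha : 0 < a) (ha1 : a < 1) (hb : 0 ≤ b) (n : ℕ) {y : ℝ}
    (hy : 0 < y) : powFun a b n y ≤ y ^ b * ((y ^ 2 / (4 * (1 - a))) ^ n / n.factorial) := by
  unfold powFun
  rw [Real.rpow_add hy, div_pow, mul_div_assoc]
  have h1 : y ^ (2 * (n : ℝ)) = (y ^ 2) ^ n := by
    rw [Real.rpow_mul hy.le]; simp
  have h2 : 0 < 4 * (1 - a) := by linarith
  rw [h1, div_div]
  have := powConst_ge ha ha1 hb n
  gcongr

lemma powFun_mono {a b : ℝ} (ha : 0 < a) (ha1 : a < 1) (hb : 0 ≤ b) (n : ℕ) {y Y : ℝ}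
    (hy : 0 ≤ y) (hyY : y ≤ Y) : powFun a b n y ≤ powFun a b n Y := by
  unfold powFun
  have := powConst_pos ha ha1 hb n
  gcongr

/-- The normalized powers as locally bounded functions. -/
def powLoc (a : UnitExp) {b : ℝ} (hb : 0 ≤ b) (n : ℕ) : LocBdd :=
  ⟨(Set.Ioi 0).indicator fun y => (powFun a b n y : ℂ), by
    refine ⟨?_, fun y hy => by simp [hy], fun Y => ⟨max 0 (powFun a b n Y), fun y hy => ?_⟩⟩
    · exact Measurable.indicator (Complex.measurable_ofReal.comp (by unfold powFun; fun_prop))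
        measurableSet_Ioi
    · by_cases h : 0 < y
      · rw [Set.indicator_of_mem (by exact h), Complex.norm_real,
          Real.norm_of_nonneg (powFun_nonneg a.2.1 a.2.2 hb n h.le)]
        exact (powFun_mono a.2.1 a.2.2 hb n h.le hy).trans (le_max_right _ _)
      · rw [Set.indicator_of_notMem (by exact h)]; simp⟩

lemma powLoc_apply (a : UnitExp) {b : ℝ} (hb : 0 ≤ b) (n : ℕ) {y : ℝ} (hy : 0 < y) :
    (powLoc a hb n : ℝ → ℂ) y = powFun a b n y := by
  simp [powLoc, hy]

lemma LocBdd.ext_pos {u v : LocBdd} (h : ∀ y, 0 < y → (u : ℝ → ℂ) y = (v : ℝ → ℂ) y) : u = v := by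
  ext y
  rcases le_or_gt y 0 with hy | hy
  · rw [u.2.2.1 y hy, v.2.2.1 y hy]
  · exact h y hy

lemma normalInv_powLoc (a : UnitExp) {b : ℝ} (hb : 0 ≤ b) (n : ℕ) :
    normalInv a (powLoc a hb n) = powLoc a hb (n + 1) := by
  refine LocBdd.ext_pos fun y hy => ?_
  rw [normalInv_apply, powLoc_apply a hb _ hy, normalInvFun]
  have h : ∀ t ∈ Set.Ioc 0 y, (greenKernel a y t : ℂ) * (powLoc a hb n : ℝ → ℂ) t =
      ((greenKernel a y t * t ^ (b + 2 * n) / powConst a b n : ℝ) : ℂ) := by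
    intro t ht
    rw [powLoc_apply a hb _ ht.1, powFun]; push_cast; ring
  rw [setIntegral_congr_fun measurableSet_Ioc h, integral_complex_ofReal, integral_div,
    integral_greenKernel_rpow a.2.1 a.2.2 (by positivity) hy, powFun, powConst_succ]
  push_cast
  rw [div_div, mul_comm (powConst (a : ℝ) b n : ℂ)]
  congr 3
  · ring
  · ring
  · ring

/-- Iterating the power comparison from the constant `M` reproduces exactly the normalized powers,
hence factorial decay in `n` at fixed `y`. -/
lemma norm_normalInv_pow_le (a : UnitExp) {M Y : ℝ} {u : LocBdd}
    (hu : ∀ t ≤ Y, ‖(u : ℝ → ℂ) t‖ ≤ M) (n : ℕ) {y : ℝ} (hy : 0 < y) (hyY : y ≤ Y) :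
    ‖((normalInv a ^ n) u : ℝ → ℂ) y‖ ≤ M * powFun a 0 n y := by
  induction n generalizing y with
  | zero => simpa [powFun, powConst] using hu y hyY
  | succ n ih =>
    rw [pow_succ', Module.End.mul_apply, normalInv_apply]
    have := norm_normalInvFun_le (a := a) (p := 0 + 2 * n) (M := M / powConst a 0 n) (Y := Y)
      (u := ((normalInv a ^ n) u : ℝ → ℂ)) a.2.1 a.2.2 (by positivity) ?_ hy hyY
    · refine this.trans (le_of_eq ?_)
      rw [powFun, powConst_succ, div_mul_div_comm, mul_div_assoc]
      push_cast
      congr 3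
      · ring
      · ring
    · intro t ht htY
      refine (ih ht htY).trans (le_of_eq ?_)
      rw [powFun]; ring

/-! ### Power series in the normalized powers -/

/-- Geometric growth of the coefficients is beaten by the factorial in `powFun`. The shift `i`
allows for applications of `T⁻¹` to the series. -/
lemma summable_powFun {a b : ℝ} (ha : 0 < a) (ha1 : a < 1) (hb : 0 ≤ b) {c : ℕ → ℂ} {M θ : ℝ}
    (hc : ∀ n, ‖c n‖ ≤ M * θ ^ n) (i : ℕ) {y : ℝ} (hy : 0 < y) :
    Summable fun n => ‖c n‖ * powFun a b (n + i) y := by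
  have h4 : 0 < 4 * (1 - a) := by linarith
  obtain ⟨z, hz⟩ : ∃ z, z = y ^ 2 / (4 * (1 - a)) := ⟨_, rfl⟩
  have hz0 : 0 < z := by rw [hz]; positivity
  have hM : 0 ≤ M := by have := (norm_nonneg _).trans (hc 0); simpa using this
  have hbound : ∀ n, ‖c n‖ * powFun a b (n + i) y ≤
      M * y ^ b * z ^ i * ((|θ| * z) ^ n / n.factorial) := by
    intro n
    have h1 : ‖c n‖ ≤ M * |θ| ^ n := by
      refine (hc n).trans (mul_le_mul_of_nonneg_left ?_ hM)
      rw [← abs_pow]; exact le_abs_self _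
    have h2 : powFun a b (n + i) y ≤ y ^ b * (z ^ (n + i) / n.factorial) := by
      refine (powFun_le ha ha1 hb _ hy).trans ?_
      rw [← hz]
      have h3 : (n.factorial : ℝ) ≤ (n + i).factorial :=
        Nat.cast_le.2 (Nat.factorial_le (Nat.le_add_right n i))
      have h4 : (0 : ℝ) < n.factorial := Nat.cast_pos.2 n.factorial_pos
      exact mul_le_mul_of_nonneg_left (div_le_div_of_nonneg_left (pow_pos hz0 _).le h4 h3)
        (Real.rpow_nonneg hy.le b)
    calc ‖c n‖ * powFun a b (n + i) y ≤ (M * |θ| ^ n) * (y ^ b * (z ^ (n + i) / n.factorial)) :=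
          mul_le_mul h1 h2 (powFun_nonneg ha ha1 hb _ hy.le)
            (mul_nonneg hM (pow_nonneg (abs_nonneg _) _))
      _ = _ := by rw [pow_add, mul_pow]; ring
  exact Summable.of_nonneg_of_le
    (fun n => mul_nonneg (norm_nonneg _) (powFun_nonneg ha ha1 hb _ hy.le)) hbound
    ((Real.summable_pow_div_factorial _).mul_left _)

/-- Geometrically bounded coefficient sequences. -/
def GeomCoeff (c : ℕ → ℂ) : Prop := ∃ M θ : ℝ, ∀ n, ‖c n‖ ≤ M * θ ^ n

lemma hasSum_powFun (a : UnitExp) {b : ℝ} (hb : 0 ≤ b) {c : ℕ → ℂ} (hc : GeomCoeff c) (i : ℕ)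
    {y : ℝ} (hy : 0 < y) :
    HasSum (fun n => c n * powFun a b (n + i) y) (∑' n, c n * (powFun a b (n + i) y : ℂ)) := by
  obtain ⟨M, θ, h⟩ := hc
  refine Summable.hasSum (Summable.of_norm ?_)
  refine (summable_powFun a.2.1 a.2.2 hb h i hy).congr fun n => ?_
  rw [norm_mul, Complex.norm_real, Real.norm_of_nonneg (powFun_nonneg a.2.1 a.2.2 hb _ hy.le)]

/-- The sum of a series in the normalized powers, as a locally bounded function. -/
def powSeries (a : UnitExp) {b : ℝ} (hb : 0 ≤ b) (c : ℕ → ℂ) (hc : GeomCoeff c) : LocBdd :=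
  ⟨(Set.Ioi 0).indicator fun y => ∑' n, c n * (powFun a b n y : ℂ), by
    refine ⟨?_, fun y hy => by simp [hy], fun Y => ?_⟩
    · refine measurable_of_tendsto_metrizable
        (f := fun I => (Set.Ioi 0).indicator fun y => ∑ n ∈ Finset.range I, c n * (powFun a b n y : ℂ))
        (fun I => Measurable.indicator ?_ measurableSet_Ioi) ?_
      · refine Finset.measurable_sum _ fun n _ => ?_
        exact measurable_const.mul (Complex.measurable_ofReal.comp (by unfold powFun; fun_prop))
      · rw [tendsto_pi_nhds]
        intro y
        by_cases h : 0 < y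
        · simp only [Set.indicator_of_mem (show y ∈ Set.Ioi (0 : ℝ) from h)]
          exact (hasSum_powFun a hb hc 0 h).tendsto_sum_nat
        · simp only [Set.indicator_of_notMem (show y ∉ Set.Ioi (0 : ℝ) from h)]
          exact tendsto_const_nhds
    · refine ⟨∑' n, ‖c n‖ * powFun a b n (max Y 1), fun y hy => ?_⟩
      have hY : (0 : ℝ) < max Y 1 := lt_max_of_lt_right one_pos
      obtain ⟨M, θ, h⟩ := hc
      have hs := summable_powFun a.2.1 a.2.2 hb h 0 hY
      by_cases h0 : 0 < y
      · rw [Set.indicator_of_mem (show y ∈ Set.Ioi (0 : ℝ) from h0)]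
        refine tsum_of_norm_bounded hs.hasSum fun n => ?_
        rw [norm_mul, Complex.norm_real,
          Real.norm_of_nonneg (powFun_nonneg a.2.1 a.2.2 hb _ h0.le)]
        exact mul_le_mul_of_nonneg_left
          (powFun_mono a.2.1 a.2.2 hb _ h0.le (hy.trans (le_max_left _ _))) (norm_nonneg _)
      · rw [Set.indicator_of_notMem (show y ∉ Set.Ioi (0 : ℝ) from h0), norm_zero]
        exact tsum_nonneg fun n => mul_nonneg (norm_nonneg _) (powFun_nonneg a.2.1 a.2.2 hb _ hY.le)⟩

lemma powSeries_apply (a : UnitExp) {b : ℝ} (hb : 0 ≤ b) {c : ℕ → ℂ} (hc : GeomCoeff c) {y : ℝ}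
    (hy : 0 < y) :
    (powSeries a hb c hc : ℝ → ℂ) y = ∑' n, c n * (powFun a b n y : ℂ) := by
  simp [powSeries, hy]

/-- Termwise, `T⁻¹` shifts the normalized powers by one; positivity of kernel and powers makes the
sum of the integrals of the norms a convergent series of the same kind, which justifies the
exchange. -/
lemma normalInv_powSeries (a : UnitExp) {b : ℝ} (hb : 0 ≤ b) {c : ℕ → ℂ} (hc : GeomCoeff c)
    {y : ℝ} (hy : 0 < y) :
    (normalInv a (powSeries a hb c hc) : ℝ → ℂ) y = ∑' n, c n * (powFun a b (n + 1) y : ℂ) := by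
  have hreal : ∀ n : ℕ, ∫ t in Set.Ioc 0 y, greenKernel a y t * powFun a b n t =
      powFun a b (n + 1) y := by
    intro n
    have := congrArg (fun u : LocBdd => (u : ℝ → ℂ) y) (normalInv_powLoc a hb n)
    simp only [normalInv_apply, powLoc_apply a hb _ hy, normalInvFun] at this
    rw [← Complex.ofReal_inj, ← this, ← integral_complex_ofReal]
    refine setIntegral_congr_fun measurableSet_Ioc fun t ht => ?_
    rw [powLoc_apply a hb _ ht.1]; push_cast; ring
  have hsum := hasSum_integral_of_summable_integral_norm (μ := volume.restrict (Set.Ioc 0 y))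
    (F := fun n t => c n * ((greenKernel a y t : ℂ) * (powLoc a hb n : ℝ → ℂ) t)) ?_ ?_
  · rw [normalInv_apply, normalInvFun]
    refine (Eq.trans ?_ hsum.tsum_eq.symm).trans (tsum_congr fun n => ?_)
    · refine setIntegral_congr_fun measurableSet_Ioc fun t ht => ?_
      rw [powSeries_apply a hb hc ht.1, ← tsum_mul_left]
      refine tsum_congr fun n => ?_
      rw [powLoc_apply a hb _ ht.1]; ring
    · rw [integral_const_mul]
      have := congrArg (fun u : LocBdd => (u : ℝ → ℂ) y) (normalInv_powLoc a hb n)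
      simp only [normalInv_apply, powLoc_apply a hb _ hy, normalInvFun] at this
      rw [this]
  · exact fun n => (integrableOn_greenKernel_mul a.2.2 _ y).const_mul _
  · obtain ⟨M, θ, h⟩ := hc
    refine (summable_powFun a.2.1 a.2.2 hb h 1 hy).congr fun n => ?_
    rw [← hreal n, ← integral_const_mul]
    refine setIntegral_congr_fun measurableSet_Ioc fun t ht => ?_
    rw [powLoc_apply a hb _ ht.1, norm_mul, norm_mul, Complex.norm_real, Complex.norm_real,
      Real.norm_of_nonneg (powFun_nonneg a.2.1 a.2.2 hb _ ht.1.le),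
      Real.norm_of_nonneg (greenKernel_nonneg a.2.1 ht.1 ht.2)]

/-! ### The operator `X u l = T⁻¹ u (l + 1)` on sequences -/

/-- `T⁻¹` acting termwise on sequences. -/
def invSeq (a : UnitExp) : Module.End ℂ (ℕ → LocBdd) := (normalInv a).compLeft ℕ

/-- The shift of sequences. -/
def shiftSeq : Module.End ℂ (ℕ → LocBdd) := LinearMap.funLeft ℂ LocBdd Nat.succ

/-- The operator `(X u) l = T⁻¹ (u (l + 1))`. -/
def invShift (a : UnitExp) : Module.End ℂ (ℕ → LocBdd) := invSeq a * shiftSeq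

lemma invSeq_pow_apply (a : UnitExp) (q : ℕ) (u : ℕ → LocBdd) (l : ℕ) :
    (invSeq a ^ q) u l = (normalInv a ^ q) (u l) := by
  induction q generalizing u with
  | zero => rfl
  | succ q ih => rw [pow_succ, Module.End.mul_apply, ih, pow_succ, Module.End.mul_apply]; rfl

lemma commute_invSeq_invShift (a : UnitExp) : Commute (invSeq a) (invShift a) := by
  ext u l; rfl

lemma invShift_apply (a : UnitExp) (u : ℕ → LocBdd) (l : ℕ) :
    invShift a u l = normalInv a (u (l + 1)) := rfl

lemma invShift_pow_apply (a : UnitExp) (q : ℕ) (u : ℕ → LocBdd) (l : ℕ) :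
    (invShift a ^ q) u l = (normalInv a ^ q) (u (l + q)) := by
  induction q generalizing u with
  | zero => rfl
  | succ q ih =>
    rw [pow_succ, Module.End.mul_apply, ih, invShift_apply, pow_succ, Module.End.mul_apply]; rfl

lemma one_sub_invShift_pow_apply (a : UnitExp) (k : ℕ) (u : ℕ → LocBdd) (l : ℕ) :
    ((1 - invShift a) ^ k) u l =
      ∑ q ∈ Finset.range (k + 1), ((-1) ^ q * k.choose q : ℂ) • (normalInv a ^ q) (u (l + q)) := by
  have h : (1 - invShift a) ^ k =
      ∑ q ∈ Finset.range (k + 1), ((-1) ^ q * k.choose q : ℂ) • invShift a ^ q := by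
    have h0 : 1 - invShift a = -invShift a + 1 := by ext; simp [sub_eq_neg_add]
    rw [h0, (Commute.one_right (-invShift a)).add_pow]
    refine Finset.sum_congr rfl fun q _ => ?_
    have h1 : (-invShift a) ^ q = ((-1 : ℂ) ^ q) • invShift a ^ q := by
      rw [← smul_pow]
      congr 1
      ext; simp
    have h2 : ((k.choose q : ℕ) : Module.End ℂ (ℕ → LocBdd)) = (k.choose q : ℂ) • 1 := by
      rw [← nsmul_one, Nat.cast_smul_eq_nsmul]
    rw [one_pow, mul_one, h1, h2, mul_smul_comm, mul_one, smul_smul, mul_comm]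
  rw [h, LinearMap.sum_apply, Finset.sum_apply]
  refine Finset.sum_congr rfl fun q _ => ?_
  rw [LinearMap.smul_apply, Pi.smul_apply, invShift_pow_apply]

/-- Sequences with geometric growth, locally uniformly in `y`. -/
def GeomSeq (u : ℕ → LocBdd) : Prop :=
  ∀ Y : ℝ, ∃ M θ : ℝ, ∀ l, ∀ y ≤ Y, ‖(u l : ℝ → ℂ) y‖ ≤ M * θ ^ l

lemma GeomSeq.sub {u v : ℕ → LocBdd} (hu : GeomSeq u) (hv : GeomSeq v) : GeomSeq (u - v) := by
  intro Y
  obtain ⟨M, θ, h⟩ := hu Y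
  obtain ⟨M', θ', h'⟩ := hv Y
  refine ⟨M + M', |θ| + |θ'|, fun l y hy => ?_⟩
  have hM : 0 ≤ M := by simpa using (norm_nonneg _).trans (h 0 y hy)
  have hM' : 0 ≤ M' := by simpa using (norm_nonneg _).trans (h' 0 y hy)
  have e1 : θ ^ l ≤ (|θ| + |θ'|) ^ l := (le_abs_self _).trans (by
    rw [abs_pow]; exact pow_le_pow_left₀ (abs_nonneg _) (by simp) _)
  have e2 : θ' ^ l ≤ (|θ| + |θ'|) ^ l := (le_abs_self _).trans (by
    rw [abs_pow]; exact pow_le_pow_left₀ (abs_nonneg _) (by simp) _)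
  rw [add_mul]
  refine (norm_sub_le _ _).trans (add_le_add ((h l y hy).trans ?_) ((h' l y hy).trans ?_))
  · exact mul_le_mul_of_nonneg_left e1 hM
  · exact mul_le_mul_of_nonneg_left e2 hM'

lemma GeomSeq.invShift (a : UnitExp) {u : ℕ → LocBdd} (hu : GeomSeq u) :
    GeomSeq (invShift a u) := by
  intro Y
  obtain ⟨M, θ, h⟩ := hu Y
  refine ⟨M * |θ| * powFun a 0 1 |Y|, |θ|, fun l y hy => ?_⟩
  have hM : 0 ≤ M := by simpa using (norm_nonneg _).trans (h 0 y hy)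
  have hp := powFun_nonneg a.2.1 a.2.2 le_rfl 1 (abs_nonneg Y)
  rcases le_or_gt y 0 with h0 | h0
  · rw [(_root_.invShift a u l).2.2.1 y h0, norm_zero]; positivity
  · have h1 : ∀ t ≤ Y, ‖(u (l + 1) : ℝ → ℂ) t‖ ≤ M * |θ| ^ (l + 1) := fun t ht =>
      (h (l + 1) t ht).trans (mul_le_mul_of_nonneg_left (by rw [← abs_pow]; exact le_abs_self _) hM)
    have := norm_normalInv_pow_le a h1 1 h0 hy
    rw [pow_one] at this
    rw [invShift_apply]
    refine this.trans ?_
    have h2 := powFun_mono a.2.1 a.2.2 le_rfl 1 h0.le (hy.trans (le_abs_self Y))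
    calc M * |θ| ^ (l + 1) * powFun a 0 1 y ≤ M * |θ| ^ (l + 1) * powFun a 0 1 |Y| := by gcongr
      _ = _ := by ring

lemma GeomSeq.one_sub_invShift_pow (a : UnitExp) (k : ℕ) {u : ℕ → LocBdd} (hu : GeomSeq u) :
    GeomSeq (((1 - _root_.invShift a) ^ k) u) := by
  induction k with
  | zero => simpa using hu
  | succ k ih =>
    rw [pow_succ', Module.End.mul_apply]
    exact ih.sub (ih.invShift a)

/-- A fixed point satisfies `u l = T^(-q) (u (l+q))` for every `q`: the sequence grows geometrically
in `q` and the iterated inverse decays factorially, so letting `q → ∞` gives zero. -/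
lemma GeomSeq.eq_zero_of_fixed (a : UnitExp) {u : ℕ → LocBdd} (hu : GeomSeq u)
    (h : (1 - _root_.invShift a) u = 0) : u = 0 := by
  have h1 : _root_.invShift a u = u := by
    rw [LinearMap.sub_apply, sub_eq_zero] at h; exact h.symm
  have h2 : ∀ q : ℕ, (_root_.invShift a ^ q) u = u := by
    intro q
    induction q with
    | zero => rfl
    | succ q ih => rw [pow_succ, Module.End.mul_apply, h1, ih]
  funext l
  refine LocBdd.ext_pos fun y hy => ?_
  obtain ⟨M, θ, hM⟩ := hu y
  have h3 : ∀ q, ‖(u l : ℝ → ℂ) y‖ ≤ M * θ ^ (l + q) * powFun a 0 q y := by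
    intro q
    rw [← congrFun (h2 q) l, invShift_pow_apply]
    exact norm_normalInv_pow_le a (hM (l + q)) q hy le_rfl
  have h4 : GeomCoeff fun q => ((M * θ ^ (l + q) : ℝ) : ℂ) := by
    refine ⟨|M| * |θ| ^ l, |θ|, fun n => le_of_eq ?_⟩
    rw [Complex.norm_real, Real.norm_eq_abs, abs_mul, abs_pow, pow_add, mul_assoc]
  have h5 := (hasSum_powFun a le_rfl h4 0 hy).summable.tendsto_atTop_zero.norm
  rw [norm_zero] at h5
  have h6 : ‖(u l : ℝ → ℂ) y‖ ≤ 0 := ge_of_tendsto' h5 fun q => (h3 q).trans (by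
    rw [norm_mul, Complex.norm_real, Complex.norm_real]
    refine le_trans (le_abs_self _) ?_
    rw [abs_mul]; rfl)
  simpa using h6

lemma GeomSeq.eq_zero (a : UnitExp) (k : ℕ) {u : ℕ → LocBdd} (hu : GeomSeq u)
    (h : ((1 - _root_.invShift a) ^ k) u = 0) : u = 0 := by
  induction k with
  | zero => simpa using h
  | succ k ih =>
    rw [pow_succ', Module.End.mul_apply] at h
    exact ih ((hu.one_sub_invShift_pow a k).eq_zero_of_fixed a h)

/-- Iteration of a hierarchy of first order relations. -/
lemma hierarchy (a : UnitExp) {U p : ℕ → ℕ → LocBdd}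
    (h : ∀ i, (1 - invShift a) (U i) = invSeq a (U (i + 1)) + p i) (k : ℕ) :
    ((1 - invShift a) ^ k) (U 0) = (invSeq a ^ k) (U k) +
      ∑ i ∈ Finset.range k, (invSeq a ^ i) (((1 - invShift a) ^ (k - 1 - i)) (p i)) := by
  have hc : Commute (invSeq a) (1 - invShift a) := by
    refine LinearMap.ext fun u => ?_
    have := LinearMap.congr_fun (commute_invSeq_invShift a).eq u
    rw [Module.End.mul_apply, Module.End.mul_apply] at this
    rw [Module.End.mul_apply, Module.End.mul_apply, LinearMap.sub_apply, map_sub, this]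
    rfl
  induction k with
  | zero => simp
  | succ k ih =>
    -- The additional factor `1 - X` commutes past `invSeq a ^ k` and hits `U k`, where the relation
    -- produces `U (k + 1)` and the new source `p k`; in the old sources it raises the exponent by
    -- one.
    rw [pow_succ', Module.End.mul_apply, ih, map_add, map_sum, ← Module.End.mul_apply,
      ← (hc.pow_left k).eq, Module.End.mul_apply, h k, map_add, ← Module.End.mul_apply, ← pow_succ,
      add_assoc, Finset.sum_range_succ, add_comm (Finset.sum _ _)]
    congr 2
    · simp
    · refine Finset.sum_congr rfl fun i hi => ?_
      rw [← Module.End.mul_apply, ← (hc.pow_left i).eq, Module.End.mul_apply,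
        ← Module.End.mul_apply (1 - invShift a), ← pow_succ']
      congr 3
      have := Finset.mem_range.1 hi
      omega

/-- The traces of `T ^ n` generated by the Pascal rule from those of the powers of `T + Δ`. -/
def pascal (t : ℕ → ℕ → ℂ) : ℕ → ℕ → ℕ → ℂ
  | 0, i, l => t i l
  | n + 1, i, l => pascal t n (i + 1) l + pascal t n i (l + 1)

lemma norm_pascal_le {t : ℕ → ℕ → ℂ} {M θ : ℝ} (ht : ∀ i l, ‖t i l‖ ≤ M * θ ^ l) (n i l : ℕ) :
    ‖pascal t n i l‖ ≤ M * θ ^ l * (1 + θ) ^ n := by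
  induction n generalizing i l with
  | zero => simpa [pascal] using ht i l
  | succ n ih =>
    refine (norm_add_le _ _).trans ((add_le_add (ih (i + 1) l) (ih i (l + 1))).trans (le_of_eq ?_))
    ring

lemma pascal_eq_zero {t : ℕ → ℕ → ℂ} {k : ℕ} (ht : ∀ i l, k ≤ i → t i l = 0) (n : ℕ) {i : ℕ}
    (l : ℕ) (hi : k ≤ i) : pascal t n i l = 0 := by
  induction n generalizing i l with
  | zero => exact ht i l hi
  | succ n ih => rw [pascal, ih l (by omega), ih (l + 1) hi, add_zero]

lemma two_mul_nonneg (a : UnitExp) : 0 ≤ 2 * (a : ℝ) := by linarith [a.2.1]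

/-- The boundary terms `t i l + s i l y ^ (2 a)`. -/
def srcSeq (a : UnitExp) (t s : ℕ → ℕ → ℂ) (i l : ℕ) : LocBdd :=
  t i l • powLoc a le_rfl 0 + s i l • powLoc a (two_mul_nonneg a) 0

/-- Solution of the iterated equation by a series. -/
theorem hasSum_of_one_sub_invShift_pow (a : UnitExp) (k : ℕ) {t s : ℕ → ℕ → ℂ} {M θ : ℝ}
    (ht : ∀ i l, ‖t i l‖ ≤ M * θ ^ l) (hs : ∀ i l, ‖s i l‖ ≤ M * θ ^ l) (hθ : 0 ≤ θ)
    (ht0 : ∀ i l, k ≤ i → t i l = 0) (hs0 : ∀ i l, k ≤ i → s i l = 0)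
    {u : ℕ → LocBdd} (hu : GeomSeq u)
    (h : ((1 - invShift a) ^ k) u =
      ∑ i ∈ Finset.range k, (invSeq a ^ i) (((1 - invShift a) ^ (k - 1 - i)) (srcSeq a t s i)))
    (l : ℕ) {y : ℝ} (hy : 0 < y) :
    (u l : ℝ → ℂ) y = ∑' n, pascal t n 0 l * (powFun a 0 n y : ℂ) +
      ∑' n, pascal s n 0 l * (powFun a (2 * a) n y : ℂ) := by
  have gt : ∀ i l, GeomCoeff fun n => pascal t n i l := fun i l =>
    ⟨M * θ ^ l, 1 + θ, fun n => norm_pascal_le ht n i l⟩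
  have gs : ∀ i l, GeomCoeff fun n => pascal s n i l := fun i l =>
    ⟨M * θ ^ l, 1 + θ, fun n => norm_pascal_le hs n i l⟩
  -- The candidate solution, built simultaneously for all levels `i` so that it satisfies the same
  -- hierarchy of first order relations as the tested powers of the operator.
  set C : ℕ → ℕ → LocBdd := fun i l =>
    powSeries a le_rfl _ (gt i l) + powSeries a (two_mul_nonneg a) _ (gs i l) with hC
  have one : ∀ {b : ℝ} (hb : 0 ≤ b) {t : ℕ → ℕ → ℂ}
      (gt : ∀ i l, GeomCoeff fun n => pascal t n i l) (i l : ℕ) {y : ℝ}, 0 < y →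
      (powSeries a hb _ (gt i l) : ℝ → ℂ) y -
        (normalInv a (powSeries a hb _ (gt i (l + 1))) : ℝ → ℂ) y =
      (normalInv a (powSeries a hb _ (gt (i + 1) l)) : ℝ → ℂ) y + t i l * powFun a b 0 y := by
    intro b hb t gt i l y hy
    rw [powSeries_apply a hb _ hy, normalInv_powSeries a hb _ hy, normalInv_powSeries a hb _ hy,
      Summable.tsum_eq_zero_add (f := fun n => pascal t n i l * (powFun a b n y : ℂ))
        (hasSum_powFun a hb (gt i l) 0 hy).summable, add_sub_assoc]
    -- The Pascal rule is the relation `T u_{i,l} = u_{i+1,l} + u_{i,l+1}` read on coefficients.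
    have : ∀ n, pascal t (n + 1) i l * (powFun a b (n + 1) y : ℂ) =
        pascal t n (i + 1) l * (powFun a b (n + 1) y : ℂ) +
          pascal t n i (l + 1) * (powFun a b (n + 1) y : ℂ) := fun n => by rw [pascal]; ring
    simp only [this]
    rw [(hasSum_powFun a hb (gt (i + 1) l) 1 hy).summable.tsum_add
      (hasSum_powFun a hb (gt i (l + 1)) 1 hy).summable, add_sub_cancel_right, add_comm]
    rfl
  have hier : ∀ i, (1 - invShift a) (C i) = invSeq a (C (i + 1)) + srcSeq a t s i := by
    intro i
    funext l
    refine LocBdd.ext_pos fun y hy => ?_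
    have e1 := one le_rfl gt i l hy
    have e2 := one (two_mul_nonneg a) gs i l hy
    have hL : (((1 - invShift a) (C i)) l : ℝ → ℂ) y =
        (C i l : ℝ → ℂ) y - (normalInv a (C i (l + 1)) : ℝ → ℂ) y := rfl
    have hR : ((invSeq a (C (i + 1)) + srcSeq a t s i) l : ℝ → ℂ) y =
        (normalInv a (C (i + 1) l) : ℝ → ℂ) y + (srcSeq a t s i l : ℝ → ℂ) y := rfl
    rw [hL, hR]
    simp only [hC, srcSeq, map_add, Submodule.coe_add, Submodule.coe_smul, Pi.add_apply,
      Pi.smul_apply, smul_eq_mul, powLoc_apply a _ _ hy]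
    linear_combination e1 + e2
  have hCk : C k = 0 := by
    funext l
    refine LocBdd.ext_pos fun y hy => ?_
    simp only [hC, Submodule.coe_add, Pi.add_apply, powSeries_apply a _ _ hy,
      pascal_eq_zero ht0 _ l le_rfl, pascal_eq_zero hs0 _ l le_rfl]
    simp
  -- In the bound `M θ^l (1+θ)^n` for the coefficients the dependence on `l` is a separate factor,
  -- so the sum over `n` is a constant times `θ^l`. Uniqueness then applies to `u - C 0`.
  have geomC : GeomSeq (C 0) := by
    intro Y
    set Z := max Y 1 with hZ
    have hZ0 : (0 : ℝ) < Z := lt_max_of_lt_right one_pos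
    have hM : 0 ≤ M := by simpa using (norm_nonneg _).trans (ht 0 0)
    have key : ∀ {b : ℝ} (hb : 0 ≤ b) {t : ℕ → ℕ → ℂ} (ht : ∀ i l, ‖t i l‖ ≤ M * θ ^ l)
        (g : ∀ i l, GeomCoeff fun n => pascal t n i l) (l : ℕ) (y : ℝ), y ≤ Y →
        ‖(powSeries a hb _ (g 0 l) : ℝ → ℂ) y‖ ≤
          (∑' n, ‖((M * (1 + θ) ^ n : ℝ) : ℂ)‖ * powFun a b (n + 0) Z) * θ ^ l := by
      intro b hb t ht g l y hy
      have hsum := summable_powFun a.2.1 a.2.2 hb (c := fun n => ((M * (1 + θ) ^ n : ℝ) : ℂ))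
        (M := M) (θ := 1 + θ) (fun n => by
          rw [Complex.norm_real, Real.norm_of_nonneg (by positivity)]) 0 hZ0
      rcases le_or_gt y 0 with h0 | h0
      · rw [(powSeries a hb _ (g 0 l)).2.2.1 y h0, norm_zero]
        exact mul_nonneg (tsum_nonneg fun n => mul_nonneg (norm_nonneg _)
          (powFun_nonneg a.2.1 a.2.2 hb _ hZ0.le)) (by positivity)
      · rw [powSeries_apply a hb _ h0]
        refine tsum_of_norm_bounded (hsum.hasSum.mul_right (θ ^ l)) fun n => ?_
        rw [norm_mul, Complex.norm_real, Complex.norm_real,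
          Real.norm_of_nonneg (powFun_nonneg a.2.1 a.2.2 hb _ h0.le),
          Real.norm_of_nonneg (by positivity)]
        have e1 := norm_pascal_le ht n 0 l
        have e2 := powFun_mono a.2.1 a.2.2 hb n h0.le (hy.trans (le_max_left Y 1))
        calc _ ≤ (M * θ ^ l * (1 + θ) ^ n) * powFun a b n Z :=
              mul_le_mul e1 e2 (powFun_nonneg a.2.1 a.2.2 hb _ h0.le) (by positivity)
          _ = _ := by simp only [add_zero]; ring
    refine ⟨_, θ, fun l y hy => (norm_add_le _ _).trans ((add_le_add
      (key le_rfl ht gt l y hy) (key (two_mul_nonneg a) hs gs l y hy)).trans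
      (le_of_eq (add_mul _ _ _).symm))⟩
  have heq : u - C 0 = 0 := by
    refine (hu.sub geomC).eq_zero a k ?_
    rw [map_sub, h, hierarchy a hier k, hCk, map_zero, zero_add, sub_self]
  rw [sub_eq_zero.1 heq]
  simp only [hC, Submodule.coe_add, Pi.add_apply, powSeries_apply a _ _ hy]

/-! ### Even jets and the normal operator -/

/-- Green's formula: `Φ(t) = t^(1-2a) u'(t) (y^(2a) - t^(2a))/(2a) + u(t)` is a primitive of the
kernel times `T u`. It equals `u y` at `t = y` and tends to `σ y^(2a) + τ` as `t → 0⁺`; these are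
the two elements of the kernel of `T` lost by inversion. -/
lemma normalInv_eq_of_hasDerivAt (a : UnitExp) {u u1 u2 : ℝ → ℂ} {τ σ : ℂ}
    (h1 : ∀ y, 0 < y → HasDerivAt u (u1 y) y) (h2 : ∀ y, 0 < y → HasDerivAt u1 (u2 y) y)
    (hτ : Tendsto u (𝓝[>] 0) (𝓝 τ))
    (hσ : Tendsto (fun y => ((y ^ (1 - 2 * (a : ℝ)) : ℝ) : ℂ) * u1 y) (𝓝[>] 0) (𝓝 (2 * a * σ)))
    {f : LocBdd}
    (hf : ∀ y, 0 < y → (f : ℝ → ℂ) y = u2 y + (((1 - 2 * (a : ℝ)) / y : ℝ) : ℂ) * u1 y)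
    {y : ℝ} (hy : 0 < y) :
    (normalInv a f : ℝ → ℂ) y = u y - τ - σ * ((y ^ (2 * (a : ℝ)) : ℝ) : ℂ) := by
  have ha := a.2.1
  set b : ℝ := (a : ℝ) with hb
  have hbc : (2 * b : ℂ) ≠ 0 := by
    have : (2 * b : ℝ) ≠ 0 := by positivity
    exact_mod_cast this
  have hb0 : (b : ℂ) ≠ 0 := by exact_mod_cast ha.ne'
  set Φ : ℝ → ℂ := fun t => (((t ^ (1 - 2 * b) : ℝ) : ℂ) * u1 t) *
    (((y ^ (2 * b) - t ^ (2 * b)) / (2 * b) : ℝ) : ℂ) + u t with hΦ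
  have hcont : Tendsto (fun t : ℝ => (((y ^ (2 * b) - t ^ (2 * b)) / (2 * b) : ℝ) : ℂ)) (𝓝 0)
      (𝓝 ((y ^ (2 * b) / (2 * b) : ℝ) : ℂ)) := by
    refine (Complex.continuous_ofReal.tendsto _).comp ?_
    have h3 : ContinuousAt (fun t : ℝ => (y ^ (2 * b) - t ^ (2 * b)) / (2 * b)) 0 := by
      have := Real.continuousAt_rpow_const 0 (2 * b) (Or.inr (by positivity))
      fun_prop
    have h4 := h3.tendsto
    simpa [Real.zero_rpow (show 2 * b ≠ 0 by positivity)] using h4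
  rw [normalInv_apply, normalInvFun, ← intervalIntegral.integral_of_le hy.le]
  have hderiv : ∀ t, 0 < t → HasDerivAt Φ ((greenKernel b y t : ℂ) * (f : ℝ → ℂ) t) t := by
    intro t ht
    have e1 : HasDerivAt (fun t : ℝ => ((t ^ (1 - 2 * b) : ℝ) : ℂ))
        (((1 - 2 * b) * t ^ (1 - 2 * b - 1) : ℝ) : ℂ) t :=
      (Real.hasDerivAt_rpow_const (Or.inl ht.ne')).ofReal_comp
    have e2 : HasDerivAt (fun t : ℝ => (((y ^ (2 * b) - t ^ (2 * b)) / (2 * b) : ℝ) : ℂ))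
        (((-((2 * b) * t ^ (2 * b - 1))) / (2 * b) : ℝ) : ℂ) t :=
      (((Real.hasDerivAt_rpow_const (Or.inl ht.ne')).const_sub _).div_const _).ofReal_comp
    refine (((e1.mul (h2 t ht)).mul e2).add (h1 t ht)).congr_deriv ?_
    rw [hf t ht, greenKernel]
    have r1 : (t ^ (1 - 2 * b - 1) : ℝ) = t ^ (1 - 2 * b) / t := by
      rw [Real.rpow_sub_one ht.ne']
    have r2 : (-((2 * b) * t ^ (2 * b - 1))) / (2 * b) = -(t ^ (1 - 2 * b))⁻¹ := by
      rw [← Real.rpow_neg ht.le, show -(1 - 2 * b) = 2 * b - 1 by ring]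
      field_simp
    have r3 : (t ^ (1 - 2 * b) : ℝ) ≠ 0 := (Real.rpow_pos_of_pos ht _).ne'
    have r3' : ((t ^ (1 - 2 * b) : ℝ) : ℂ) ≠ 0 := by exact_mod_cast r3
    have ht' : (t : ℂ) ≠ 0 := by exact_mod_cast ht.ne'
    rw [r1, r2]
    simp only [Complex.ofReal_mul, Complex.ofReal_div, Complex.ofReal_sub, Complex.ofReal_neg,
      Complex.ofReal_inv, Complex.ofReal_one, Complex.ofReal_ofNat, Pi.mul_apply]
    field_simp
    ring
  rw [intervalIntegral.integral_eq_sub_of_hasDerivAt_of_tendsto (f := Φ) hy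
    (fun t ht => hderiv t ht.1) ?_
    (fa := (2 * b * σ) * ((y ^ (2 * b) / (2 * b) : ℝ) : ℂ) + τ) (fb := u y) ?_ ?_]
  · push_cast
    field_simp
    ring
  · rw [intervalIntegrable_iff_integrableOn_Ioc_of_le hy.le]
    exact integrableOn_greenKernel_mul a.2.2 f y
  · exact (hσ.mul (hcont.mono_left nhdsWithin_le_nhds)).add hτ
  · have := (hderiv y hy).continuousAt.tendsto.mono_left
      (nhdsWithin_le_nhds : 𝓝[<] y ≤ 𝓝 y)
    simpa [hΦ] using this

/-- The derivatives of a function on `[0, ∞)` which is smooth and even at `0`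
(extended continuously to `ℝ`). -/
structure EvenJet (w : ℕ → ℝ → ℂ) : Prop where
  cont : ∀ j, Continuous (w j)
  deriv : ∀ j y, 0 < y → HasDerivAt (w j) (w (j + 1) y) y
  odd : ∀ j, w (2 * j + 1) 0 = 0

/-- The derivatives of `w' / y`. -/
def jetDiv (w : ℕ → ℝ → ℂ) (j : ℕ) (y : ℝ) : ℂ :=
  ∫ t in (0 : ℝ)..1, (t : ℂ) ^ j * w (j + 2) (t * y)

lemma jetDiv_zero_right (w : ℕ → ℝ → ℂ) (j : ℕ) : jetDiv w j 0 = w (j + 2) 0 / (j + 1) := by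
  simp only [jetDiv, mul_zero]
  rw [intervalIntegral.integral_mul_const]
  have : ∫ t in (0 : ℝ)..1, (t : ℂ) ^ j = 1 / (j + 1) := by
    have h := integral_pow (a := 0) (b := 1) j
    simp only [one_pow, ne_eq, Nat.add_eq_zero_iff, one_ne_zero, and_false, not_false_eq_true,
      zero_pow, sub_zero] at h
    have h2 : ∫ t in (0 : ℝ)..1, (t : ℂ) ^ j = ∫ t in (0 : ℝ)..1, ((t ^ j : ℝ) : ℂ) := by
      simp
    rw [h2, intervalIntegral.integral_ofReal, h]; push_cast; ring
  rw [this]; ring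

/-- Evenness gives `w'(0) = 0`, so `w'(y)/y` is the average of `w''` over `[0, y]`. The integral
form is regular at `y = 0` and can be differentiated there under the integral sign. -/
lemma EvenJet.jetDiv_zero_left {w : ℕ → ℝ → ℂ} (hw : EvenJet w) {y : ℝ} (hy : 0 < y) :
    jetDiv w 0 y = w 1 y / y := by
  have h1 : ∫ t in (0 : ℝ)..y, w 2 t = w 1 y - w 1 0 :=
    intervalIntegral.integral_eq_sub_of_hasDerivAt_of_le hy.le (hw.cont 1).continuousOn
      (fun t ht => hw.deriv 1 t ht.1) ((hw.cont 2).intervalIntegrable _ _)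
  have h0 : w 1 0 = 0 := hw.odd 0
  have h2 := intervalIntegral.integral_comp_mul_right (a := 0) (b := 1) (fun t => w 2 t) hy.ne'
  simp only [jetDiv, pow_zero, one_mul]
  simp only [zero_mul, one_mul] at h2
  rw [zero_add, h2, h1, h0, sub_zero, Complex.real_smul]
  push_cast
  rw [div_eq_inv_mul]

lemma EvenJet.continuous_jetDiv {w : ℕ → ℝ → ℂ} (hw : EvenJet w) (j : ℕ) :
    Continuous (jetDiv w j) := by
  refine intervalIntegral.continuous_parametric_intervalIntegral_of_continuous' ?_ 0 1
  have := hw.cont (j + 2)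
  fun_prop

lemma EvenJet.hasDerivAt_jetDiv {w : ℕ → ℝ → ℂ} (hw : EvenJet w) (j : ℕ) {y : ℝ} (hy : 0 < y) :
    HasDerivAt (jetDiv w j) (jetDiv w (j + 1) y) y := by
  have hc2 := hw.cont (j + 2)
  have hc3 := hw.cont (j + 3)
  obtain ⟨M, hM⟩ := (isCompact_Icc (a := (0 : ℝ)) (b := 2 * y)).exists_bound_of_continuousOn
    hc3.continuousOn
  refine (intervalIntegral.hasDerivAt_integral_of_dominated_loc_of_deriv_le (μ := volume)
    (F := fun y t => (t : ℂ) ^ j * w (j + 2) (t * y))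
    (F' := fun y t => (t : ℂ) ^ (j + 1) * w (j + 3) (t * y)) (bound := fun _ => M)
    (s := Set.Ioo 0 (2 * y)) (isOpen_Ioo.mem_nhds ⟨hy, by linarith⟩) ?_ ?_ ?_ ?_ ?_ ?_).2
  · exact Eventually.of_forall fun x => Continuous.aestronglyMeasurable (by fun_prop)
  · exact Continuous.intervalIntegrable (by fun_prop) _ _
  · exact Continuous.aestronglyMeasurable (by fun_prop)
  · refine Eventually.of_forall fun t ht x hx => ?_
    rw [Set.uIoc_of_le zero_le_one] at ht
    rw [norm_mul, norm_pow, Complex.norm_real, Real.norm_of_nonneg ht.1.le]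
    have h1 : t ^ (j + 1) ≤ 1 := pow_le_one₀ ht.1.le ht.2
    have h2 := hM (t * x) ⟨mul_nonneg ht.1.le hx.1.le, by nlinarith [ht.1, ht.2, hx.1, hx.2]⟩
    calc t ^ (j + 1) * ‖w (j + 3) (t * x)‖ ≤ 1 * ‖w (j + 3) (t * x)‖ := by gcongr
      _ ≤ M := by rwa [one_mul]
  · exact intervalIntegrable_const
  · refine Eventually.of_forall fun t ht x hx => ?_
    rw [Set.uIoc_of_le zero_le_one] at ht
    have h1 := (hw.deriv (j + 2) (t * x) (mul_pos ht.1 hx.1)).scomp x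
      ((hasDerivAt_id x).const_mul t)
    refine (h1.const_mul ((t : ℂ) ^ j)).congr_deriv ?_
    simp only [mul_one, Complex.real_smul]
    ring

/-- The jet of `w'' + (μ / y) w'`. -/
def jetOp (μ : ℝ) (w : ℕ → ℝ → ℂ) (j : ℕ) (y : ℝ) : ℂ := w (j + 2) y + μ * jetDiv w j y

lemma EvenJet.jetOp {w : ℕ → ℝ → ℂ} (hw : EvenJet w) (μ : ℝ) : EvenJet (jetOp μ w) where
  cont j := (hw.cont (j + 2)).add (continuous_const.mul (hw.continuous_jetDiv j))
  deriv j y hy := (hw.deriv (j + 2) y hy).add ((hw.hasDerivAt_jetDiv j hy).const_mul (μ : ℂ))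
  odd j := by
    have h := hw.odd (j + 1)
    rw [show 2 * (j + 1) + 1 = 2 * j + 1 + 2 by ring] at h
    rw [_root_.jetOp, jetDiv_zero_right, h]; simp

lemma EvenJet.sub {w z : ℕ → ℝ → ℂ} (hw : EvenJet w) (hz : EvenJet z) : EvenJet (w - z) where
  cont j := (hw.cont j).sub (hz.cont j)
  deriv j y hy := (hw.deriv j y hy).sub (hz.deriv j y hy)
  odd j := by simp [hw.odd j, hz.odd j]

/-- The constants in `T ^ i w (0) = c w ^ (2 i) (0)`. -/
def jetConst (μ : ℝ) (i : ℕ) : ℝ := ∏ s ∈ Finset.range i, (1 + μ / (2 * s + 1))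

/-- At `0` one application sends the derivative of order `2s+2` to that of order `2s` with factor `1
+ μ/(2s+1)`, so only the derivative of order `2i` survives. -/
lemma jetOp_iterate_zero (μ : ℝ) (w : ℕ → ℝ → ℂ) (i : ℕ) :
    ((jetOp μ)^[i] w) 0 0 = jetConst μ i * w (2 * i) 0 := by
  have key : ∀ (i : ℕ) (w : ℕ → ℝ → ℂ), ((jetOp μ)^[i] w) 0 0 = jetConst μ i * w (2 * i) 0 := by
    intro i
    induction i with
    | zero => intro w; simp [jetConst]
    | succ i ih =>
      intro w
      rw [Function.iterate_succ_apply, ih, jetOp, jetDiv_zero_right, jetConst,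
        jetConst, Finset.prod_range_succ, show 2 * i + 2 = 2 * (i + 1) by ring]
      push_cast
      ring
  exact key i w

/-- `u = w + y ^ (2 a) z` on `(0, ∞)` for even jets `w` and `z`. -/
structure IsJetPair (a : ℝ) (u : ℝ → ℂ) (w z : ℕ → ℝ → ℂ) : Prop where
  left : EvenJet w
  right : EvenJet z
  eq : ∀ y, 0 < y → u y = w 0 y + ((y ^ (2 * a) : ℝ) : ℂ) * z 0 y

/-- The formula for the first derivative of `w + y ^ (2 a) z`. -/
def pairDeriv (a : ℝ) (w z : ℕ → ℝ → ℂ) (y : ℝ) : ℂ :=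
  w 1 y + (((2 * a * y ^ (2 * a - 1) : ℝ) : ℂ) * z 0 y + ((y ^ (2 * a) : ℝ) : ℂ) * z 1 y)

lemma hasDerivAt_ofReal_rpow (p : ℝ) {y : ℝ} (hy : 0 < y) :
    HasDerivAt (fun t : ℝ => ((t ^ p : ℝ) : ℂ)) ((p * y ^ (p - 1) : ℝ) : ℂ) y :=
  (Real.hasDerivAt_rpow_const (Or.inl hy.ne')).ofReal_comp

namespace IsJetPair

variable {a : ℝ} {u v : ℝ → ℂ} {w z w' z' : ℕ → ℝ → ℂ}

lemma hasDerivAt (h : IsJetPair a u w z) {y : ℝ} (hy : 0 < y) :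
    HasDerivAt u (pairDeriv a w z y) y := by
  have h1 := (h.left.deriv 0 y hy).add ((hasDerivAt_ofReal_rpow (2 * a) hy).mul
    (h.right.deriv 0 y hy))
  refine h1.congr_of_eventuallyEq ?_
  filter_upwards [lt_mem_nhds hy] with t ht using h.eq t ht

lemma hasDerivAt_deriv (h : IsJetPair a u w z) {y : ℝ} (hy : 0 < y) :
    HasDerivAt (pairDeriv a w z) (w 2 y + ((((2 * a * ((2 * a - 1) * y ^ (2 * a - 1 - 1)) : ℝ) : ℂ) *
      z 0 y + ((2 * a * y ^ (2 * a - 1) : ℝ) : ℂ) * z 1 y) +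
      (((2 * a * y ^ (2 * a - 1) : ℝ) : ℂ) * z 1 y + ((y ^ (2 * a) : ℝ) : ℂ) * z 2 y))) y := by
  have e1 : HasDerivAt (fun t : ℝ => ((2 * a * t ^ (2 * a - 1) : ℝ) : ℂ))
      ((2 * a * ((2 * a - 1) * y ^ (2 * a - 1 - 1)) : ℝ) : ℂ) y :=
    ((Real.hasDerivAt_rpow_const (Or.inl hy.ne')).const_mul (2 * a)).ofReal_comp
  exact (h.left.deriv 1 y hy).add ((e1.mul (h.right.deriv 0 y hy)).add
    ((hasDerivAt_ofReal_rpow (2 * a) hy).mul (h.right.deriv 1 y hy)))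

lemma deriv_eq (h : IsJetPair a u w z) {y : ℝ} (hy : 0 < y) : deriv u y = pairDeriv a w z y :=
  (h.hasDerivAt hy).deriv

lemma deriv_eventuallyEq (h : IsJetPair a u w z) {y : ℝ} (hy : 0 < y) :
    deriv u =ᶠ[𝓝 y] pairDeriv a w z := by
  filter_upwards [lt_mem_nhds hy] with t ht using h.deriv_eq ht

/-- Since `T y^(2a) = 0`, conjugation by `y^(2a)` produces no zero order term and only changes the
weight: the cross term `4a y^(2a-1) z'` turns `1 - 2a` into `1 + 2a`. -/
protected lemma normalOp (h : IsJetPair a u w z) :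
    IsJetPair a (normalOp (1 - 2 * a) u) (jetOp (1 - 2 * a) w) (jetOp (1 + 2 * a) z) where
  left := h.left.jetOp _
  right := h.right.jetOp _
  eq y hy := by
    have hyc : (y : ℂ) ≠ 0 := by exact_mod_cast hy.ne'
    rw [_root_.normalOp, (h.deriv_eventuallyEq hy).deriv_eq, (h.hasDerivAt_deriv hy).deriv,
      h.deriv_eq hy, pairDeriv, jetOp, jetOp, h.left.jetDiv_zero_left hy,
      h.right.jetDiv_zero_left hy, Complex.real_smul, Real.rpow_sub_one hy.ne',
      Real.rpow_sub_one hy.ne']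
    simp only [Complex.ofReal_mul, Complex.ofReal_div, Complex.ofReal_sub, Complex.ofReal_one,
      Complex.ofReal_ofNat, Complex.ofReal_add]
    field_simp
    ring

lemma normalOp_iterate (h : IsJetPair a u w z) (i : ℕ) :
    IsJetPair a ((_root_.normalOp (1 - 2 * a))^[i] u) ((jetOp (1 - 2 * a))^[i] w)
      ((jetOp (1 + 2 * a))^[i] z) := by
  induction i with
  | zero => exact h
  | succ i ih =>
    rw [Function.iterate_succ_apply', Function.iterate_succ_apply', Function.iterate_succ_apply']
    exact ih.normalOp

lemma sub (h : IsJetPair a u w z) (h' : IsJetPair a v w' z') :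
    IsJetPair a (u - v) (w - w') (z - z') where
  left := h.left.sub h'.left
  right := h.right.sub h'.right
  eq y hy := by
    simp only [Pi.sub_apply]; rw [h.eq y hy, h'.eq y hy]; ring

lemma congr (h : IsJetPair a u w z) (huv : ∀ y, 0 < y → v y = u y) : IsJetPair a v w z where
  left := h.left
  right := h.right
  eq y hy := by rw [huv y hy, h.eq y hy]

lemma tendsto (h : IsJetPair a u w z) (ha : 0 < a) : Tendsto u (𝓝[>] 0) (𝓝 (w 0 0)) := by
  have h1 : Tendsto (fun y : ℝ => w 0 y + ((y ^ (2 * a) : ℝ) : ℂ) * z 0 y) (𝓝[>] 0)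
      (𝓝 (w 0 0 + (((0 : ℝ) ^ (2 * a) : ℝ) : ℂ) * z 0 0)) := by
    have c1 : Continuous fun y : ℝ => ((y ^ (2 * a) : ℝ) : ℂ) :=
      Complex.continuous_ofReal.comp (Real.continuous_rpow_const (by positivity))
    have := ((h.left.cont 0).add (c1.mul (h.right.cont 0))).tendsto 0
    exact this.mono_left nhdsWithin_le_nhds
  rw [Real.zero_rpow (by positivity), Complex.ofReal_zero, zero_mul, add_zero] at h1
  refine h1.congr' ?_
  filter_upwards [self_mem_nhdsWithin] with y hy using (h.eq y hy).symm

/-- Multiplication by `y^(1-2a)` gives `y^(2-2a) (w'/y) + 2a z + y z'`. The quotient `w'/y` stays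
bounded because `w` is even, and `2 - 2a > 0`. -/
lemma tendsto_deriv (h : IsJetPair a u w z) (ha1 : a < 1) :
    Tendsto (fun y => ((y ^ (1 - 2 * a) : ℝ) : ℂ) * pairDeriv a w z y) (𝓝[>] 0)
      (𝓝 (2 * a * z 0 0)) := by
  have c1 : Continuous fun y : ℝ => ((y ^ (2 - 2 * a) : ℝ) : ℂ) :=
    Complex.continuous_ofReal.comp (Real.continuous_rpow_const (by linarith))
  have h1 : Tendsto (fun y : ℝ => ((y ^ (2 - 2 * a) : ℝ) : ℂ) * jetDiv w 0 y +
      (2 * a * z 0 y + (y : ℂ) * z 1 y)) (𝓝 0)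
      (𝓝 ((((0 : ℝ) ^ (2 - 2 * a) : ℝ) : ℂ) * jetDiv w 0 0 +
        (2 * a * z 0 0 + ((0 : ℝ) : ℂ) * z 1 0))) :=
    ((c1.mul (h.left.continuous_jetDiv 0)).add ((continuous_const.mul (h.right.cont 0)).add
      (Complex.continuous_ofReal.mul (h.right.cont 1)))).tendsto 0
  have h2 := h1.mono_left (nhdsWithin_le_nhds (s := Set.Ioi 0))
  rw [Real.zero_rpow (show 2 - 2 * a ≠ 0 by linarith), Complex.ofReal_zero, zero_mul, zero_mul,
    zero_add, add_zero] at h2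
  refine h2.congr' ?_
  filter_upwards [self_mem_nhdsWithin] with y hy
  have hy : 0 < y := hy
  have hyc : (y : ℂ) ≠ 0 := by exact_mod_cast hy.ne'
  have r1 : y ^ (2 - 2 * a) = y ^ (1 - 2 * a) * y := by
    rw [← Real.rpow_add_one hy.ne']; congr 1; ring
  have r2 : y ^ (1 - 2 * a) * y ^ (2 * a - 1) = 1 := by
    rw [← Real.rpow_add hy]; simp
  have r3 : y ^ (1 - 2 * a) * y ^ (2 * a) = y := by
    rw [← Real.rpow_add hy]; simp
  have r2' : ((y ^ (1 - 2 * a) : ℝ) : ℂ) * ((y ^ (2 * a - 1) : ℝ) : ℂ) = 1 := by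
    exact_mod_cast r2
  have r3' : ((y ^ (1 - 2 * a) : ℝ) : ℂ) * ((y ^ (2 * a) : ℝ) : ℂ) = y := by
    exact_mod_cast r3
  rw [h.left.jetDiv_zero_left hy, pairDeriv, r1]
  simp only [Complex.ofReal_mul, Complex.ofReal_ofNat]
  rw [mul_assoc _ (y : ℂ), mul_div_cancel₀ _ hyc]
  linear_combination (-(2 * a * z 0 y) : ℂ) * r2' - z 1 y * r3'

lemma tendsto_smul_deriv (h : IsJetPair a u w z) (ha1 : a < 1) :
    Tendsto (fun y => (y ^ (1 - 2 * a) : ℝ) • deriv u y) (𝓝[>] 0) (𝓝 (2 * a * z 0 0)) := by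
  refine (h.tendsto_deriv ha1).congr' ?_
  filter_upwards [self_mem_nhdsWithin] with y hy
  rw [h.deriv_eq hy, Complex.real_smul]

lemma indicator_mem (h : IsJetPair a u w z) (ha : 0 < a) :
    (Set.Ioi 0).indicator u ∈ LocBdd := by
  have c1 : Continuous fun y : ℝ => w 0 y + ((y ^ (2 * a) : ℝ) : ℂ) * z 0 y :=
    (h.left.cont 0).add ((Complex.continuous_ofReal.comp
      (Real.continuous_rpow_const (by positivity))).mul (h.right.cont 0))
  have h1 : (Set.Ioi 0).indicator u =
      (Set.Ioi 0).indicator fun y : ℝ => w 0 y + ((y ^ (2 * a) : ℝ) : ℂ) * z 0 y :=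
    Set.indicator_congr fun y hy => h.eq y hy
  rw [h1]
  refine ⟨c1.measurable.indicator measurableSet_Ioi, fun y hy => by simp [hy], fun Y => ?_⟩
  obtain ⟨M, hM⟩ := (isCompact_Icc (a := (0 : ℝ)) (b := Y)).exists_bound_of_continuousOn
    c1.continuousOn
  refine ⟨max 0 M, fun y hy => ?_⟩
  by_cases h0 : 0 < y
  · rw [Set.indicator_of_mem (show y ∈ Set.Ioi (0 : ℝ) from h0)]
    exact (hM y ⟨h0.le, hy⟩).trans (le_max_right _ _)
  · rw [Set.indicator_of_notMem (show y ∉ Set.Ioi (0 : ℝ) from h0), norm_zero]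
    exact le_max_left _ _

end IsJetPair

/-- A function in the range of the jets, as a locally bounded function. -/
def IsJetPair.toLoc {a : UnitExp} {u : ℝ → ℂ} {w z : ℕ → ℝ → ℂ} (h : IsJetPair a u w z) : LocBdd :=
  ⟨(Set.Ioi 0).indicator u, h.indicator_mem a.2.1⟩

lemma IsJetPair.toLoc_apply {a : UnitExp} {u : ℝ → ℂ} {w z : ℕ → ℝ → ℂ} (h : IsJetPair a u w z)
    {y : ℝ} (hy : 0 < y) : (h.toLoc : ℝ → ℂ) y = u y := by
  simp [IsJetPair.toLoc, hy]

lemma IsJetPair.normalInv_eq {a : UnitExp} {u : ℝ → ℂ} {w z : ℕ → ℝ → ℂ} (h : IsJetPair a u w z)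
    {f : LocBdd} (hf : ∀ y, 0 < y → (f : ℝ → ℂ) y = normalOp (1 - 2 * (a : ℝ)) u y) :
    normalInv a f = h.toLoc -
      (w 0 0 • powLoc a le_rfl 0 + z 0 0 • powLoc a (two_mul_nonneg a) 0) := by
  refine LocBdd.ext_pos fun y hy => ?_
  rw [normalInv_eq_of_hasDerivAt a (fun y hy => h.hasDerivAt hy) (fun y hy => h.hasDerivAt_deriv hy)
    (h.tendsto a.2.1) (h.tendsto_deriv a.2.2) (f := f) ?_ hy]
  · simp only [Submodule.coe_sub, Submodule.coe_add, Submodule.coe_smul, Pi.sub_apply, Pi.add_apply,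
      Pi.smul_apply, smul_eq_mul, powLoc_apply a _ _ hy, h.toLoc_apply hy]
    simp [powFun, powConst]
    ring
  · intro y hy
    rw [hf y hy, normalOp, (h.deriv_eventuallyEq hy).deriv_eq, (h.hasDerivAt_deriv hy).deriv,
      h.deriv_eq hy, Complex.real_smul]

/-! ### Modified Bessel functions -/

/-- `2 z ^ (ν / 2) K_ν (2 √z)`. -/
def besK (ν z : ℝ) : ℝ := ∫ t in Set.Ioi (0 : ℝ), Real.exp (-t - z / t) * t ^ (ν - 1)

lemma exp_neg_le_factorial_div_pow (p : ℕ) {x : ℝ} (hx : 0 < x) :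
    Real.exp (-x) ≤ p.factorial / x ^ p := by
  rw [Real.exp_neg, inv_eq_one_div, div_le_div_iff₀ (Real.exp_pos _) (by positivity), one_mul]
  have := Real.pow_div_factorial_le_exp x hx.le p
  rw [div_le_iff₀ (by positivity)] at this
  linarith

/-- For `z > 0` the factor `exp(-z/t)` is smaller than any power of `t` near `0`. Trading it for
`t^p` with `ν + p > 0` leaves a convergent Gamma integral, so no sign condition on `ν` is needed. -/
lemma integrableOn_besK (ν : ℝ) {z : ℝ} (hz : 0 < z) :
    IntegrableOn (fun t : ℝ => Real.exp (-t - z / t) * t ^ (ν - 1)) (Set.Ioi 0) := by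
  obtain ⟨p, hp⟩ := exists_nat_gt (-ν)
  have h := (Real.GammaIntegral_convergent (s := ν + p) (by linarith)).const_mul
    ((p.factorial : ℝ) / z ^ p)
  refine Integrable.mono' h ?_ ?_
  · exact Measurable.aestronglyMeasurable (by fun_prop)
  · filter_upwards [ae_restrict_mem measurableSet_Ioi] with t ht
    have ht : 0 < t := ht
    rw [Real.norm_of_nonneg (by positivity), sub_eq_add_neg, Real.exp_add]
    have h1 := exp_neg_le_factorial_div_pow p (x := z / t) (by positivity)
    have h2 : t ^ (ν + p - 1) = t ^ (ν - 1) * t ^ p := by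
      rw [← Real.rpow_natCast, ← Real.rpow_add ht]; congr 1; ring
    rw [h2]
    calc Real.exp (-t) * Real.exp (-(z / t)) * t ^ (ν - 1)
        ≤ Real.exp (-t) * (p.factorial / (z / t) ^ p) * t ^ (ν - 1) := by gcongr
      _ = _ := by rw [div_pow]; field_simp

/-- The substitution `t ↦ z/t` exchanges the two terms of the exponent; it is carried out as an
inversion followed by a dilation. -/
lemma besK_neg (ν : ℝ) {z : ℝ} (hz : 0 < z) : besK ν z = z ^ ν * besK (-ν) z := by
  have h1 := integral_comp_rpow_Ioi (fun t : ℝ => Real.exp (-t - z / t) * t ^ (ν - 1))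
    (p := -1) (by norm_num)
  have h2 := integral_comp_mul_left_Ioi
    (fun t : ℝ => Real.exp (-(1 / t) - z * t) * t ^ (-ν - 1)) 0 (b := 1 / z) (by positivity)
  simp only [mul_zero, smul_eq_mul] at h2
  have h3 : besK ν z = ∫ t in Set.Ioi (0 : ℝ), Real.exp (-(1 / t) - z * t) * t ^ (-ν - 1) := by
    rw [besK, ← h1]
    refine setIntegral_congr_fun measurableSet_Ioi fun t ht => ?_
    have ht : 0 < t := ht
    simp only [smul_eq_mul]
    rw [Real.rpow_neg_one, Real.inv_rpow ht.le, ← Real.rpow_neg ht.le, abs_neg, abs_one, one_mul,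
      mul_left_comm, ← Real.rpow_add ht]
    congr 2
    · field_simp
    · ring
  have h4 : ∀ t ∈ Set.Ioi (0 : ℝ), Real.exp (-(1 / (1 / z * t)) - z * (1 / z * t)) *
      (1 / z * t) ^ (-ν - 1) = z ^ (ν + 1) * (Real.exp (-t - z / t) * t ^ (-ν - 1)) := by
    intro t ht
    have ht : 0 < t := ht
    rw [Real.mul_rpow (by positivity) ht.le, one_div z, Real.inv_rpow hz.le, ← Real.rpow_neg hz.le,
      show -(-ν - 1) = ν + 1 by ring, mul_left_comm]
    congr 3
    field_simp
    ring
  rw [setIntegral_congr_fun measurableSet_Ioi h4, integral_const_mul, ← h3] at h2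
  rw [Real.rpow_add_one hz.ne'] at h2
  have h5 : z ^ ν * z * besK (-ν) z = (1 / z)⁻¹ * besK ν z := h2
  rw [one_div, inv_inv] at h5
  exact mul_left_cancel₀ hz.ne' (by linear_combination -h5)

lemma hasDerivAt_besK (ν : ℝ) {z : ℝ} (hz : 0 < z) :
    HasDerivAt (besK ν) (-besK (ν - 1) z) z := by
  have hz2 : 0 < z / 2 := by positivity
  have key := (hasDerivAt_integral_of_dominated_loc_of_deriv_le
    (μ := volume.restrict (Set.Ioi (0 : ℝ)))
    (F := fun z t => Real.exp (-t - z / t) * t ^ (ν - 1))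
    (F' := fun z t => -(Real.exp (-t - z / t) * t ^ (ν - 1 - 1)))
    (bound := fun t => Real.exp (-t - z / 2 / t) * t ^ (ν - 1 - 1))
    (s := Set.Ioi (z / 2)) (x₀ := z) (Ioi_mem_nhds (by linarith)) ?_ ?_ ?_ ?_ ?_ ?_).2
  · rw [integral_neg] at key
    exact key
  · exact Eventually.of_forall fun x => Measurable.aestronglyMeasurable (by fun_prop)
  · exact integrableOn_besK ν hz
  · exact Measurable.aestronglyMeasurable (by fun_prop)
  · filter_upwards [ae_restrict_mem measurableSet_Ioi] with t ht x hx
    have ht : 0 < t := ht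
    have hx : z / 2 < x := hx
    rw [norm_neg, Real.norm_of_nonneg (by positivity)]
    gcongr
  · exact integrableOn_besK (ν - 1) hz2
  · filter_upwards [ae_restrict_mem measurableSet_Ioi] with t ht x hx
    have ht : 0 < t := ht
    have h1 : HasDerivAt (fun x : ℝ => -t - x / t) (-(1 / t)) x :=
      ((hasDerivAt_id x).div_const t).const_sub (-t)
    refine (h1.exp.mul_const (t ^ (ν - 1))).congr_deriv ?_
    rw [Real.rpow_sub_one ht.ne' (ν - 1)]
    ring

/-- Differentiating `besK ν z = z^ν besK (-ν) z` and comparing with `besK' ν = -besK (ν-1)` gives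
the recurrence, after the negative orders are reflected back. -/
lemma besK_contiguous (ν : ℝ) {z : ℝ} (hz : 0 < z) :
    besK (ν + 1) z = ν * besK ν z + z * besK (ν - 1) z := by
  have h1 := hasDerivAt_besK ν hz
  have h2 : HasDerivAt (besK ν) (ν * z ^ (ν - 1) * besK (-ν) z + z ^ ν * (-besK (-ν - 1) z)) z := by
    refine ((Real.hasDerivAt_rpow_const (Or.inl hz.ne')).mul
      (hasDerivAt_besK (-ν) hz)).congr_of_eventuallyEq ?_
    filter_upwards [lt_mem_nhds hz] with t ht using besK_neg ν ht
  have h3 := h1.unique h2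
  have h4 := besK_neg ν hz
  have h5 := besK_neg (ν + 1) hz
  rw [show -(ν + 1) = -ν - 1 by ring, Real.rpow_add_one hz.ne'] at h5
  rw [Real.rpow_sub_one hz.ne'] at h3
  rw [h5]
  have h6 : z * (ν * (z ^ ν / z) * besK (-ν) z) = ν * besK ν z := by
    rw [h4]; field_simp
  linear_combination z * h3 + h6

lemma besK_nonneg (ν z : ℝ) : 0 ≤ besK ν z :=
  setIntegral_nonneg measurableSet_Ioi fun t ht => by
    have ht : 0 < t := ht
    positivity

lemma besK_le {ν z : ℝ} (hν : 0 < ν) (hz : 0 < z) : besK ν z ≤ Real.Gamma ν := by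
  rw [Real.Gamma_eq_integral hν]
  refine setIntegral_mono_on (integrableOn_besK ν hz) (Real.GammaIntegral_convergent hν)
    measurableSet_Ioi fun t ht => ?_
  have ht : 0 < t := ht
  have : 0 < z / t := by positivity
  gcongr
  linarith

lemma tendsto_besK {ν : ℝ} (hν : 0 < ν) : Tendsto (besK ν) (𝓝[>] 0) (𝓝 (Real.Gamma ν)) := by
  rw [Real.Gamma_eq_integral hν]
  refine tendsto_integral_filter_of_dominated_convergence
    (fun t => Real.exp (-t) * t ^ (ν - 1)) ?_ ?_ (Real.GammaIntegral_convergent hν) ?_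
  · exact Eventually.of_forall fun x => Measurable.aestronglyMeasurable (by fun_prop)
  · filter_upwards [self_mem_nhdsWithin] with z hz
    have hz : 0 < z := hz
    filter_upwards [ae_restrict_mem measurableSet_Ioi] with t ht
    have ht : 0 < t := ht
    have : 0 < z / t := by positivity
    rw [Real.norm_of_nonneg (by positivity)]
    gcongr
    linarith
  · filter_upwards with t
    have h : Continuous fun z : ℝ => Real.exp (-t - z / t) * t ^ (ν - 1) := by fun_prop
    have := (h.tendsto 0).mono_left (nhdsWithin_le_nhds (s := Set.Ioi 0))
    simpa using this

/-- `z ^ (-μ / 2) I_μ (2 √z)`. -/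
def besI (μ z : ℝ) : ℝ := ∑' l : ℕ, z ^ l / (l.factorial * Real.Gamma (μ + 1 + l))

lemma summable_besI (μ z : ℝ) :
    Summable fun l : ℕ => z ^ l / (l.factorial * Real.Gamma (μ + 1 + l)) := by
  refine Summable.of_norm_bounded_eventually_nat (Real.summable_pow_div_factorial |z|) ?_
  obtain ⟨p, hp⟩ := exists_nat_gt (1 - μ)
  filter_upwards [eventually_ge_atTop p] with l hl
  have hl' : (p : ℝ) ≤ l := by exact_mod_cast hl
  have h1 : 1 ≤ Real.Gamma (μ + 1 + l) := by
    calc (1 : ℝ) = Real.Gamma 2 := Real.Gamma_two.symm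
      _ ≤ _ := Real.Gamma_strictMonoOn_Ici.monotoneOn (by simp)
        (by simp only [Set.mem_Ici]; linarith) (by linarith)
  rw [norm_div, norm_mul, norm_pow, Real.norm_eq_abs, Real.norm_of_nonneg (Nat.cast_nonneg _),
    Real.norm_of_nonneg (by linarith)]
  have : (0 : ℝ) < l.factorial := by positivity
  gcongr
  nlinarith

/-- Termwise `1/Γ(μ+l) = (μ+l)/Γ(μ+1+l)`: the summand `μ` gives order `μ`, and the summand `l`
cancels against `l!` and gives order `μ + 1` after a shift. -/
lemma besI_contiguous {μ : ℝ} (hμ : ∀ l : ℕ, μ + l ≠ 0) (z : ℝ) :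
    besI (μ - 1) z = μ * besI μ z + z * besI (μ + 1) z := by
  have h1 : besI (μ - 1) z = ∑' l : ℕ, (μ * (z ^ l / (l.factorial * Real.Gamma (μ + 1 + l))) +
      l * (z ^ l / (l.factorial * Real.Gamma (μ + 1 + l)))) := by
    refine tsum_congr fun l => ?_
    have e : Real.Gamma (μ + 1 + l) = (μ + l) * Real.Gamma (μ - 1 + 1 + l) := by
      rw [show μ - 1 + 1 + (l : ℝ) = μ + l by ring, ← Real.Gamma_add_one (hμ l)]; ring_nf
    rw [e]
    have := hμ l
    rw [← add_mul, mul_div_assoc', mul_left_comm, mul_div_mul_left _ _ this]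
  have h2 : Summable fun l : ℕ => (l : ℝ) * (z ^ l / (l.factorial * Real.Gamma (μ + 1 + l))) := by
    rw [← summable_nat_add_iff 1]
    refine ((summable_besI (μ + 1) z).mul_left z).congr fun l => ?_
    rw [Nat.factorial_succ, show μ + 1 + ((l + 1 : ℕ) : ℝ) = μ + 1 + 1 + l by push_cast; ring]
    push_cast
    have : (l : ℝ) + 1 ≠ 0 := by positivity
    rw [pow_succ, mul_assoc ((l : ℝ) + 1), mul_div_assoc' ((l : ℝ) + 1), mul_div_mul_left _ _ this]
    ring
  rw [h1, ((summable_besI μ z).mul_left μ).tsum_add h2, tsum_mul_left, h2.tsum_eq_zero_add,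
    besI, besI, ← tsum_mul_left (a := z)]
  simp only [CharP.cast_eq_zero, zero_mul, zero_add]
  congr 1
  refine tsum_congr fun l => ?_
  rw [Nat.factorial_succ, show μ + 1 + ((l + 1 : ℕ) : ℝ) = μ + 1 + 1 + l by push_cast; ring]
  push_cast
  have : (l : ℝ) + 1 ≠ 0 := by positivity
  rw [pow_succ, mul_assoc ((l : ℝ) + 1), mul_div_assoc' ((l : ℝ) + 1), mul_div_mul_left _ _ this]
  ring

lemma powConst_zero_eq {a : ℝ} (ha1 : a < 1) (n : ℕ) :
    powConst a 0 n = 4 ^ n * n.factorial * Real.Gamma (n + 1 - a) / Real.Gamma (1 - a) := by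
  have hg : Real.Gamma (1 - a) ≠ 0 := (Real.Gamma_pos_of_pos (by linarith)).ne'
  induction n with
  | zero => simp [powConst, hg]
  | succ n ih =>
    have hn : (0 : ℝ) ≤ n := Nat.cast_nonneg n
    rw [powConst_succ, ih, show ((n + 1 : ℕ) : ℝ) + 1 - a = (n + 1 - a) + 1 by push_cast; ring,
      Real.Gamma_add_one (by linarith), Nat.factorial_succ]
    push_cast
    field_simp
    ring

lemma powConst_two_mul_eq {a : ℝ} (ha : 0 < a) (n : ℕ) :
    powConst a (2 * a) n = 4 ^ n * n.factorial * Real.Gamma (n + 1 + a) / Real.Gamma (1 + a) := by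
  have hg : Real.Gamma (1 + a) ≠ 0 := (Real.Gamma_pos_of_pos (by linarith)).ne'
  induction n with
  | zero => simp [powConst, hg]
  | succ n ih =>
    have hn : (0 : ℝ) ≤ n := Nat.cast_nonneg n
    rw [powConst_succ, ih, show ((n + 1 : ℕ) : ℝ) + 1 + a = (n + 1 + a) + 1 by push_cast; ring,
      Real.Gamma_add_one (by linarith), Nat.factorial_succ]
    push_cast
    field_simp
    ring

/-- The expansion of `besK` at `z = 0`. -/
def BesKExpansion (ν z : ℝ) : Prop :=
  besK ν z = Real.Gamma ν * Real.Gamma (1 - ν) * (besI (-ν) z - z ^ ν * besI ν z)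

/-- By the recurrence, `u(y) = besK a (y²/4)` solves `T u = u`, and it is bounded with computable
traces at `0`. The series theorem with `k = 1` therefore yields its expansion in the normalized
powers, which sum to `besI (-a)` and `z^a besI a`. -/
lemma besKExpansion_of_mem_Ioo {a : ℝ} (ha : 0 < a) (ha1 : a < 1) {z : ℝ} (hz : 0 < z) :
    BesKExpansion a z := by
  set A : UnitExp := ⟨a, ha, ha1⟩ with hA
  set u : ℝ → ℂ := fun y => (besK a (y ^ 2 / 4) : ℂ) with hu
  set u1 : ℝ → ℂ := fun y => ((-besK (a - 1) (y ^ 2 / 4) * (y / 2) : ℝ) : ℂ) with hu1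
  set u2 : ℝ → ℂ := fun y =>
    ((besK (a - 1 - 1) (y ^ 2 / 4) * (y / 2) * (y / 2) - besK (a - 1) (y ^ 2 / 4) * (1 / 2) : ℝ) : ℂ)
    with hu2
  set τ : ℝ := Real.Gamma a with hτ
  -- Determined by `y^(1-2a) u' → 2aσ`: reflection writes `besK (a-1)` as `z^(a-1) besK (1-a)`, and
  -- `besK (1-a)` tends to `Γ(1-a)`.
  set σ : ℝ := -(4 ^ (-a) * Real.Gamma (1 - a) / a) with hσ
  have hsq : ∀ y : ℝ, 0 < y → 0 < y ^ 2 / 4 := fun y hy => by positivity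
  have hd : ∀ y : ℝ, HasDerivAt (fun y : ℝ => y ^ 2 / 4) (y / 2) y := fun y => by
    refine ((hasDerivAt_pow 2 y).div_const 4).congr_deriv ?_
    simp only [Nat.cast_ofNat, Nat.add_one_sub_one, pow_one]; ring
  have hdK : ∀ (ν y : ℝ), 0 < y → HasDerivAt (fun y : ℝ => besK ν (y ^ 2 / 4))
      (-besK (ν - 1) (y ^ 2 / 4) * (y / 2)) y := fun ν y hy =>
    HasDerivAt.comp (h₂ := besK ν) (h := fun y => y ^ 2 / 4) y (hasDerivAt_besK ν (hsq y hy)) (hd y)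
  have h1 : ∀ y, 0 < y → HasDerivAt u (u1 y) y := fun y hy => (hdK a y hy).ofReal_comp
  have h2 : ∀ y, 0 < y → HasDerivAt u1 (u2 y) y := fun y hy => by
    have := ((hdK (a - 1) y hy).neg.mul ((hasDerivAt_id y).div_const 2)).ofReal_comp
    refine this.congr_deriv ?_
    simp only [hu2, Pi.neg_apply]
    congr 1
    simp only [id]
    ring
  have hlim0 : Tendsto (fun y : ℝ => y ^ 2 / 4) (𝓝[>] 0) (𝓝[>] 0) := by
    rw [tendsto_nhdsWithin_iff]
    constructor
    · have h : Continuous fun y : ℝ => y ^ 2 / 4 := by fun_prop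
      simpa using (h.tendsto 0).mono_left (nhdsWithin_le_nhds (s := Set.Ioi 0))
    · filter_upwards [self_mem_nhdsWithin] with y hy using hsq y hy
  have hlimτ : Tendsto u (𝓝[>] 0) (𝓝 (τ : ℂ)) :=
    (Complex.continuous_ofReal.tendsto _).comp ((tendsto_besK ha).comp hlim0)
  have hlimσ : Tendsto (fun y => ((y ^ (1 - 2 * (A : ℝ)) : ℝ) : ℂ) * u1 y) (𝓝[>] 0)
      (𝓝 (2 * (A : ℝ) * (σ : ℂ))) := by
    have h3 : Tendsto (fun y : ℝ => -(1 / 2 * 4 ^ (1 - a)) * besK (1 - a) (y ^ 2 / 4)) (𝓝[>] 0)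
        (𝓝 (2 * a * σ)) := by
      have h4 := ((tendsto_besK (show 0 < 1 - a by linarith)).comp hlim0).const_mul
        (-(1 / 2 * 4 ^ (1 - a)))
      have h5 : 2 * a * σ = -(1 / 2 * 4 ^ (1 - a)) * Real.Gamma (1 - a) := by
        rw [hσ, sub_eq_add_neg 1 a, Real.rpow_add (by norm_num), Real.rpow_one]
        field_simp
        ring
      rw [h5]
      exact h4
    have h5 := (Complex.continuous_ofReal.tendsto _).comp h3
    have e : (2 * (A : ℝ) * (σ : ℂ)) = ((2 * a * σ : ℝ) : ℂ) := by push_cast; rfl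
    rw [e]
    refine h5.congr' ?_
    filter_upwards [self_mem_nhdsWithin] with y hy
    have hy : 0 < y := hy
    simp only [Function.comp, hu1]
    rw [← Complex.ofReal_mul]
    congr 1
    have e4 : (y ^ 2 / 4) ^ (a - 1) = 4 ^ (1 - a) * y ^ (((2 : ℕ) : ℝ) * -(1 - a)) := by
      rw [Real.div_rpow (by positivity) (by norm_num), ← Real.rpow_natCast, ← Real.rpow_mul hy.le,
        show (a - 1) = -(1 - a) by ring, Real.rpow_neg (by norm_num : (0 : ℝ) ≤ 4), div_inv_eq_mul,
        mul_comm]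
    rw [besK_neg (a - 1) (hsq y hy), show -(a - 1) = 1 - a by ring, e4]
    have r : y ^ (1 - 2 * a) * y ^ (((2 : ℕ) : ℝ) * -(1 - a)) * y = 1 := by
      rw [← Real.rpow_add hy, ← Real.rpow_add_one hy.ne', ← Real.rpow_zero y]
      congr 1; push_cast; ring
    have hA' : (A : ℝ) = a := rfl
    rw [hA']
    linear_combination (-(1 / 2) * 4 ^ (1 - a) * besK (1 - a) (y ^ 2 / 4)) * (-r)
  have hmem : (Set.Ioi 0).indicator u ∈ LocBdd := by
    refine ⟨?_, fun y hy => by simp [hy], fun Y => ⟨Real.Gamma a, fun y _ => ?_⟩⟩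
    · classical
      rw [← Set.piecewise_eq_indicator]
      exact ContinuousOn.measurable_piecewise
        (fun y hy => (h1 y hy).continuousAt.continuousWithinAt) continuousOn_const measurableSet_Ioi
    · by_cases h0 : 0 < y
      · rw [Set.indicator_of_mem (show y ∈ Set.Ioi (0 : ℝ) from h0), hu, Complex.norm_real,
          Real.norm_of_nonneg (besK_nonneg _ _)]
        exact besK_le ha (hsq y h0)
      · rw [Set.indicator_of_notMem (show y ∉ Set.Ioi (0 : ℝ) from h0), norm_zero]
        exact (Real.Gamma_pos_of_pos ha).le
  set f : LocBdd := ⟨_, hmem⟩ with hf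
  have hfy : ∀ y, 0 < y → (f : ℝ → ℂ) y = u y := fun y hy => by simp [hf, hy]
  have heq : ∀ y, 0 < y → (f : ℝ → ℂ) y = u2 y + (((1 - 2 * (A : ℝ)) / y : ℝ) : ℂ) * u1 y := by
    intro y hy
    rw [hfy y hy]
    simp only [hu, hu1, hu2]
    rw [← Complex.ofReal_mul, ← Complex.ofReal_add]
    congr 1
    have := besK_contiguous (a - 1) (hsq y hy)
    rw [sub_add_cancel] at this
    rw [this]
    have hA' : (A : ℝ) = a := rfl
    rw [hA']
    field_simp
    ring
  have hinv := fun y hy => normalInv_eq_of_hasDerivAt A h1 h2 hlimτ hlimσ heq (y := y) hy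
  -- The sequence in `l` is constant because `T u = u`; with `k = 1` only level `0` carries traces,
  -- so every Pascal coefficient equals the trace itself.
  set t : ℕ → ℕ → ℂ := fun i _ => if i = 0 then (τ : ℂ) else 0 with ht
  set s : ℕ → ℕ → ℂ := fun i _ => if i = 0 then (σ : ℂ) else 0 with hs
  have hpas : ∀ (c : ℂ) (n l : ℕ), pascal (fun i _ => if i = 0 then c else 0) n 0 l = c := by
    intro c n
    induction n with
    | zero => intro l; simp [pascal]
    | succ n ih =>
      intro l
      rw [pascal, ih, pascal_eq_zero (k := 1) (fun i l hi => if_neg (by omega)) n _ le_rfl, zero_add]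
  have main := hasSum_of_one_sub_invShift_pow A 1 (t := t) (s := s) (M := max |τ| |σ|) (θ := 1)
    (fun i l => by
      simp only [ht]; split_ifs <;> simp) (fun i l => by simp only [hs]; split_ifs <;> simp)
    zero_le_one (fun i l hi => if_neg (by omega)) (fun i l hi => if_neg (by omega))
    (u := fun _ => f) (fun Y => by
      obtain ⟨M, hM⟩ := f.2.2.2 Y
      exact ⟨M, 1, fun l y hy => by simpa using hM y hy⟩) (by
      funext l
      refine LocBdd.ext_pos fun y hy => ?_
      have e1 : ((((1 - invShift A : Module.End ℂ (ℕ → LocBdd)) ^ 1) fun _ => f) l : ℝ → ℂ) y =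
          (f : ℝ → ℂ) y - (normalInv A f : ℝ → ℂ) y := rfl
      rw [e1, hinv y hy, hfy y hy]
      simp [srcSeq, ht, hs, powLoc_apply A _ _ hy, powFun, powConst]
      ring) 0
    (y := 2 * √z) (by positivity)
  have hzz : (2 * √z) ^ 2 / 4 = z := by rw [mul_pow, Real.sq_sqrt hz.le]; ring
  rw [hfy _ (by positivity)] at main
  simp only [hu, hzz, ht, hs, hpas] at main
  have m1 : besK a z = τ * ∑' n, powFun a 0 n (2 * √z) + σ * ∑' n, powFun a (2 * a) n (2 * √z) := by
    rw [← tsum_mul_left, ← tsum_mul_left, ← Complex.ofReal_inj, main]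
    push_cast
    rfl
  have hpw : ∀ n : ℕ, (2 * √z) ^ (2 * (n : ℝ)) = 4 ^ n * z ^ n := by
    intro n
    rw [Real.rpow_mul (by positivity), Real.rpow_two, Real.rpow_natCast, ← mul_pow]
    congr 1
    linarith
  have m2 : ∑' n, powFun a 0 n (2 * √z) = Real.Gamma (1 - a) * besI (-a) z := by
    rw [besI, ← tsum_mul_left]
    refine tsum_congr fun n => ?_
    rw [powFun, powConst_zero_eq ha1, zero_add, hpw, show -a + 1 + (n : ℝ) = n + 1 - a by ring]
    have : Real.Gamma (n + 1 - a) ≠ 0 := (Real.Gamma_pos_of_pos (by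
      have : (0 : ℝ) ≤ n := Nat.cast_nonneg n
      linarith)).ne'
    field_simp
  have m3 : ∑' n, powFun a (2 * a) n (2 * √z) = 4 ^ a * Real.Gamma (1 + a) * z ^ a * besI a z := by
    rw [besI, ← tsum_mul_left]
    refine tsum_congr fun n => ?_
    rw [powFun, powConst_two_mul_eq ha, Real.rpow_add (by positivity), hpw,
      show a + 1 + (n : ℝ) = n + 1 + a by ring]
    have r : (2 * √z) ^ (2 * a) = 4 ^ a * z ^ a := by
      rw [Real.rpow_mul (by positivity), ← Real.mul_rpow (by norm_num) hz.le, Real.rpow_two]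
      congr 1
      linarith
    rw [r]
    have : Real.Gamma (n + 1 + a) ≠ 0 := (Real.Gamma_pos_of_pos (by
      have : (0 : ℝ) ≤ n := Nat.cast_nonneg n
      linarith)).ne'
    field_simp
  rw [BesKExpansion, m1, m2, m3, hτ, hσ, add_comm 1 a, Real.Gamma_add_one ha.ne',
    Real.rpow_neg (by norm_num)]
  have : (4 : ℝ) ^ a ≠ 0 := by positivity
  field_simp
  ring

lemma Gamma_mul_one_sub_neg {ν : ℝ} (hν : ν ≠ 0) :
    Real.Gamma (-ν) * Real.Gamma (1 - -ν) = -(Real.Gamma ν * Real.Gamma (1 - ν)) := by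
  have h1 := Real.Gamma_add_one hν
  have h2 := Real.Gamma_add_one (neg_ne_zero.2 hν)
  rw [show 1 - -ν = ν + 1 by ring, h1, show 1 - ν = -ν + 1 by ring, h2]
  ring

lemma BesKExpansion.neg {ν z : ℝ} (hν : ν ≠ 0) (hz : 0 < z) (h : BesKExpansion ν z) :
    BesKExpansion (-ν) z := by
  unfold BesKExpansion at h ⊢
  have h1 := besK_neg (-ν) hz
  rw [neg_neg, h] at h1
  rw [h1, Gamma_mul_one_sub_neg hν, neg_neg, Real.rpow_neg hz.le]
  have : z ^ ν ≠ 0 := (Real.rpow_pos_of_pos hz _).ne'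
  field_simp
  ring

/-- Both sides obey the same three-term recurrence in `ν`, because the factor `Γ(ν)Γ(1-ν)` changes
sign under `ν ↦ ν ± 1`. -/
lemma BesKExpansion.add_one {ν z : ℝ} (hν : ∀ p : ℤ, ν ≠ p) (hz : 0 < z) (h : BesKExpansion ν z)
    (h' : BesKExpansion (ν - 1) z) : BesKExpansion (ν + 1) z := by
  unfold BesKExpansion at h h' ⊢
  have hν0 : ν ≠ 0 := by simpa using hν 0
  have hν1 : ν - 1 ≠ 0 := by
    intro h0; exact hν 1 (by push_cast; linarith)
  have hν2 : -ν ≠ 0 := neg_ne_zero.2 hν0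
  have g1 : Real.Gamma (ν + 1) * Real.Gamma (1 - (ν + 1)) = -(Real.Gamma ν * Real.Gamma (1 - ν)) := by
    rw [Real.Gamma_add_one hν0, show 1 - (ν + 1) = -ν by ring, show 1 - ν = -ν + 1 by ring,
      Real.Gamma_add_one hν2]; ring
  have g2 : Real.Gamma (ν - 1) * Real.Gamma (1 - (ν - 1)) =
      -(Real.Gamma ν * Real.Gamma (1 - ν)) := by
    have e1 := Real.Gamma_add_one hν1
    have e2 := Real.Gamma_add_one (s := 1 - ν) (by intro h0; apply hν1; linarith)
    rw [sub_add_cancel] at e1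
    rw [show 1 - (ν - 1) = 1 - ν + 1 by ring, e2, e1]; ring
  have c1 := besI_contiguous (μ := -ν) (fun l h0 => hν l (by push_cast; linarith)) z
  have c2 := besI_contiguous (μ := ν) (fun l h0 => hν (-l) (by push_cast; linarith)) z
  rw [besK_contiguous ν hz, h, h', g1, g2, show -(ν + 1) = -ν - 1 by ring, c1,
    show -(ν - 1) = -ν + 1 by ring, c2, Real.rpow_add_one hz.ne', Real.rpow_sub_one hz.ne']
  field_simp
  ring

/-- Two-step induction on the integer part. The start needs the orders `a` and `a - 1`, the latter
being the reflection of `1 - a ∈ (0,1)`; negative orders follow by reflection as well. -/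
lemma besKExpansion {ν : ℝ} (hν : ∀ p : ℤ, ν ≠ p) {z : ℝ} (hz : 0 < z) : BesKExpansion ν z := by
  have step : ∀ (n : ℕ) (a : ℝ), 0 < a → a < 1 → BesKExpansion (a + n) z := by
    intro n a ha ha1
    have nonint : ∀ (n : ℕ) (p : ℤ), a + n ≠ p := by
      intro n p hp
      have h1 : ((p - n : ℤ) : ℝ) = a := by push_cast; linarith
      have h2 : (0 : ℝ) < ((p - n : ℤ) : ℝ) := h1 ▸ ha
      have h3 : ((p - n : ℤ) : ℝ) < 1 := h1 ▸ ha1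
      have h4 : 0 < p - n := by exact_mod_cast h2
      have h5 : p - n < 1 := by exact_mod_cast h3
      omega
    induction n using Nat.strong_induction_on with
    | _ n ih =>
      match n with
      | 0 => simpa using besKExpansion_of_mem_Ioo ha ha1 hz
      | 1 =>
        have h1 := (besKExpansion_of_mem_Ioo (show 0 < 1 - a by linarith) (by linarith) hz).neg
          (by linarith) hz
        rw [neg_sub] at h1
        have := BesKExpansion.add_one (by simpa using nonint 0) hz
          (besKExpansion_of_mem_Ioo ha ha1 hz) h1
        simpa using this
      | n + 2 =>
        have h1 := ih (n + 1) (by omega)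
        have h2 := ih n (by omega)
        have := BesKExpansion.add_one (nonint (n + 1)) hz h1 (by
          convert h2 using 1; push_cast; ring)
        convert this using 1; push_cast; ring
  have hpos : ∀ μ : ℝ, (∀ p : ℤ, μ ≠ p) → 0 < μ → BesKExpansion μ z := by
    intro μ hμ hμ0
    have h1 : 0 < Int.fract μ := Int.fract_pos.2 (fun h => hμ _ h)
    have h2 := step ⌊μ⌋₊ _ h1 (Int.fract_lt_one μ)
    rwa [natCast_floor_eq_intCast_floor hμ0.le, Int.fract_add_floor] at h2
  rcases lt_trichotomy ν 0 with h | h | h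
  · have := (hpos (-ν) (fun p hp => hν (-p) (by push_cast; linarith)) (by linarith)).neg
      (by linarith) hz
    rwa [neg_neg] at this
  · exact absurd h (by simpa using hν 0)
  · exact hpos ν hν h

lemma exists_besK_le (ν : ℝ) (hν : ν ≠ 0) : ∃ C : ℝ, ∀ z, 1 ≤ z → |besK ν z| ≤ C := by
  rcases lt_or_gt_of_ne hν with h | h
  · refine ⟨Real.Gamma (-ν), fun z hz => ?_⟩
    have hz0 : 0 < z := by linarith
    rw [abs_of_nonneg (besK_nonneg _ _), besK_neg ν hz0]
    calc z ^ ν * besK (-ν) z ≤ 1 * besK (-ν) z :=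
          mul_le_mul_of_nonneg_right (Real.rpow_le_one_of_one_le_of_nonpos hz h.le)
            (besK_nonneg _ _)
      _ ≤ _ := by rw [one_mul]; exact besK_le (by linarith) hz0
  · refine ⟨Real.Gamma ν, fun z hz => ?_⟩
    rw [abs_of_nonneg (besK_nonneg _ _)]
    exact besK_le h (by linarith)

/-! ### Interpolation polynomials -/

lemma Gamma_ne_zero_of_eq {b : ℝ} (hb : ∀ p : ℤ, b ≠ p) {x : ℝ} (p : ℤ) (hx : x = p + b) :
    Real.Gamma x ≠ 0 :=
  Real.Gamma_ne_zero fun m h => hb (-m - p) (by push_cast; linarith)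

lemma Gamma_add_one_eq_descPochhammer (x : ℝ) (k : ℕ) (h : ∀ i < k, x ≠ i) :
    Real.Gamma (x + 1) = (descPochhammer ℝ k).eval x * Real.Gamma (x + 1 - k) := by
  induction k with
  | zero => simp
  | succ k ih =>
    rw [ih fun i hi => h i (by omega), descPochhammer_succ_eval,
      show x + 1 - k = (x - k) + 1 by ring,
      Real.Gamma_add_one (sub_ne_zero.2 (h k (by omega)))]
    push_cast
    rw [show x + 1 - (k + 1) = x - k by ring]
    ring

/-- The polynomial `x (x-1) ⋯ (x-i+1) (x+b) (x+b-1) ⋯ (x+b-N+i+1)`. -/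
def interpPoly (b : ℝ) (N i : ℕ) : Polynomial ℝ :=
  descPochhammer ℝ i * (descPochhammer ℝ (N - i)).comp (Polynomial.X + Polynomial.C b)

/-- The values of `interpPoly` at natural numbers. -/
def interpVal (b : ℝ) (N i j : ℕ) : ℝ := (interpPoly b N i).eval (j : ℝ)

lemma natDegree_interpPoly_le (b : ℝ) {N i : ℕ} (hi : i ≤ N) : (interpPoly b N i).natDegree ≤ N := by
  refine Polynomial.natDegree_mul_le.trans ?_
  rw [Polynomial.natDegree_comp, descPochhammer_natDegree, descPochhammer_natDegree,
    Polynomial.natDegree_X_add_C]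
  omega

lemma eval_interpPoly {b : ℝ} (hb : ∀ p : ℤ, b ≠ p) {N i : ℕ} (hi : i ≤ N) (j : ℕ) :
    interpVal b N i j =
      j.descFactorial i * (Real.Gamma (1 + j + b) / Real.Gamma (1 + j + i - N + b)) := by
  have h := Gamma_add_one_eq_descPochhammer (j + b) (N - i) fun l _ h =>
    hb (l - j) (by push_cast; linarith)
  rw [Nat.cast_sub hi, show (j : ℝ) + b + 1 - (N - i) = 1 + j + i - N + b by ring,
    show (j : ℝ) + b + 1 = 1 + j + b by ring] at h
  rw [interpVal, interpPoly, Polynomial.eval_mul, descPochhammer_eval_eq_descFactorial, Polynomial.eval_comp, h,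
    mul_div_assoc, div_self (Gamma_ne_zero_of_eq hb (1 + j + i - N) (by push_cast; ring)), mul_one]
  simp

lemma eval_interpPoly_self_ne_zero {b : ℝ} (hb : ∀ p : ℤ, b ≠ p) {N i : ℕ} (hi : i ≤ N) :
    interpVal b N i i ≠ 0 := by
  rw [eval_interpPoly hb hi, Nat.descFactorial_self]
  exact mul_ne_zero (by positivity) (div_ne_zero
    (Gamma_ne_zero_of_eq hb (1 + i) (by push_cast; ring))
    (Gamma_ne_zero_of_eq hb (1 + i + i - N) (by push_cast; ring)))

/-- The factor `x(x-1)⋯(x-i+1)` vanishes at `j`. Together with nonvanishing on the diagonal, this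
makes evaluation at `0, …, N` triangular. -/
lemma eval_interpPoly_eq_zero {b : ℝ} (hb : ∀ p : ℤ, b ≠ p) {N i : ℕ} (hi : i ≤ N) {j : ℕ}
    (hj : j < i) : interpVal b N i j = 0 := by
  rw [eval_interpPoly hb hi, Nat.descFactorial_of_lt hj]; simp

/-- The coefficients in the recursions for the boundary operators. -/
def gammaCoeff (b : ℝ) (N j i : ℕ) : ℝ :=
  (j.choose (j - i) : ℝ) * (Real.Gamma (1 + j + b) * Real.Gamma (1 + 2 * i - N + b)) /
    (Real.Gamma (1 + i + b) * Real.Gamma (1 + j + i - N + b))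

/-- The reason for the Gamma factors in the boundary operators: they are the ratios of values needed
to solve the triangular interpolation problem. Since `b` is not an integer, no Gamma factor
vanishes, not even at the junk values of poles. -/
lemma gammaCoeff_mul_eval {b : ℝ} (hb : ∀ p : ℤ, b ≠ p) {N i : ℕ} (hi : i ≤ N) {j : ℕ}
    (hj : i ≤ j) : gammaCoeff b N j i * interpVal b N i i =
      interpVal b N i j := by
  rw [eval_interpPoly hb hi, eval_interpPoly hb hi, gammaCoeff, Nat.choose_symm hj,
    Nat.descFactorial_self, Nat.descFactorial_eq_factorial_mul_choose,
    show (1 : ℝ) + 2 * i - N + b = 1 + i + i - N + b by ring]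
  have h1 : Real.Gamma (1 + i + b) ≠ 0 := Gamma_ne_zero_of_eq hb (1 + i) (by push_cast; ring)
  have h2 : Real.Gamma (1 + i + i - N + b) ≠ 0 :=
    Gamma_ne_zero_of_eq hb (1 + i + i - N) (by push_cast; ring)
  push_cast
  field_simp

/-- Both sides are polynomials in `n` of degree at most `N`, the left one in Newton form. The
recursion says that they agree at `0, …, N`, hence they agree at every `n`. -/
lemma sum_choose_eq_sum_interpPoly {b : ℝ} (hb : ∀ p : ℤ, b ≠ p) (N : ℕ) (t β : ℕ → ℂ)
    (hβ : ∀ j ≤ N, β j = ∑ s ∈ Finset.range (N + 1), (j.choose s : ℂ) * t s -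
      ∑ i : Fin j, (gammaCoeff b N j i : ℂ) * β i) (n : ℕ) :
    ∑ s ∈ Finset.range (N + 1), (n.choose s : ℂ) * t s =
      ∑ i ∈ Finset.range (N + 1), β i / (interpVal b N i i : ℂ) *
        (interpVal b N i n : ℂ) := by
  set p : Polynomial ℂ := ∑ s ∈ Finset.range (N + 1),
    Polynomial.C (t s / s.factorial) * descPochhammer ℂ s with hp
  set q : Polynomial ℂ := ∑ i ∈ Finset.range (N + 1),
    Polynomial.C (β i / (interpVal b N i i : ℂ)) *
      (interpPoly b N i).map (algebraMap ℝ ℂ) with hq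
  have ep : ∀ n : ℕ, p.eval (n : ℂ) = ∑ s ∈ Finset.range (N + 1), (n.choose s : ℂ) * t s := by
    intro n
    rw [hp, Polynomial.eval_finsetSum]
    refine Finset.sum_congr rfl fun s _ => ?_
    rw [Polynomial.eval_mul, Polynomial.eval_C, descPochhammer_eval_eq_descFactorial,
      Nat.descFactorial_eq_factorial_mul_choose]
    have : (s.factorial : ℂ) ≠ 0 := by exact_mod_cast s.factorial_ne_zero
    push_cast
    field_simp
  have eq : ∀ n : ℕ, q.eval (n : ℂ) =
      ∑ i ∈ Finset.range (N + 1), β i / (interpVal b N i i : ℂ) *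
        (interpVal b N i n : ℂ) := by
    intro n
    rw [hq, Polynomial.eval_finsetSum]
    refine Finset.sum_congr rfl fun i _ => ?_
    rw [Polynomial.eval_mul, Polynomial.eval_C]
    congr 1
    have := Polynomial.eval_map_algebraMap (B := ℂ) (interpPoly b N i) (algebraMap ℝ ℂ (n : ℝ))
    rw [Polynomial.aeval_algebraMap_apply] at this
    simpa [interpVal] using this
  rw [← ep, ← eq]
  have dp : p.natDegree ≤ N := by
    refine Polynomial.natDegree_sum_le_of_forall_le _ _ fun s hs => ?_
    refine (Polynomial.natDegree_C_mul_le _ _).trans ?_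
    rw [descPochhammer_natDegree]
    have := Finset.mem_range.1 hs
    omega
  have dq : q.natDegree ≤ N := by
    refine Polynomial.natDegree_sum_le_of_forall_le _ _ fun i hi => ?_
    refine (Polynomial.natDegree_C_mul_le _ _).trans ?_
    refine Polynomial.natDegree_map_le.trans ?_
    exact natDegree_interpPoly_le b (by have := Finset.mem_range.1 hi; omega)
  have : p = q := by
    refine Polynomial.eq_of_natDegree_lt_card_of_eval_eq p q
      (f := fun i : Fin (N + 1) => ((i : ℕ) : ℂ)) (fun i j h => Fin.ext (Nat.cast_injective h))
      (fun i => ?_) (by rw [Fintype.card_fin]; omega)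
    have hi : (i : ℕ) ≤ N := by omega
    rw [ep, eq]
    have h1 := hβ i hi
    rw [eq_sub_iff_add_eq] at h1
    rw [← h1, Finset.sum_fin_eq_sum_range]
    have h2 : Finset.range (N + 1) = Finset.range ((i : ℕ) + 1 + (N - i)) := by congr 1; omega
    rw [h2, Finset.sum_range_add, Finset.sum_range_succ]
    have h3 : ∑ x ∈ Finset.range (N - i), β (i + 1 + x) /
        (interpVal b N (i + 1 + x) (i + 1 + x : ℕ) : ℂ) *
        (interpVal b N (i + 1 + x) (i : ℕ) : ℂ) = 0 :=
      Finset.sum_eq_zero fun x hx => by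
        have := Finset.mem_range.1 hx
        rw [eval_interpPoly_eq_zero hb (show (i : ℕ) + 1 + x ≤ N by omega) (j := i) (by omega)]; simp
    rw [h3, add_zero, add_comm]
    congr 1
    · refine Finset.sum_congr rfl fun l hl => ?_
      have hl := Finset.mem_range.1 hl
      rw [dif_pos hl, ← gammaCoeff_mul_eval hb (show l ≤ N by omega) hl.le]
      have : (interpVal b N l l : ℂ) ≠ 0 := by
        exact_mod_cast eval_interpPoly_self_ne_zero hb (show l ≤ N by omega)
      push_cast
      field_simp
    · have : (interpVal b N i (i : ℕ) : ℂ) ≠ 0 := by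
        exact_mod_cast eval_interpPoly_self_ne_zero hb hi
      field_simp
  rw [this]

/-- The general term of the series attached to a polynomial. -/
def besTerm (b : ℝ) (p : Polynomial ℝ) (z : ℝ) (n : ℕ) : ℝ :=
  p.eval (n : ℝ) * (z ^ n / (n.factorial * Real.Gamma (1 + n + b)))

/-- The two factors of `interpPoly` shift the two factorials: the coefficient becomes `1/((n-i)!
Γ(1+n+i-N+b))`, and the terms with `n < i` vanish. -/
lemma hasSum_besTerm_interpPoly {b : ℝ} (hb : ∀ p : ℤ, b ≠ p) {N i : ℕ} (hi : i ≤ N) (z : ℝ) :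
    HasSum (besTerm b (interpPoly b N i) z) (z ^ i * besI (b - N + 2 * i) z) := by
  have h1 : ∑ n ∈ Finset.range i, besTerm b (interpPoly b N i) z n = 0 :=
    Finset.sum_eq_zero fun n hn => by
      rw [besTerm, ← interpVal, eval_interpPoly_eq_zero hb hi (Finset.mem_range.1 hn), zero_mul]
  have h2 := ((summable_besI (b - N + 2 * i) z).hasSum.mul_left (z ^ i))
  rw [← hasSum_nat_add_iff' i, h1, sub_zero]
  suffices e : ∀ l, besTerm b (interpPoly b N i) z (l + i) =
      z ^ i * (z ^ l / (l.factorial * Real.Gamma (b - N + 2 * i + 1 + l))) by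
    rw [funext e]
    exact h2
  intro l
  rw [besTerm, ← interpVal, eval_interpPoly hb hi]
  have e1 : Real.Gamma (1 + ((l + i : ℕ) : ℝ) + b) ≠ 0 :=
    Gamma_ne_zero_of_eq hb (1 + l + i) (by push_cast; ring)
  have e2 : b - N + 2 * i + 1 + l = 1 + ((l + i : ℕ) : ℝ) + i - N + b := by push_cast; ring
  have e3 : Real.Gamma (1 + ((l + i : ℕ) : ℝ) + i - N + b) ≠ 0 :=
    Gamma_ne_zero_of_eq hb (1 + l + i + i - N) (by push_cast; ring)
  have e4 : ((l + i).factorial : ℝ) = l.factorial * (l + i).descFactorial i := by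
    have := Nat.factorial_mul_descFactorial (show i ≤ l + i by omega)
    rw [Nat.add_sub_cancel] at this
    exact_mod_cast this.symm
  have e5 : ((l + i).descFactorial i : ℝ) ≠ 0 := by
    exact_mod_cast (Nat.descFactorial_pos.2 (by omega)).ne'
  rw [e2, e4, pow_add]
  field_simp

/-- A nonzero real polynomial has a constant sign at large integers. All but finitely many terms of
the series then have that sign, and a single term of degree above `P` contradicts the growth bound.
-/
lemma eq_zero_of_besTerm_le {b : ℝ} (hb : ∀ n : ℕ, 0 < Real.Gamma (1 + n + b)) (p : Polynomial ℝ)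
    (hs : ∀ z, Summable (besTerm b p z)) {P : ℕ} {ζ : ℕ → ℝ} (hζ : Tendsto ζ atTop atTop)
    (h : (fun m => ∑' n, besTerm b p (ζ m) n) =O[atTop] fun m => ζ m ^ P) : p = 0 := by
  wlog hp : 0 < p.leadingCoeff generalizing p
  · by_contra h0
    have hneg : ∀ z, besTerm b (-p) z = fun n => -besTerm b p z n := fun z => by
      funext n; simp [besTerm]
    refine h0 (neg_eq_zero.1 (this (-p) (fun z => by rw [hneg]; exact (hs z).neg) ?_ ?_))
    · simpa only [hneg, tsum_neg] using h.neg_left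
    · rw [Polynomial.leadingCoeff_neg]
      have := Polynomial.leadingCoeff_ne_zero.2 h0
      rcases lt_or_gt_of_ne this with h1 | h1
      · linarith
      · exact absurd h1 hp
  exfalso
  obtain ⟨C, h⟩ := h.bound
  have hpos : ∀ᶠ n : ℕ in atTop, 0 < p.eval (n : ℝ) := by
    have h1 : ∀ᶠ x : ℝ in atTop, 0 < p.eval x := by
      rcases Nat.eq_zero_or_pos p.natDegree with h0 | h0
      · rw [Polynomial.eq_C_of_natDegree_eq_zero h0] at hp ⊢
        simp only [Polynomial.leadingCoeff_C] at hp
        exact Eventually.of_forall fun x => by simpa using hp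
      · exact (p.tendsto_atTop_of_leadingCoeff_nonneg (Polynomial.natDegree_pos_iff_degree_pos.1 h0)
          hp.le).eventually_gt_atTop 0
    exact tendsto_natCast_atTop_atTop.eventually h1
  obtain ⟨n0, hn0⟩ := eventually_atTop.1 hpos
  -- Terms from index `q` on are positive, and the `q`-th outgrows both `z^P` and the finitely many
  -- terms before it.
  set q := max n0 (P + 1) with hq
  set w : ℕ → ℝ := fun n => p.eval (n : ℝ) / (n.factorial * Real.Gamma (1 + n + b)) with hw
  have hterm : ∀ z n, besTerm b p z n = w n * z ^ n := fun z n => by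
    rw [besTerm, hw]; ring
  have hwq : 0 < w q := div_pos (hn0 q (le_max_left _ _))
    (mul_pos (by positivity) (hb q))
  have key : ∀ m, 1 ≤ ζ m → ‖∑' n, besTerm b p (ζ m) n‖ ≤ C * ‖ζ m ^ P‖ → w q * ζ m ≤ |C| + ∑ n ∈ Finset.range q, |w n| := by
    intro m hm h1
    rw [Real.norm_eq_abs, Real.norm_of_nonneg (by positivity)] at h1
    obtain ⟨r, hr⟩ : ∃ r, q = r + 1 := ⟨q - 1, by omega⟩
    have h2 : ∑ n ∈ Finset.range q, besTerm b p (ζ m) n + besTerm b p (ζ m) q ≤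
        ∑' n, besTerm b p (ζ m) n := by
      rw [← Finset.sum_range_succ]
      refine (hs (ζ m)).sum_le_tsum _ fun n hn => ?_
      have hn : n0 ≤ n := by
        have := Finset.mem_range.not.1 hn
        omega
      have := (hn0 n hn).le
      have := hb n
      unfold besTerm
      positivity
    have h3 : -(∑ n ∈ Finset.range q, |w n|) * ζ m ^ r ≤ ∑ n ∈ Finset.range q, besTerm b p (ζ m) n := by
      rw [neg_mul, Finset.sum_mul, ← Finset.sum_neg_distrib]
      refine Finset.sum_le_sum fun n hn => ?_
      have hn := Finset.mem_range.1 hn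
      rw [hterm]
      have h4 : ζ m ^ n ≤ ζ m ^ r := pow_le_pow_right₀ hm (by omega)
      have h5 : 0 ≤ ζ m ^ n := by positivity
      nlinarith [neg_abs_le (w n), abs_nonneg (w n)]
    have h6 : C * ζ m ^ P ≤ |C| * ζ m ^ r := by
      have h4 : ζ m ^ P ≤ ζ m ^ r := pow_le_pow_right₀ hm (by omega)
      have h5 : 0 ≤ ζ m ^ P := by positivity
      nlinarith [le_abs_self C, abs_nonneg C]
    rw [hterm, hr, pow_succ, ← hr] at h2
    have h7 : 0 < ζ m ^ r := by positivity
    refine le_of_mul_le_mul_right ?_ h7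
    nlinarith [le_abs_self (∑' n, besTerm b p (ζ m) n)]
  obtain ⟨m, ⟨hm1, hm2⟩, hm3⟩ := (((hζ.eventually_ge_atTop 1).and (hζ.eventually_gt_atTop
    ((|C| + ∑ n ∈ Finset.range q, |w n|) / w q))).and h).exists
  have := key m hm1 hm3
  rw [div_lt_iff₀ hwq] at hm2
  linarith

/-! ### The scalar problem at a fixed frequency -/

/-- At a fixed frequency the shift in `l` is multiplication by `R²`, so the Pascal rule becomes the
binomial expansion of `((T - R²) + R²)^n`. -/
lemma pascal_geom (R : ℝ) (hR : R ≠ 0) (t : ℕ → ℂ) (n i l : ℕ) :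
    pascal (fun i l => (R : ℂ) ^ (2 * l) * t i) n i l =
      (R : ℂ) ^ (2 * (n + i + l)) *
        ∑ s ∈ Finset.range (n + 1), (n.choose s : ℂ) * (t (i + s) / (R : ℂ) ^ (2 * (i + s))) := by
  have hR' : (R : ℂ) ≠ 0 := by exact_mod_cast hR
  induction n generalizing i l with
  | zero => simp [pascal, pow_add, mul_add]; field_simp
  | succ n ih =>
    rw [pascal, ih, ih, show n + (i + 1) + l = n + 1 + i + l by ring,
      show n + i + (l + 1) = n + 1 + i + l by ring, ← mul_add]
    congr 1
    rw [Finset.sum_range_succ' _ (n + 1)]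
    simp only [Nat.choose_succ_succ]
    push_cast
    simp only [add_mul, Finset.sum_add_distrib]
    rw [add_assoc]
    congr 1
    · exact Finset.sum_congr rfl fun s _ => by rw [show i + 1 + s = i + (s + 1) by ring]
    · rw [Finset.sum_range_succ' _ n, Finset.sum_range_succ]
      simp

lemma sum_choose_range_eq {N : ℕ} {t : ℕ → ℂ} (ht : ∀ i, N < i → t i = 0) (n : ℕ) :
    ∑ s ∈ Finset.range (n + 1), (n.choose s : ℂ) * t s =
      ∑ s ∈ Finset.range (N + 1), (n.choose s : ℂ) * t s := by
  have h1 : ∑ s ∈ Finset.range (n + 1), (n.choose s : ℂ) * t s =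
      ∑ s ∈ Finset.range (max n N + 1), (n.choose s : ℂ) * t s := by
    refine Finset.sum_subset (Finset.range_mono (by omega)) fun s _ hs => ?_
    rw [Nat.choose_eq_zero_of_lt (by simpa using hs)]; simp
  have h2 : ∑ s ∈ Finset.range (N + 1), (n.choose s : ℂ) * t s =
      ∑ s ∈ Finset.range (max n N + 1), (n.choose s : ℂ) * t s := by
    refine Finset.sum_subset (Finset.range_mono (by omega)) fun s _ hs => ?_
    rw [ht s (by simpa using hs)]; simp
  rw [h1, h2]

lemma hasSum_interpVal {b : ℝ} (hb : ∀ p : ℤ, b ≠ p) (N : ℕ) (α : ℕ → ℂ) (z : ℝ) :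
    HasSum (fun n : ℕ => (∑ i ∈ Finset.range (N + 1), α i * (interpVal b N i n : ℂ)) *
        ((z ^ n / (n.factorial * Real.Gamma (1 + n + b)) : ℝ) : ℂ))
      (∑ i ∈ Finset.range (N + 1), α i * ((z ^ i * besI (b - N + 2 * i) z : ℝ) : ℂ)) := by
  simp only [Finset.sum_mul]
  refine hasSum_sum fun i hi => ?_
  have h := (Complex.hasSum_ofReal.2 (hasSum_besTerm_interpPoly hb
    (show i ≤ N by have := Finset.mem_range.1 hi; omega) z)).mul_left (α i)
  suffices e : ∀ n : ℕ, α i * (interpVal b N i n : ℂ) *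
      ((z ^ n / (n.factorial * Real.Gamma (1 + n + b)) : ℝ) : ℂ) =
      α i * (besTerm b (interpPoly b N i) z n : ℂ) by
    rw [funext e]
    exact h
  intro n
  rw [besTerm, interpVal]
  push_cast
  ring

/-- The combination is the series of one polynomial, a combination of the `interpPoly`, which must
vanish by its growth; triangularity then kills the coefficients one after another. Real and
imaginary parts are treated separately because the argument rests on signs. -/
lemma eq_zero_of_isBigO {b : ℝ} (hb : ∀ p : ℤ, b ≠ p) (hb1 : -1 < b) (N : ℕ) (w : ℕ → ℂ) {P : ℕ}
    {ζ : ℕ → ℝ} (hζ : Tendsto ζ atTop atTop)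
    (h : (fun m => ∑ i ∈ Finset.range (N + 1),
      w i * ((ζ m ^ i * besI (b - N + 2 * i) (ζ m) : ℝ) : ℂ)) =O[atTop] fun m => ζ m ^ P) :
    ∀ i ≤ N, w i = 0 := by
  have hG : ∀ n : ℕ, 0 < Real.Gamma (1 + n + b) := fun n => Real.Gamma_pos_of_pos (by
    have : (0 : ℝ) ≤ n := Nat.cast_nonneg n
    linarith)
  have real : ∀ r : ℕ → ℝ, (fun m => ∑ i ∈ Finset.range (N + 1),
      r i * (ζ m ^ i * besI (b - N + 2 * i) (ζ m))) =O[atTop] (fun m => ζ m ^ P) →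
      ∀ i ≤ N, r i = 0 := by
    intro r hr
    set p : Polynomial ℝ := ∑ i ∈ Finset.range (N + 1), Polynomial.C (r i) * interpPoly b N i with hp
    have hsum : ∀ z, HasSum (besTerm b p z) (∑ i ∈ Finset.range (N + 1),
        r i * (z ^ i * besI (b - N + 2 * i) z)) := by
      intro z
      have h1 := hasSum_sum (s := Finset.range (N + 1)) fun i hi =>
        (hasSum_besTerm_interpPoly hb (show i ≤ N by have := Finset.mem_range.1 hi; omega) z).mul_left
          (r i)
      have e : besTerm b p z = fun n => ∑ i ∈ Finset.range (N + 1),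
          r i * besTerm b (interpPoly b N i) z n := by
        funext n
        simp only [besTerm, hp, Polynomial.eval_finsetSum, Polynomial.eval_mul, Polynomial.eval_C,
          Finset.sum_mul, mul_assoc]
      rw [e]
      exact h1
    have hp0 : p = 0 := eq_zero_of_besTerm_le hG p (fun z => (hsum z).summable) (P := P) hζ (by
      simpa only [(hsum _).tsum_eq] using hr)
    have hval : ∀ n : ℕ, ∑ i ∈ Finset.range (N + 1), r i * interpVal b N i n = 0 := by
      intro n
      have := congrArg (Polynomial.eval (n : ℝ)) hp0
      simpa [hp, Polynomial.eval_finsetSum, interpVal] using this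
    intro i
    induction i using Nat.strong_induction_on with
    | _ i ih =>
      intro hi
      have h1 := hval i
      rw [Finset.sum_eq_single i] at h1
      · exact (mul_eq_zero.1 h1).resolve_right (eval_interpPoly_self_ne_zero hb hi)
      · intro j hj hji
        have hj := Finset.mem_range.1 hj
        rcases lt_or_gt_of_ne hji with h2 | h2
        · rw [ih j h2 (by omega), zero_mul]
        · rw [eval_interpPoly_eq_zero hb (by omega) h2, mul_zero]
      · intro h2
        exact absurd (Finset.mem_range.2 (by omega)) h2
  intro i hi
  refine Complex.ext ?_ ?_
  · refine real (fun i => (w i).re) (Asymptotics.IsBigO.trans ?_ h) i hi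
    refine Asymptotics.IsBigO.of_bound 1 (Eventually.of_forall fun m => ?_)
    rw [one_mul]
    refine le_trans (le_of_eq ?_) (Complex.abs_re_le_norm _)
    simp only [Complex.re_sum, Complex.re_mul_ofReal, Real.norm_eq_abs]
  · refine real (fun i => (w i).im) (Asymptotics.IsBigO.trans ?_ h) i hi
    refine Asymptotics.IsBigO.of_bound 1 (Eventually.of_forall fun m => ?_)
    rw [one_mul]
    refine le_trans (le_of_eq ?_) (Complex.abs_im_le_norm _)
    simp only [Complex.im_sum, Complex.im_mul_ofReal, Real.norm_eq_abs]

/-- Division by `c (-R²)^j` removes all powers of the frequency from the recursion and reduces it to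
the interpolation identity. The constant is `c = 1` for the even operators and `c = -2a` for the
conormal ones. -/
lemma pascal_eq_sum_interpVal {b : ℝ} (hb : ∀ p : ℤ, b ≠ p) (N : ℕ) {R : ℝ} (hR : R ≠ 0)
    {t : ℕ → ℂ} (ht : ∀ i, N < i → t i = 0) {c : ℂ} (hc : c ≠ 0) {B : ℕ → ℂ}
    (hB : ∀ j ≤ N, B j = c * ((-1) ^ j * pascal (fun i l => (R : ℂ) ^ (2 * l) * t i) j 0 0) -
      ∑ i : Fin j, (gammaCoeff b N j i : ℂ) * ((-(R : ℂ) ^ 2) ^ (j - (i : ℕ)) * B i)) (n : ℕ) :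
    pascal (fun i l => (R : ℂ) ^ (2 * l) * t i) n 0 0 = (R : ℂ) ^ (2 * n) *
      ∑ i ∈ Finset.range (N + 1), B i / (c * (-(R : ℂ) ^ 2) ^ i) / (interpVal b N i i : ℂ) *
        (interpVal b N i n : ℂ) := by
  have hR' : (R : ℂ) ≠ 0 := by exact_mod_cast hR
  have hR2 : -(R : ℂ) ^ 2 ≠ 0 := neg_ne_zero.2 (pow_ne_zero 2 hR')
  have hpas : ∀ n, pascal (fun i l => (R : ℂ) ^ (2 * l) * t i) n 0 0 = (R : ℂ) ^ (2 * n) *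
      ∑ s ∈ Finset.range (N + 1), (n.choose s : ℂ) * (t s / (R : ℂ) ^ (2 * s)) := by
    intro n
    rw [pascal_geom R hR, ← sum_choose_range_eq (N := N)
      (t := fun s => t s / (R : ℂ) ^ (2 * s)) (fun i hi => by simp [ht i hi])]
    simp
  rw [hpas, sum_choose_eq_sum_interpPoly hb N _ (fun i => B i / (c * (-(R : ℂ) ^ 2) ^ i))]
  intro j hj
  have h1 := hB j hj
  rw [hpas] at h1
  rw [h1, sub_div, Finset.sum_div]
  congr 1
  · rw [neg_pow ((R : ℂ) ^ 2), ← pow_mul]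
    field_simp
  · refine Finset.sum_congr rfl fun i _ => ?_
    have e : (-(R : ℂ) ^ 2) ^ j = (-(R : ℂ) ^ 2) ^ (j - (i : ℕ)) * (-(R : ℂ) ^ 2) ^ (i : ℕ) := by
      rw [← pow_add]; congr 1; omega
    rw [e]
    have := pow_ne_zero (j - (i : ℕ)) hR2
    field_simp

lemma ne_intCast_of_mem_Ioo {a : ℝ} (ha : 0 < a) (ha1 : a < 1) (p : ℤ) : a ≠ p := by
  intro hp
  have h1 : (p : ℝ) < 1 := by linarith
  have h2 : (0 : ℝ) < p := by linarith
  have h3 : p < 1 := by exact_mod_cast h1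
  have h4 : 0 < p := by exact_mod_cast h2
  omega

lemma neg_ne_intCast_of_mem_Ioo {a : ℝ} (ha : 0 < a) (ha1 : a < 1) (p : ℤ) : -a ≠ p := fun h =>
  ne_intCast_of_mem_Ioo ha ha1 (-p) (by push_cast; linarith)

lemma tsum_powFun_zero {a : ℝ} (ha : 0 < a) (ha1 : a < 1) (N : ℕ) (R : ℝ) (α : ℕ → ℂ) {y : ℝ}
    (hy : 0 < y) :
    ∑' n : ℕ, ((R : ℂ) ^ (2 * n) *
        ∑ i ∈ Finset.range (N + 1), α i * (interpVal (-a) N i n : ℂ)) * (powFun a 0 n y : ℂ) =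
      (Real.Gamma (1 - a) : ℂ) * ∑ i ∈ Finset.range (N + 1), α i *
        (((R ^ 2 * y ^ 2 / 4) ^ i * besI (-a - N + 2 * i) (R ^ 2 * y ^ 2 / 4) : ℝ) : ℂ) := by
  have hb := neg_ne_intCast_of_mem_Ioo ha ha1
  rw [← (hasSum_interpVal hb N α _).tsum_eq, ← tsum_mul_left]
  refine tsum_congr fun n => ?_
  rw [powFun, powConst_zero_eq ha1, zero_add, Real.rpow_mul hy.le, Real.rpow_two, Real.rpow_natCast,
    show (n : ℝ) + 1 - a = 1 + n + -a by ring, div_pow, mul_pow]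
  have h1 : (Real.Gamma (1 - a) : ℂ) ≠ 0 := by
    exact_mod_cast (Real.Gamma_pos_of_pos (by linarith)).ne'
  push_cast
  rw [← pow_mul, pow_mul (R : ℂ)]
  field_simp

/-- The prefactor rewrites `y^(2a)` as `4^a R^(-2a) z^a` with `z = R²y²/4`; it is the source of the
fractional part of the power of the frequency. -/
lemma tsum_powFun_two_mul {a : ℝ} (ha : 0 < a) (ha1 : a < 1) (N : ℕ) {R : ℝ} (hR : 0 < R)
    (α : ℕ → ℂ) {y : ℝ} (hy : 0 < y) :
    ∑' n : ℕ, ((R : ℂ) ^ (2 * n) *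
        ∑ i ∈ Finset.range (N + 1), α i * (interpVal a N i n : ℂ)) * (powFun a (2 * a) n y : ℂ) =
      ((4 ^ a * R ^ (-(2 * a)) * Real.Gamma (1 + a) * (R ^ 2 * y ^ 2 / 4) ^ a : ℝ) : ℂ) *
        ∑ i ∈ Finset.range (N + 1), α i *
        (((R ^ 2 * y ^ 2 / 4) ^ i * besI (a - N + 2 * i) (R ^ 2 * y ^ 2 / 4) : ℝ) : ℂ) := by
  have hb := ne_intCast_of_mem_Ioo ha ha1
  rw [← (hasSum_interpVal hb N α _).tsum_eq, ← tsum_mul_left]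
  refine tsum_congr fun n => ?_
  have e1 : (4 : ℝ) ^ a * R ^ (-(2 * a)) * Real.Gamma (1 + a) * (R ^ 2 * y ^ 2 / 4) ^ a =
      Real.Gamma (1 + a) * y ^ (2 * a) := by
    rw [Real.div_rpow (by positivity) (by norm_num), Real.mul_rpow (by positivity) (by positivity),
      ← Real.rpow_two, ← Real.rpow_two, ← Real.rpow_mul hR.le, ← Real.rpow_mul hy.le,
      Real.rpow_neg hR.le]
    have : (4 : ℝ) ^ a ≠ 0 := by positivity
    have : R ^ (2 * a) ≠ 0 := by positivity
    field_simp
  rw [e1, powFun, powConst_two_mul_eq ha, Real.rpow_add hy, Real.rpow_mul hy.le 2 n, Real.rpow_two,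
    Real.rpow_natCast, show (n : ℝ) + 1 + a = 1 + n + a by ring, div_pow, mul_pow]
  have h1 : (Real.Gamma (1 + a) : ℂ) ≠ 0 := by
    exact_mod_cast (Real.Gamma_pos_of_pos (by linarith)).ne'
  push_cast
  rw [← pow_mul, pow_mul (R : ℂ)]
  field_simp

/-- The constant of the Dirichlet-to-Neumann map, in terms of the interpolation polynomials. -/
def dnConst (a : ℝ) (N j : ℕ) : ℝ :=
  (-1) ^ N * (2 * a * Real.Gamma (1 - a) / (4 ^ a * Real.Gamma (1 + a))) *
    (interpVal a N (N - j) (N - j) / interpVal (-a) N j j)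

/-- Pure field algebra: the vanishing of a growing coefficient is solved for the odd symbol `O`,
with signs, frequency powers and Gamma factors abstracted to letters. -/
lemma solve_odd_symbol {g E s₁ r₁ v₁ F Q γ O a s₂ r₂ v₂ X : ℂ} (h2 : s₂ * s₂ = 1)
    (h1 : s₁ * s₁ = 1) (ha : a ≠ 0) (hv1 : v₁ ≠ 0) (hv2 : v₂ ≠ 0) (hγ : γ ≠ 0) (hF : F ≠ 0)
    (hQ : Q ≠ 0) (hr1 : r₁ ≠ 0) (hr2 : r₂ ≠ 0) (hX : X * r₁ = Q * r₂)
    (h : g * (E / (1 * (s₁ * r₁)) / v₁) + F * Q⁻¹ * γ * (O / (-(2 * a) * (s₂ * r₂)) / v₂) = 0) :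
    O = s₁ * s₂ * (2 * a * g / (F * γ)) * (v₂ / v₁) * X * E := by
  rw [eq_div_of_mul_eq hr1 hX]
  have hs1 : s₁ ≠ 0 := fun h0 => by simp [h0] at h1
  have hs2 : s₂ ≠ 0 := fun h0 => by simp [h0] at h2
  field_simp at h ⊢
  linear_combination -s₁ * h - (r₁ * v₁ * F * γ * O) * h1

/-- The scalar Dirichlet-to-Neumann map. Expressed through `I` functions, the solution can grow
polynomially only if the even and odd data combine to `K` functions, and this is one linear relation
for each order. -/
theorem odd_symbol_eq {a : ℝ} (ha : 0 < a) (ha1 : a < 1) (N : ℕ) {R : ℝ} (hR : 0 < R)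
    {t s : ℕ → ℂ} (ht : ∀ i, N < i → t i = 0) (hs : ∀ i, N < i → s i = 0) {bE bO : ℕ → ℂ}
    (hE : ∀ j ≤ N, bE j = (-1) ^ j * pascal (fun i l => (R : ℂ) ^ (2 * l) * t i) j 0 0 -
      ∑ i : Fin j, (gammaCoeff (-a) N j i : ℂ) * ((-(R : ℂ) ^ 2) ^ (j - (i : ℕ)) * bE i))
    (hO : ∀ j ≤ N, bO j =
      (-1) ^ (j + 1) * (2 * a * pascal (fun i l => (R : ℂ) ^ (2 * l) * s i) j 0 0) -
      ∑ i : Fin j, (gammaCoeff a N j i : ℂ) * ((-(R : ℂ) ^ 2) ^ (j - (i : ℕ)) * bO i))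
    {P : ℕ} (hgrow : (fun m : ℕ =>
      ∑' n, pascal (fun i l => (R : ℂ) ^ (2 * l) * t i) n 0 0 * (powFun a 0 n m : ℂ) +
      ∑' n, pascal (fun i l => (R : ℂ) ^ (2 * l) * s i) n 0 0 * (powFun a (2 * a) n m : ℂ))
        =O[atTop] fun m : ℕ => (m : ℝ) ^ P) {j : ℕ} (hj : j ≤ N) :
    bO (N - j) = ((dnConst a N j * R ^ (2 * (N + a - 2 * j)) : ℝ) : ℂ) * bE j := by
  have hb := ne_intCast_of_mem_Ioo ha ha1
  have hb' := neg_ne_intCast_of_mem_Ioo ha ha1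
  have hRc : (R : ℂ) ≠ 0 := by exact_mod_cast hR.ne'
  have hac : (a : ℂ) ≠ 0 := by exact_mod_cast ha.ne'
  set αE : ℕ → ℂ := fun i => bE i / (1 * (-(R : ℂ) ^ 2) ^ i) / (interpVal (-a) N i i : ℂ) with hαE
  set αO : ℕ → ℂ := fun i => bO i / (-(2 * a) * (-(R : ℂ) ^ 2) ^ i) / (interpVal a N i i : ℂ) with hαO
  have pE := pascal_eq_sum_interpVal hb' N hR.ne' ht (one_ne_zero) (B := bE) (fun j hj => by
    rw [one_mul]; exact hE j hj)
  have pO := pascal_eq_sum_interpVal hb N hR.ne' hs (c := -(2 * a))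
    (neg_ne_zero.2 (mul_ne_zero two_ne_zero hac)) (B := bO) (fun j hj => by
      rw [hO j hj, pow_succ]; ring)
  set ζ : ℕ → ℝ := fun m => R ^ 2 * (m : ℝ) ^ 2 / 4 with hζ
  have hζt : Tendsto ζ atTop atTop := by
    have h1 : Tendsto (fun m : ℕ => (m : ℝ) ^ 2) atTop atTop :=
      (tendsto_pow_atTop two_ne_zero).comp tendsto_natCast_atTop_atTop
    exact (h1.const_mul_atTop (pow_pos hR 2)).atTop_div_const (by norm_num)
  set K : ℝ := 4 ^ a * R ^ (-(2 * a)) * Real.Gamma (1 + a) with hK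
  set u : ℝ → ℂ := fun z => (Real.Gamma (1 - a) : ℂ) * ∑ i ∈ Finset.range (N + 1), αE i *
        ((z ^ i * besI (-a - N + 2 * i) z : ℝ) : ℂ) +
      ((K * z ^ a : ℝ) : ℂ) * ∑ i ∈ Finset.range (N + 1), αO i *
        ((z ^ i * besI (a - N + 2 * i) z : ℝ) : ℂ) with hu
  have hgrow1 : (fun m => u (ζ m)) =O[atTop] fun m => ζ m ^ P := by
    refine Asymptotics.IsBigO.trans (g := fun m : ℕ => (m : ℝ) ^ P) ?_ ?_
    · refine hgrow.congr' ?_ EventuallyEq.rfl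
      filter_upwards [eventually_ge_atTop 1] with m hm
      have hm : (0 : ℝ) < m := by exact_mod_cast hm
      simp only [pE, pO]
      rw [tsum_powFun_zero ha ha1 N R αE hm, tsum_powFun_two_mul ha ha1 N hR αO hm]
    · refine Asymptotics.IsBigO.pow (Asymptotics.IsBigO.of_bound (4 / R ^ 2) ?_) P
      filter_upwards [eventually_ge_atTop 1] with m hm
      have hm : (1 : ℝ) ≤ m := by exact_mod_cast hm
      rw [Real.norm_of_nonneg (by positivity), Real.norm_of_nonneg (by positivity)]
      simp only [hζ]
      field_simp
      exact hm
  -- The even datum `i` has order `-ν i`, the odd datum `N - i` has order `ν i`; this reversal pairs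
  -- `bE j` with `bO (N - j)`.
  set ν : ℕ → ℝ := fun i => N + a - 2 * i with hν
  have hνint : ∀ (i : ℕ) (p : ℤ), ν i ≠ p := fun i p h =>
    hb (p - N + 2 * i) (by simp only [hν] at h; push_cast; linarith)
  set G : ℕ → ℝ := fun i => Real.Gamma (ν i) * Real.Gamma (1 - ν i) with hG
  have hG0 : ∀ i, G i ≠ 0 := fun i => mul_ne_zero
    (Gamma_ne_zero_of_eq hb (N - 2 * i) (by simp only [hν]; push_cast; ring))
    (Gamma_ne_zero_of_eq hb' (1 - N + 2 * i) (by simp only [hν]; push_cast; ring))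
  -- The coefficient of the growing functions left over once each `I_{-ν}` has been replaced by `K_ν
  -- / G` plus `z^ν I_ν`.
  set w : ℕ → ℂ := fun i => (Real.Gamma (1 - a) : ℂ) * αE (N - i) + (K : ℂ) * αO i with hw
  have hident : ∀ z : ℝ, 0 < z → ∑ i ∈ Finset.range (N + 1),
      w i * ((z ^ i * besI (a - N + 2 * i) z : ℝ) : ℂ) = ((z ^ (-a) : ℝ) : ℂ) *
        (u z - ∑ i ∈ Finset.range (N + 1), (Real.Gamma (1 - a) : ℂ) * αE i / (G i : ℂ) *
          ((z ^ i * besK (ν i) z : ℝ) : ℂ)) := by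
    intro z hz
    have e1 : ∑ i ∈ Finset.range (N + 1), αE (N - i) * ((z ^ i * besI (a - N + 2 * i) z : ℝ) : ℂ) =
        ∑ i ∈ Finset.range (N + 1), αE i *
          ((z ^ (N - i) * besI (a - N + 2 * (N - i : ℕ)) z : ℝ) : ℂ) := by
      rw [← Finset.sum_flip]
      refine Finset.sum_congr rfl fun i hi => ?_
      have : i ≤ N := by have := Finset.mem_range.1 hi; omega
      rw [Nat.sub_sub_self this]
    have e2 : ∀ i ∈ Finset.range (N + 1), αE i * ((z ^ i * besI (-a - N + 2 * i) z : ℝ) : ℂ) =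
        αE i / (G i : ℂ) * ((z ^ i * besK (ν i) z : ℝ) : ℂ) + ((z ^ a : ℝ) : ℂ) *
          (αE i * ((z ^ (N - i) * besI (a - N + 2 * (N - i : ℕ)) z : ℝ) : ℂ)) := by
      intro i hi
      have hi : i ≤ N := by have := Finset.mem_range.1 hi; omega
      have h1 : besK (ν i) z = G i * (besI (-ν i) z - z ^ ν i * besI (ν i) z) :=
        besKExpansion (hνint i) hz
      have h2 : z ^ i * z ^ ν i = z ^ a * z ^ (N - i) := by
        rw [← Real.rpow_natCast, ← Real.rpow_natCast, ← Real.rpow_add hz, ← Real.rpow_add hz,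
          Nat.cast_sub hi]
        congr 1
        simp only [hν]; ring
      have h3 : a - N + 2 * ((N - i : ℕ) : ℝ) = ν i := by
        rw [Nat.cast_sub hi]; simp only [hν]; ring
      have h4 : -a - N + 2 * (i : ℝ) = -ν i := by simp only [hν]; ring
      have h5 : z ^ i * besI (-ν i) z = z ^ i * besK (ν i) z / G i +
          z ^ a * (z ^ (N - i) * besI (ν i) z) := by
        rw [← mul_assoc, ← h2, h1]
        have := hG0 i
        field_simp
        ring
      rw [h3, h4, h5]
      push_cast
      ring
    have e3 : ((z ^ (-a) : ℝ) : ℂ) * ((z ^ a : ℝ) : ℂ) = 1 := by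
      rw [← Complex.ofReal_mul, ← Real.rpow_add hz, neg_add_cancel, Real.rpow_zero,
        Complex.ofReal_one]
    simp only [hw, hu, add_mul, Finset.sum_add_distrib, mul_assoc]
    rw [← Finset.mul_sum, e1, Finset.sum_congr rfl e2, Finset.sum_add_distrib, ← Finset.mul_sum,
      ← Finset.mul_sum]
    have e4 : ∑ i ∈ Finset.range (N + 1), (Real.Gamma (1 - a) : ℂ) * αE i / (G i : ℂ) *
        ((z ^ i * besK (ν i) z : ℝ) : ℂ) = (Real.Gamma (1 - a) : ℂ) *
        ∑ i ∈ Finset.range (N + 1), αE i / (G i : ℂ) * ((z ^ i * besK (ν i) z : ℝ) : ℂ) := by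
      rw [Finset.mul_sum]
      exact Finset.sum_congr rfl fun i _ => by ring
    rw [e4, Complex.ofReal_mul K]
    linear_combination -(Real.Gamma (1 - a) * ∑ i ∈ Finset.range (N + 1), αE i *
          ((z ^ (N - i) * besI (a - N + 2 * (N - i : ℕ)) z : ℝ) : ℂ) +
          K * ∑ i ∈ Finset.range (N + 1), αO i *
        ((z ^ i * besI (a - N + 2 * i) z : ℝ) : ℂ)) * e3
  have hge1 : ∀ᶠ m in atTop, 1 ≤ ζ m := hζt.eventually_ge_atTop 1
  have hpow : ∀ {p q : ℕ}, p ≤ q → (fun m => ζ m ^ p) =O[atTop] fun m => ζ m ^ q := by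
    intro p q hpq
    refine Asymptotics.IsBigO.of_bound 1 ?_
    filter_upwards [hge1] with m hm
    rw [Real.norm_of_nonneg (by positivity), Real.norm_of_nonneg (by positivity), one_mul]
    exact pow_le_pow_right₀ hm hpq
  -- The solution is `O(z^P)`, the `K` terms are `O(z^N)` because `K` is bounded on `[1, ∞)`, and
  -- the factor `z^(-a)` is at most `1` there.
  have hw0 := eq_zero_of_isBigO hb (by linarith) N w (P := N + P) hζt (by
    have h1 : (fun m => u (ζ m) - ∑ i ∈ Finset.range (N + 1),
        (Real.Gamma (1 - a) : ℂ) * αE i / (G i : ℂ) * ((ζ m ^ i * besK (ν i) (ζ m) : ℝ) : ℂ))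
        =O[atTop] fun m => ζ m ^ (N + P) := by
      refine (hgrow1.trans (hpow (by omega))).sub (Asymptotics.IsBigO.fun_sum fun i hi => ?_)
      refine Asymptotics.IsBigO.const_mul_left ?_ _
      refine Asymptotics.IsBigO.trans ?_ (hpow (show i ≤ N + P by
        have := Finset.mem_range.1 hi; omega))
      obtain ⟨C, hC⟩ := exists_besK_le (ν i) (by simpa using hνint i 0)
      refine Asymptotics.IsBigO.of_bound C ?_
      filter_upwards [hge1] with m hm
      rw [Complex.norm_real, norm_mul, mul_comm]
      exact mul_le_mul_of_nonneg_right (hC _ hm) (norm_nonneg _)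
    refine Asymptotics.IsBigO.trans (Asymptotics.IsBigO.of_bound 1 ?_) h1
    filter_upwards [hge1] with m hm
    rw [hident _ (by linarith), norm_mul]
    refine mul_le_mul_of_nonneg_right ?_ (norm_nonneg _)
    rw [Complex.norm_real, Real.norm_of_nonneg (by positivity)]
    exact Real.rpow_le_one_of_one_le_of_nonpos hm (by linarith)) (N - j) (by omega)
  simp only [hw, Nat.sub_sub_self hj, hαE, hαO, hK] at hw0
  have n1 : (interpVal (-a) N j j : ℂ) ≠ 0 := by
    exact_mod_cast eval_interpPoly_self_ne_zero hb' hj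
  have n2 : (interpVal a N (N - j) (N - j) : ℂ) ≠ 0 := by
    exact_mod_cast eval_interpPoly_self_ne_zero hb (show N - j ≤ N by omega)
  have hR2 : (-(R : ℂ) ^ 2) ≠ 0 := neg_ne_zero.2 (pow_ne_zero 2 hRc)
  have n3 : (Real.Gamma (1 + a) : ℂ) ≠ 0 := by
    exact_mod_cast (Real.Gamma_pos_of_pos (by linarith)).ne'
  have n4 : (((4 : ℝ) ^ a : ℝ) : ℂ) ≠ 0 := by
    exact_mod_cast (Real.rpow_pos_of_pos (by norm_num : (0 : ℝ) < 4) a).ne'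
  have n5 : ((R ^ (2 * a) : ℝ) : ℂ) ≠ 0 := by
    exact_mod_cast (Real.rpow_pos_of_pos hR _).ne'
  have e5 : R ^ (2 * (N + a - 2 * j)) * R ^ (2 * j) = R ^ (2 * a) * R ^ (2 * (N - j)) := by
    rw [← Real.rpow_natCast, ← Real.rpow_natCast, ← Real.rpow_add hR, ← Real.rpow_add hR]
    congr 1
    push_cast [Nat.cast_sub hj]
    ring
  have e6 : ((R ^ (2 * (N + a - 2 * j)) : ℝ) : ℂ) * (R : ℂ) ^ (2 * j) =
      ((R ^ (2 * a) : ℝ) : ℂ) * (R : ℂ) ^ (2 * (N - j)) := by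
    exact_mod_cast congrArg Complex.ofReal e5
  have e7 : ((-1 : ℂ)) ^ N = (-1) ^ j * (-1) ^ (N - j) := by
    rw [← pow_add]; congr 1; omega
  have e8 : ((-1 : ℂ)) ^ (N - j) * (-1) ^ (N - j) = 1 := by rw [← mul_pow]; simp
  have e9 : ((-1 : ℂ)) ^ j * (-1) ^ j = 1 := by rw [← mul_pow]; simp
  rw [Real.rpow_neg hR.le, neg_pow ((R : ℂ) ^ 2), neg_pow ((R : ℂ) ^ 2) (N - j), ← pow_mul,
    ← pow_mul] at hw0
  rw [dnConst]
  push_cast at hw0 ⊢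
  have e10 : ((4 : ℂ) ^ (a : ℂ)) = (((4 : ℝ) ^ a : ℝ) : ℂ) := by
    rw [Complex.ofReal_cpow (by norm_num)]; norm_num
  rw [e7]
  refine solve_odd_symbol (by exact_mod_cast e8) e9 hac n1 n2 n3 ?_ n5 (pow_ne_zero _ hRc)
    (pow_ne_zero _ hRc) e6 hw0
  exact_mod_cast n4

/-! ### Closed forms of the Dirichlet-to-Neumann constants -/

lemma Gamma_one_add_div {x : ℝ} (hx : x ≠ 0) :
    Real.Gamma (1 + -x) / Real.Gamma (1 + x) = -(Real.Gamma (-x) / Real.Gamma x) := by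
  rw [add_comm, Real.Gamma_add_one (neg_ne_zero.2 hx), add_comm, Real.Gamma_add_one hx,
    neg_mul, neg_div, mul_div_mul_left _ _ hx]

/-- After the interpolation values are written as Gamma quotients, the remaining identity is
`Γ(1-x)/Γ(1+x) = -Γ(-x)/Γ(x)` at `x = γ - 2j`; its sign turns `(-1)^N` into `(-1)^(1+N)`. -/
lemma dnConst_eq_cConst {γ : ℝ} (hγ : 0 < γ) (ha : 0 < Int.fract γ) {j : ℕ} (hj : j ≤ ⌊γ⌋₊) :
    dnConst (Int.fract γ) ⌊γ⌋₊ j = cConst γ j := by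
  have hb := ne_intCast_of_mem_Ioo ha (Int.fract_lt_one γ)
  have hb' := neg_ne_intCast_of_mem_Ioo ha (Int.fract_lt_one γ)
  have hfl : γ = ⌊γ⌋₊ + Int.fract γ := by
    rw [natCast_floor_eq_intCast_floor hγ.le, Int.floor_add_fract]
  rw [dnConst, cConst, eval_interpPoly hb (by omega), eval_interpPoly hb' hj]
  simp only [Nat.descFactorial_self]
  generalize ⌊γ⌋₊ = N at *
  generalize Int.fract γ = a at *
  subst hfl
  have e1 := Gamma_one_add_div (x := N + a - 2 * j) (fun h => hb (2 * j - N) (by push_cast; linarith))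
  have e2 : (4 : ℝ) ^ a = 2 ^ (2 * a) := by
    rw [Real.rpow_mul (by norm_num)]; norm_num
  rw [Nat.cast_sub hj, e2, Real.rpow_sub (by norm_num), Real.rpow_one, add_comm 1 a,
    Real.Gamma_add_one ha.ne', pow_add, pow_one,
    show (1 : ℝ) + (N - j) + (N - j) - N + a = 1 + (N + a - 2 * j) by ring,
    show (1 : ℝ) + j + j - N + -a = 1 + -(N + a - 2 * j) by ring,
    show (1 : ℝ) + (N - j) + a = 1 - j + (N + a) by ring, show (1 : ℝ) + j + -a = 1 + j - a by ring,
    show (2 : ℝ) * j - (N + a) = -(N + a - 2 * j) by ring,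
    show (-2 : ℝ) * j + (N + a) = N + a - 2 * j by ring]
  have g0 : Real.Gamma (1 + j - a) ≠ 0 := Gamma_ne_zero_of_eq hb' (1 + j) (by push_cast; ring)
  have g1 : Real.Gamma (N + a - 2 * j) ≠ 0 := Gamma_ne_zero_of_eq hb (N - 2 * j) (by push_cast; ring)
  have g2 : Real.Gamma (1 + (N + a - 2 * j)) ≠ 0 :=
    Gamma_ne_zero_of_eq hb (1 + N - 2 * j) (by push_cast; ring)
  have g3 : Real.Gamma (-(N + a - 2 * j)) ≠ 0 :=
    Gamma_ne_zero_of_eq hb' (-N + 2 * j) (by push_cast; ring)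
  have g4 : Real.Gamma (1 + -(N + a - 2 * j)) ≠ 0 :=
    Gamma_ne_zero_of_eq hb' (1 - N + 2 * j) (by push_cast; ring)
  have g5 : Real.Gamma a ≠ 0 := (Real.Gamma_pos_of_pos ha).ne'
  rw [div_eq_iff g2] at e1
  rw [e1]
  field_simp

/-- Replacing `j` by `N - j` turns the factorial and Gamma quotient of one constant into the
reciprocal of the other; the powers of `2` cancel too, and only the sign is left. Part (2) of the
theorem follows by inverting part (1). -/
lemma cConst_mul_dConst {γ : ℝ} (hγ : 0 < γ) (ha : 0 < Int.fract γ) {j : ℕ} (hj : j ≤ ⌊γ⌋₊) :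
    cConst γ (⌊γ⌋₊ - j) * -dConst γ j = 1 := by
  have hb := ne_intCast_of_mem_Ioo ha (Int.fract_lt_one γ)
  have hb' := neg_ne_intCast_of_mem_Ioo ha (Int.fract_lt_one γ)
  have hfl : γ = ⌊γ⌋₊ + Int.fract γ := by
    rw [natCast_floor_eq_intCast_floor hγ.le, Int.floor_add_fract]
  rw [cConst, dConst, Nat.sub_sub_self hj]
  have ha1 := Int.fract_lt_one γ
  generalize ⌊γ⌋₊ = N at *
  generalize Int.fract γ = a at *
  subst hfl
  rw [Nat.cast_sub hj, show (2 * a - 1) = -(1 - 2 * a) by ring, Real.rpow_neg (by norm_num),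
    show (1 : ℝ) - (N - j) + (N + a) = 1 + j + a by ring,
    show 2 * ((N : ℝ) - j) - (N + a) = -2 * j + N - a by ring,
    show -2 * ((N : ℝ) - j) + (N + a) = 2 * j - N + a by ring,
    show (1 : ℝ) + (N - j) - a = 1 + N - j - a by ring, pow_add, pow_one]
  have g0 : Real.Gamma (1 + N - j - a) ≠ 0 := Gamma_ne_zero_of_eq hb' (1 + N - j) (by push_cast; ring)
  have g1 : Real.Gamma (1 + j + a) ≠ 0 := Gamma_ne_zero_of_eq hb (1 + j) (by push_cast; ring)
  have g2 : Real.Gamma (-2 * j + N - a) ≠ 0 :=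
    Gamma_ne_zero_of_eq hb' (-2 * j + N) (by push_cast; ring)
  have g3 : Real.Gamma (2 * j - N + a) ≠ 0 :=
    Gamma_ne_zero_of_eq hb (2 * j - N) (by push_cast; ring)
  have g5 : Real.Gamma a ≠ 0 := (Real.Gamma_pos_of_pos ha).ne'
  have g6 : Real.Gamma (1 - a) ≠ 0 := (Real.Gamma_pos_of_pos (by linarith)).ne'
  have e8 : ((-1 : ℝ)) ^ N * (-1) ^ N = 1 := by rw [← mul_pow]; simp
  have g7 : (2 : ℝ) ^ (1 - 2 * a) ≠ 0 := by positivity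
  generalize Real.Gamma (-2 * j + N - a) = A at *
  field_simp
  linear_combination e8

/-! ### Normal derivatives on the closed half space -/

section NormalJet

variable {n : ℕ} {F G : Rn n → ℝ → ℂ}

lemma uniqueDiffOn_univ_prod_Ici : UniqueDiffOn ℝ (Set.univ ×ˢ Set.Ici (0 : ℝ) : Set (Rn n × ℝ)) :=
  uniqueDiffOn_univ.prod (uniqueDiffOn_Ici 0)

lemma hasDerivWithinAt_of_contDiffOn
    (hF : ContDiffOn ℝ ∞ (Function.uncurry F) (Set.univ ×ˢ Set.Ici 0)) (x : Rn n) {y : ℝ}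
    (hy : 0 ≤ y) :
    HasDerivWithinAt (F x) (fderivWithin ℝ (Function.uncurry F) (Set.univ ×ˢ Set.Ici 0) (x, y) (0, 1))
      (Set.Ici 0) y := by
  have h1 : HasFDerivWithinAt (Function.uncurry F) _ (Set.univ ×ˢ Set.Ici 0) (x, y) :=
    ((hF.differentiableOn (by simp)) (x, y) ⟨trivial, hy⟩).hasFDerivWithinAt
  have h2 : HasDerivWithinAt (fun t : ℝ => (x, t)) ((0 : Rn n), (1 : ℝ)) (Set.Ici 0) y :=
    ((hasDerivAt_const y x).prodMk (hasDerivAt_id y)).hasDerivWithinAt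
  exact h1.comp_hasDerivWithinAt y h2 fun t ht => ⟨trivial, ht⟩

lemma contDiffOn_iteratedDerivWithin
    (hF : ContDiffOn ℝ ∞ (Function.uncurry F) (Set.univ ×ˢ Set.Ici 0)) (j : ℕ) :
    ContDiffOn ℝ ∞ (Function.uncurry fun x y => iteratedDerivWithin j (F x) (Set.Ici 0) y)
      (Set.univ ×ˢ Set.Ici 0) := by
  induction j with
  | zero => simpa using hF
  | succ j ih =>
    have h1 : ContDiffOn ℝ ∞ (fun p => fderivWithin ℝ
        (Function.uncurry fun x y => iteratedDerivWithin j (F x) (Set.Ici 0) y)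
        (Set.univ ×ˢ Set.Ici 0) p (0, 1)) (Set.univ ×ˢ Set.Ici 0) :=
      (ih.fderivWithin uniqueDiffOn_univ_prod_Ici (by simp)).clm_apply contDiffOn_const
    refine h1.congr fun p hp => ?_
    obtain ⟨x, y⟩ := p
    simp only [Function.uncurry]
    rw [iteratedDerivWithin_succ]
    exact (hasDerivWithinAt_of_contDiffOn ih x hp.2).derivWithin (uniqueDiffOn_Ici 0 y hp.2)

/-- The normal derivatives of a function on the closed half space, extended to `y < 0` by their
boundary values. -/
def normalJet (F : Rn n → ℝ → ℂ) (j : ℕ) (x : Rn n) (y : ℝ) : ℂ :=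
  iteratedDerivWithin j (F x) (Set.Ici 0) (max y 0)

lemma IsSmoothEven.continuous_normalJet (hF : IsSmoothEven F) (j : ℕ) :
    Continuous (Function.uncurry (normalJet F j)) := by
  have h := (contDiffOn_iteratedDerivWithin hF.1 j).continuousOn.comp_continuous
    (f := fun p : Rn n × ℝ => (p.1, max p.2 0)) (by fun_prop) fun p => ⟨trivial, Set.mem_Ici.2 (le_max_right _ _)⟩
  exact h

lemma IsSmoothEven.hasDerivAt_normalJet (hF : IsSmoothEven F) (j : ℕ) (x : Rn n) {y : ℝ}
    (hy : 0 < y) : HasDerivAt (normalJet F j x) (normalJet F (j + 1) x y) y := by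
  have h1 := hasDerivWithinAt_of_contDiffOn (contDiffOn_iteratedDerivWithin hF.1 j) x hy.le
  have h2 := h1.derivWithin (uniqueDiffOn_Ici 0 y hy.le)
  rw [← h2] at h1
  have h3 := h1.hasDerivAt (Ici_mem_nhds hy)
  rw [normalJet, max_eq_left hy.le, iteratedDerivWithin_succ]
  refine h3.congr_of_eventuallyEq ?_
  filter_upwards [lt_mem_nhds hy] with t ht
  rw [normalJet, max_eq_left ht.le]

lemma IsSmoothEven.normalJet_odd (hF : IsSmoothEven F) (j : ℕ) (x : Rn n) :
    normalJet F (2 * j + 1) x 0 = 0 := by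
  rw [normalJet, max_self]
  exact hF.2 x j

lemma IsSmoothEven.evenJet (hF : IsSmoothEven F) (x : Rn n) :
    EvenJet fun j => normalJet F j x where
  cont j := (hF.continuous_normalJet j).comp (by fun_prop : Continuous fun y : ℝ => (x, y))
  deriv j _ hy := hF.hasDerivAt_normalJet j x hy
  odd j := hF.normalJet_odd j x

lemma IsSmoothEven.contDiff_normalJet_zero (hF : IsSmoothEven F) (j : ℕ) :
    ContDiff ℝ ∞ fun x => normalJet F j x 0 := by
  have h := (contDiffOn_iteratedDerivWithin hF.1 j).comp_contDiff
    (f := fun x : Rn n => (x, (0 : ℝ))) (by fun_prop) fun p => ⟨trivial, Set.mem_Ici.2 le_rfl⟩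
  simpa [normalJet, Function.comp_def, Function.uncurry] using h

lemma IsSmoothEven.evenJet_integral (hF : IsSmoothEven F) {ψ : Rn n → ℂ} (hψ : Continuous ψ)
    (hψc : HasCompactSupport ψ) : EvenJet fun j y => ∫ x, normalJet F j x y * ψ x := by
  have hcont : ∀ j, Continuous fun p : Rn n × ℝ => normalJet F j p.1 p.2 * ψ p.1 := fun j =>
    (hF.continuous_normalJet j).mul (by fun_prop)
  -- On the compact support of `ψ` a constant serves as dominating function for differentiation
  -- under the integral.
  have hset : ∀ (j : ℕ) (y : ℝ), ∫ x, normalJet F j x y * ψ x =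
      ∫ x in tsupport ψ, normalJet F j x y * ψ x := fun j y =>
    (setIntegral_eq_integral_of_forall_compl_eq_zero fun x hx => by
      rw [image_eq_zero_of_notMem_tsupport hx, mul_zero]).symm
  refine ⟨fun j => ?_, fun j y hy => ?_, fun j => ?_⟩
  · simp only [hset]
    exact continuous_parametric_integral_of_continuous
      (f := fun y x => normalJet F j x y * ψ x) ((hcont j).comp continuous_swap) hψc
  · simp only [hset]
    obtain ⟨M, hM⟩ := (hψc.prod (isCompact_Icc (a := (0 : ℝ)) (b := 2 * y))).exists_bound_of_continuousOn
      (hcont (j + 1)).continuousOn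
    refine (hasDerivAt_integral_of_dominated_loc_of_deriv_le
      (μ := volume.restrict (tsupport ψ))
      (F := fun y x => normalJet F j x y * ψ x) (F' := fun y x => normalJet F (j + 1) x y * ψ x)
      (bound := fun _ => M) (s := Set.Ioo 0 (2 * y)) (isOpen_Ioo.mem_nhds ⟨hy, by linarith⟩)
      ?_ ?_ ?_ ?_ ?_ ?_).2
    · exact Eventually.of_forall fun t => ((hcont j).comp
        (by fun_prop : Continuous fun x : Rn n => (x, t))).aestronglyMeasurable
    · exact ((hcont j).comp (by fun_prop : Continuous fun x : Rn n => (x, y))).continuousOn.integrableOn_compact hψc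
    · exact ((hcont (j + 1)).comp
        (by fun_prop : Continuous fun x : Rn n => (x, y))).aestronglyMeasurable
    · filter_upwards [ae_restrict_mem (isClosed_tsupport ψ).measurableSet] with x hx t ht
      exact hM (x, t) ⟨hx, ht.1.le, ht.2.le⟩
    · exact integrableOn_const hψc.measure_lt_top.ne
    · filter_upwards with x t ht
      exact (hF.hasDerivAt_normalJet j x ht.1).mul_const (ψ x)
  · simp only [hF.normalJet_odd, zero_mul, integral_zero]

/-- `V = F + y ^ (2 a) G` with `F` and `G` smooth and even. -/
structure IsSmoothPair (a : ℝ) (V F G : Rn n → ℝ → ℂ) : Prop where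
  left : IsSmoothEven F
  right : IsSmoothEven G
  eq : ∀ (x : Rn n) (y : ℝ), 0 < y → V x y = F x y + (y ^ (2 * a) : ℝ) • G x y

namespace IsSmoothPair

variable {a : ℝ} {V : Rn n → ℝ → ℂ}

lemma isJetPair (h : IsSmoothPair a V F G) (x : Rn n) :
    IsJetPair a (V x) (fun j => normalJet F j x) (fun j => normalJet G j x) where
  left := h.left.evenJet x
  right := h.right.evenJet x
  eq y hy := by rw [h.eq x y hy, normalJet, normalJet, max_eq_left hy.le]; simp

lemma isJetPair_integral (h : IsSmoothPair a V F G) {ψ : Rn n → ℂ} (hψ : Continuous ψ)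
    (hψc : HasCompactSupport ψ) :
    IsJetPair a (fun y => ∫ x, V x y * ψ x) (fun j y => ∫ x, normalJet F j x y * ψ x)
      (fun j y => ∫ x, normalJet G j x y * ψ x) where
  left := h.left.evenJet_integral hψ hψc
  right := h.right.evenJet_integral hψ hψc
  eq y hy := by
    have hi : ∀ {F : Rn n → ℝ → ℂ}, IsSmoothEven F →
        Integrable fun x => normalJet F 0 x y * ψ x := fun hF =>
      (((hF.continuous_normalJet 0).comp (by fun_prop : Continuous fun x : Rn n => (x, y))).mul
        hψ).integrable_of_hasCompactSupport (hψc.mul_left (f' := _))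
    rw [← integral_const_mul, ← integral_add (hi h.left) ((hi h.right).const_mul _)]
    refine integral_congr_ae (Eventually.of_forall fun x => ?_)
    simp only [(h.isJetPair x).eq y hy]
    ring

lemma boundaryTrace_normalOp (h : IsSmoothPair a V F G) (ha : 0 < a) (i : ℕ) :
    boundaryTrace (fun x => (normalOp (1 - 2 * a))^[i] (V x)) =
      fun x => jetConst (1 - 2 * a) i * normalJet F (2 * i) x 0 := by
  funext x
  rw [boundaryTrace, (((h.isJetPair x).normalOp_iterate i).tendsto ha).limUnder_eq,
    jetOp_iterate_zero]

lemma boundaryTrace_smul_deriv (h : IsSmoothPair a V F G) (ha1 : a < 1) (i : ℕ) :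
    boundaryTrace (fun x y => (y ^ (1 - 2 * a) : ℝ) •
        deriv ((normalOp (1 - 2 * a))^[i] (V x)) y) =
      fun x => 2 * a * (jetConst (1 + 2 * a) i * normalJet G (2 * i) x 0) := by
  funext x
  rw [boundaryTrace, (((h.isJetPair x).normalOp_iterate i).tendsto_smul_deriv ha1).limUnder_eq,
    jetOp_iterate_zero]

end IsSmoothPair

end NormalJet

/-! ### The weighted Laplacian tested against functions of the tangential variable -/

section Tested

variable {n : ℕ}

/-- The operator `-Δ` on Schwartz functions. -/
def negLap : 𝓢(Rn n, ℂ) →ₗ[ℂ] 𝓢(Rn n, ℂ) :=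
  -(LineDeriv.laplacianCLM ℂ (Rn n) 𝓢(Rn n, ℂ)).toLinearMap

lemma negLap_apply (ψ : 𝓢(Rn n, ℂ)) (x : Rn n) : negLap ψ x = -Δ (ψ : Rn n → ℂ) x := by
  rw [← SchwartzMap.laplacian_apply, ← SchwartzMap.laplacianCLM_eq (𝕜 := ℂ)]
  rfl

lemma laplacian_eq_sum_fderiv {g : Rn n → ℂ} (hg : ContDiff ℝ 2 g) (x : Rn n) :
    Δ g x = ∑ i, fderiv ℝ (fun x' => fderiv ℝ g x' (EuclideanSpace.basisFun (Fin n) ℝ i)) x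
      (EuclideanSpace.basisFun (Fin n) ℝ i) := by
  rw [InnerProductSpace.laplacian_eq_iteratedFDeriv_orthonormalBasis g
    (EuclideanSpace.basisFun (Fin n) ℝ)]
  refine Finset.sum_congr rfl fun i _ => ?_
  have h1 : DifferentiableAt ℝ (fderiv ℝ g) x :=
    ((hg.fderiv_right (m := 1) (by norm_num)).differentiable (by norm_num)) x
  rw [iteratedFDeriv_two_apply, fderiv_clm_apply h1 (differentiableAt_const _)]
  simp

lemma tsupport_laplacian_subset (g : Rn n → ℂ) : tsupport (Δ g) ⊆ tsupport g := by
  refine closure_minimal (fun x hx => ?_) (isClosed_tsupport g)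
  by_contra h
  refine hx ?_
  have h1 : g =ᶠ[𝓝 x] fun _ => 0 := notMem_tsupport_iff_eventuallyEq.1 h
  rw [(InnerProductSpace.laplacian_congr_nhds h1).eq_of_nhds]
  simp

lemma hasCompactSupport_negLap {ψ : 𝓢(Rn n, ℂ)} (hψ : HasCompactSupport ψ) :
    HasCompactSupport (negLap ψ) := by
  have h1 : HasCompactSupport (Δ (ψ : Rn n → ℂ)) :=
    hψ.of_isClosed_subset (isClosed_tsupport _) (tsupport_laplacian_subset _)
  have h2 : ((negLap ψ : 𝓢(Rn n, ℂ)) : Rn n → ℂ) = -Δ (ψ : Rn n → ℂ) := by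
    funext x; exact negLap_apply ψ x
  rw [h2]
  exact h1.neg

lemma hasCompactSupport_negLap_iterate {ψ : 𝓢(Rn n, ℂ)} (hψ : HasCompactSupport ψ) (l : ℕ) :
    HasCompactSupport ((negLap ^ l) ψ) := by
  induction l with
  | zero => simpa using hψ
  | succ l ih => rw [pow_succ']; exact hasCompactSupport_negLap ih

lemma integral_fderiv_mul {g ψ : Rn n → ℂ} (hg : ContDiff ℝ 1 g) (hψ : ContDiff ℝ 1 ψ)
    (hψc : HasCompactSupport ψ) (v : Rn n) :
    ∫ x, fderiv ℝ g x v * ψ x = -∫ x, g x * fderiv ℝ ψ x v := by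
  have c1 : Continuous fun x => fderiv ℝ g x v := (hg.continuous_fderiv (by norm_num)).clm_apply
    continuous_const
  have c2 : Continuous fun x => fderiv ℝ ψ x v := (hψ.continuous_fderiv (by norm_num)).clm_apply
    continuous_const
  have s2 : HasCompactSupport fun x => fderiv ℝ ψ x v := hψc.fderiv_apply (𝕜 := ℝ) v
  rw [integral_mul_fderiv_eq_neg_fderiv_mul_of_integrable, neg_neg]
  · exact (c1.mul hψ.continuous).integrable_of_hasCompactSupport hψc.mul_left
  · exact (hg.continuous.mul c2).integrable_of_hasCompactSupport s2.mul_left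
  · exact (hg.continuous.mul hψ.continuous).integrable_of_hasCompactSupport hψc.mul_left
  · exact fun x _ => (hg.differentiable (by norm_num)) x
  · exact fun x _ => (hψ.differentiable (by norm_num)) x

lemma contDiff_fderiv_apply {g : Rn n → ℂ} (hg : ContDiff ℝ ∞ g) (v : Rn n) :
    ContDiff ℝ ∞ fun x => fderiv ℝ g x v :=
  (hg.fderiv_right (m := ∞) (by simp)).clm_apply contDiff_const

lemma integral_laplacian_mul {g : Rn n → ℂ} (hg : ContDiff ℝ ∞ g) {ψ : 𝓢(Rn n, ℂ)}
    (hψ : HasCompactSupport ψ) : ∫ x, Δ g x * ψ x = -∫ x, g x * negLap ψ x := by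
  have hψs : ContDiff ℝ ∞ ψ := ψ.smooth ⊤
  have h2 : ∀ {f : Rn n → ℂ}, ContDiff ℝ ∞ f → ContDiff ℝ 2 f := fun h => by
    exact_mod_cast contDiff_infty.1 h 2
  have h1 : ∀ {f : Rn n → ℂ}, ContDiff ℝ ∞ f → ContDiff ℝ 1 f := fun h => h.of_le (by exact_mod_cast le_top)
  simp only [laplacian_eq_sum_fderiv (h2 hg), negLap_apply, laplacian_eq_sum_fderiv (h2 hψs),
    mul_neg, integral_neg, neg_neg, Finset.sum_mul, Finset.mul_sum]
  rw [integral_finsetSum, integral_finsetSum]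
  · refine Finset.sum_congr rfl fun i _ => ?_
    rw [integral_fderiv_mul (h1 (contDiff_fderiv_apply hg _)) (h1 hψs) hψ,
      integral_fderiv_mul (h1 hg) (h1 (contDiff_fderiv_apply hψs _)) (hψ.fderiv_apply (𝕜 := ℝ) _),
      neg_neg]
  · intro i _
    exact (hg.continuous.mul (contDiff_fderiv_apply (contDiff_fderiv_apply hψs _) _).continuous).integrable_of_hasCompactSupport
      (((hψ.fderiv_apply (𝕜 := ℝ) _).fderiv_apply (𝕜 := ℝ) _).mul_left)
  · intro i _
    exact ((contDiff_fderiv_apply (contDiff_fderiv_apply hg _) _).continuous.mul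
      ψ.continuous).integrable_of_hasCompactSupport hψ.mul_left

/-- Smoothness on the open half space. -/
def SmoothInterior (U : Rn n → ℝ → ℂ) : Prop :=
  ContDiffOn ℝ ∞ (Function.uncurry U) (Set.univ ×ˢ Set.Ioi 0)

lemma isOpen_univ_prod_Ioi : IsOpen (Set.univ ×ˢ Set.Ioi (0 : ℝ) : Set (Rn n × ℝ)) :=
  isOpen_univ.prod isOpen_Ioi

namespace SmoothInterior

variable {U W : Rn n → ℝ → ℂ}

lemma hasFDerivAt (h : SmoothInterior U) (x : Rn n) {y : ℝ} (hy : 0 < y) :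
    HasFDerivAt (Function.uncurry U) (fderiv ℝ (Function.uncurry U) (x, y)) (x, y) :=
  ((h.differentiableOn (by simp)).differentiableAt
    (isOpen_univ_prod_Ioi.mem_nhds ⟨trivial, Set.mem_Ioi.2 hy⟩)).hasFDerivAt

lemma hasDerivAt (h : SmoothInterior U) (x : Rn n) {y : ℝ} (hy : 0 < y) :
    HasDerivAt (U x) (fderiv ℝ (Function.uncurry U) (x, y) (0, 1)) y := by
  have h2 : HasDerivAt (fun t : ℝ => (x, t)) ((0 : Rn n), (1 : ℝ)) y :=
    (hasDerivAt_const y x).prodMk (hasDerivAt_id y)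
  exact (h.hasFDerivAt x hy).comp_hasDerivAt y h2

lemma fderiv_apply (h : SmoothInterior U) (v : Rn n × ℝ) :
    SmoothInterior fun x y => fderiv ℝ (Function.uncurry U) (x, y) v :=
  (ContDiffOn.fderiv_of_isOpen h isOpen_univ_prod_Ioi (m := ∞) (by simp)).clm_apply contDiffOn_const

lemma congr (h : SmoothInterior U) (hUW : ∀ x y, 0 < y → W x y = U x y) : SmoothInterior W :=
  ContDiffOn.congr h fun p hp => hUW p.1 p.2 hp.2

lemma deriv (h : SmoothInterior U) : SmoothInterior fun x y => deriv (U x) y :=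
  (h.fderiv_apply (0, 1)).congr fun x _ hy => (h.hasDerivAt x hy).deriv

lemma slice (h : SmoothInterior U) {y : ℝ} (hy : 0 < y) : ContDiff ℝ ∞ fun x => U x y :=
  ContDiffOn.comp_contDiff (f := fun x : Rn n => (x, y)) h (by fun_prop) fun _ => ⟨trivial, hy⟩

lemma fderiv_slice (h : SmoothInterior U) (v : Rn n) :
    SmoothInterior fun x y => fderiv ℝ (fun x' => U x' y) x v :=
  (h.fderiv_apply (v, 0)).congr fun x y hy => by
    have h2 : HasFDerivAt (𝕜 := ℝ) (fun x' : Rn n => (x', y))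
        ((ContinuousLinearMap.id ℝ (Rn n)).prod (0 : Rn n →L[ℝ] ℝ)) x :=
      (hasFDerivAt_id x).prodMk (hasFDerivAt_const y x)
    have h4 : HasFDerivAt (𝕜 := ℝ) (fun x' => U x' y) _ x :=
      HasFDerivAt.comp (g := Function.uncurry U) x (h.hasFDerivAt x hy) h2
    rw [h4.fderiv]
    simp

lemma weightedLaplacian (h : SmoothInterior U) (m : ℝ) :
    SmoothInterior (weightedLaplacian m U) := by
  have h1 : SmoothInterior fun x y => ∑ i, fderiv ℝ (fun x' => fderiv ℝ (fun x'' => U x'' y) x'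
      (EuclideanSpace.basisFun (Fin n) ℝ i)) x (EuclideanSpace.basisFun (Fin n) ℝ i) :=
    ContDiffOn.sum (f := fun i (p : Rn n × ℝ) => fderiv ℝ (fun x' => fderiv ℝ (fun x'' => U x'' p.2) x'
      (EuclideanSpace.basisFun (Fin n) ℝ i)) p.1 (EuclideanSpace.basisFun (Fin n) ℝ i))
      fun i _ => (h.fderiv_slice _).fderiv_slice _
  have h2 : ContDiffOn ℝ ∞ (fun p : Rn n × ℝ => (m / p.2 : ℝ)) (Set.univ ×ˢ Set.Ioi 0) :=
    contDiffOn_const.div contDiffOn_snd fun p hp => (ne_of_gt hp.2 : p.2 ≠ 0)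
  have h3 := ContDiffOn.add h1 (ContDiffOn.add h.deriv.deriv (ContDiffOn.smul h2 h.deriv))
  refine ContDiffOn.congr h3 fun p hp => ?_
  have h4 := laplacian_eq_sum_fderiv (g := fun x => U x p.2)
    (by exact_mod_cast contDiff_infty.1 (h.slice hp.2) 2) p.1
  simp only [Function.uncurry, _root_.weightedLaplacian, normalOp]
  rw [h4]
  rfl

lemma continuous_slice (h : SmoothInterior U) {y : ℝ} (hy : 0 < y) : Continuous fun x => U x y :=
  (h.slice hy).continuous

lemma integrable (h : SmoothInterior U) {y : ℝ} (hy : 0 < y) {ψ : Rn n → ℂ} (hψ : Continuous ψ)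
    (hψc : HasCompactSupport ψ) : Integrable fun x => U x y * ψ x :=
  ((h.continuous_slice hy).mul hψ).integrable_of_hasCompactSupport hψc.mul_left

lemma hasDerivAt_integral (h : SmoothInterior U) {ψ : Rn n → ℂ} (hψ : Continuous ψ)
    (hψc : HasCompactSupport ψ) {y : ℝ} (hy : 0 < y) :
    HasDerivAt (fun y => ∫ x, U x y * ψ x) (∫ x, _root_.deriv (U x) y * ψ x) y := by
  have hc : ContinuousOn (fun p : Rn n × ℝ => _root_.deriv (U p.1) p.2 * ψ p.1)
      (tsupport ψ ×ˢ Set.Icc (y / 2) (2 * y)) :=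
    ((ContDiffOn.continuousOn h.deriv).mono fun p hp =>
      ⟨trivial, lt_of_lt_of_le (by positivity) hp.2.1⟩).mul (by fun_prop)
  obtain ⟨M, hM⟩ := (hψc.prod (isCompact_Icc (a := y / 2) (b := 2 * y))).exists_bound_of_continuousOn hc
  have hset : ∀ (f : Rn n → ℂ), ∫ x, f x * ψ x = ∫ x in tsupport ψ, f x * ψ x := fun f =>
    (setIntegral_eq_integral_of_forall_compl_eq_zero fun x hx => by
      rw [image_eq_zero_of_notMem_tsupport hx, mul_zero]).symm
  simp only [hset]
  refine (hasDerivAt_integral_of_dominated_loc_of_deriv_le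
    (μ := volume.restrict (tsupport ψ))
    (F := fun y x => U x y * ψ x) (F' := fun y x => _root_.deriv (U x) y * ψ x)
    (bound := fun _ => M) (s := Set.Ioo (y / 2) (2 * y))
    (isOpen_Ioo.mem_nhds ⟨by linarith, by linarith⟩) ?_ ?_ ?_ ?_ ?_ ?_).2
  · filter_upwards [lt_mem_nhds hy] with t ht
    exact ((h.continuous_slice ht).mul hψ).aestronglyMeasurable
  · exact ((h.continuous_slice hy).mul hψ).continuousOn.integrableOn_compact hψc
  · exact ((h.deriv.continuous_slice hy).mul hψ).aestronglyMeasurable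
  · filter_upwards [ae_restrict_mem (isClosed_tsupport ψ).measurableSet] with x hx t ht
    exact hM (x, t) ⟨hx, ht.1.le, ht.2.le⟩
  · exact integrableOn_const hψc.measure_lt_top.ne
  · filter_upwards with x t ht
    have ht0 : 0 < t := lt_trans (by positivity) ht.1
    exact ((h.hasDerivAt x ht0).differentiableAt.hasDerivAt).mul_const (ψ x)

/-- `T` passes through the integral and the tangential Laplacian moves onto `ψ`. With `u_{i,l}` the
pairing of `Δ_m^i V` with `(-Δ̄)^l ψ`, this is `T u_{i,l} = u_{i+1,l} + u_{i,l+1}`. -/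
lemma integral_weightedLaplacian (h : SmoothInterior U) (m : ℝ) {ψ : 𝓢(Rn n, ℂ)}
    (hψ : HasCompactSupport ψ) {y : ℝ} (hy : 0 < y) :
    ∫ x, _root_.weightedLaplacian m U x y * ψ x =
      normalOp m (fun y => ∫ x, U x y * ψ x) y - ∫ x, U x y * negLap ψ x := by
  have h1 : ∀ y, 0 < y → _root_.deriv (fun y => ∫ x, U x y * ψ x) y =
      ∫ x, _root_.deriv (U x) y * ψ x := fun y hy => (h.hasDerivAt_integral ψ.continuous hψ hy).deriv
  have h2 : _root_.deriv (_root_.deriv fun y => ∫ x, U x y * ψ x) y =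
      ∫ x, _root_.deriv (_root_.deriv (U x)) y * ψ x := by
    rw [← (h.deriv.hasDerivAt_integral ψ.continuous hψ hy).deriv]
    refine EventuallyEq.deriv_eq ?_
    filter_upwards [lt_mem_nhds hy] with t ht using h1 t ht
  have h3 := integral_laplacian_mul (h.slice hy) hψ
  -- Weight `0` makes the weighted Laplacian the ordinary one, so the tangential Laplacian is
  -- recovered by subtracting the second normal derivative.
  have cL : Continuous fun x => Δ (fun x' => U x' y) x := by
    have := ((h.weightedLaplacian 0).continuous_slice hy).sub (h.deriv.deriv.continuous_slice hy)
    refine this.congr fun x => ?_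
    simp [_root_.weightedLaplacian, normalOp]
  have i1 : Integrable fun x => Δ (fun x' => U x' y) x * ψ x :=
    (cL.mul ψ.continuous).integrable_of_hasCompactSupport hψ.mul_left
  have i2 := h.deriv.deriv.integrable hy ψ.continuous hψ
  have i3 := (h.deriv.integrable hy ψ.continuous hψ).const_mul ((m / y : ℝ) : ℂ)
  rw [normalOp, h2, h1 y hy, sub_eq_add_neg, ← h3, Complex.real_smul, ← integral_const_mul,
    ← integral_add i2 i3, add_comm]
  refine Eq.trans ?_ (integral_add i1 (i2.add i3))
  refine integral_congr_ae (Eventually.of_forall fun x => ?_)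
  simp only [_root_.weightedLaplacian, normalOp, Complex.real_smul]
  ring

end SmoothInterior

end Tested

/-! ### The hierarchy of tested equations -/

section Hierarchy

variable {n : ℕ} {V F G : Rn n → ℝ → ℂ}

lemma IsSmoothPair.smoothInterior {a : ℝ} (h : IsSmoothPair a V F G) : SmoothInterior V := by
  have h0 : (Set.univ ×ˢ Set.Ioi 0 : Set (Rn n × ℝ)) ⊆ Set.univ ×ˢ Set.Ici 0 :=
    Set.prod_mono le_rfl Set.Ioi_subset_Ici_self
  have h2 : ContDiffOn ℝ ∞ (fun p : Rn n × ℝ => p.2 ^ (2 * a)) (Set.univ ×ˢ Set.Ioi 0) :=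
    contDiffOn_snd.rpow_const_of_ne fun p hp => (ne_of_gt hp.2 : p.2 ≠ 0)
  exact ((h.left.1.mono h0).add (h2.smul (h.right.1.mono h0))).congr fun p hp => h.eq p.1 p.2 hp.2

lemma SmoothInterior.weightedLaplacian_iterate (h : SmoothInterior V) (m : ℝ) (i : ℕ) :
    SmoothInterior ((_root_.weightedLaplacian m)^[i] V) := by
  induction i with
  | zero => exact h
  | succ i ih => rw [Function.iterate_succ_apply']; exact ih.weightedLaplacian m

/-- The jets of the functions obtained by testing `Δ_m ^ i V` against `ψ`. -/
def jetTower (μ : ℝ) (F : Rn n → ℝ → ℂ) : ℕ → 𝓢(Rn n, ℂ) → ℕ → ℝ → ℂ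
  | 0, ψ => fun j y => ∫ x, normalJet F j x y * ψ x
  | i + 1, ψ => jetOp μ (jetTower μ F i ψ) - jetTower μ F i (negLap ψ)

lemma IsSmoothPair.isJetPair_jetTower {a : ℝ} (h : IsSmoothPair a V F G) (i : ℕ)
    {ψ : 𝓢(Rn n, ℂ)} (hψ : HasCompactSupport ψ) :
    IsJetPair a (fun y => ∫ x, ((weightedLaplacian (1 - 2 * a))^[i] V) x y * ψ x)
      (jetTower (1 - 2 * a) F i ψ) (jetTower (1 + 2 * a) G i ψ) := by
  induction i generalizing ψ with
  | zero => exact h.isJetPair_integral ψ.continuous hψ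
  | succ i ih =>
    refine ((ih hψ).normalOp.sub (ih (hasCompactSupport_negLap hψ))).congr fun y hy => ?_
    rw [Function.iterate_succ_apply',
      (h.smoothInterior.weightedLaplacian_iterate _ i).integral_weightedLaplacian _ hψ hy]
    rfl

/-- By its definition, the tower satisfies the Pascal rule: `jetOp` at level `i` is level `i + 1`
plus level `i` tested against `-Δψ`. Each use of `jetOp` at `0` reaches the next even derivative
with one more factor of `jetConst`. -/
lemma pascal_jetTower (μ : ℝ) (F : Rn n → ℝ → ℂ) (ψ : 𝓢(Rn n, ℂ)) (j i l : ℕ) :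
    pascal (fun i l => jetTower μ F i ((negLap ^ l) ψ) 0 0) j i l =
      jetConst μ j * jetTower μ F i ((negLap ^ l) ψ) (2 * j) 0 := by
  induction j generalizing i l with
  | zero => simp [pascal, jetConst]
  | succ j ih =>
    rw [pascal, ih, ih, jetTower, pow_succ', Module.End.mul_apply, jetConst, jetConst,
      Finset.prod_range_succ]
    simp only [Pi.sub_apply, jetOp]
    rw [jetDiv_zero_right, show 2 * j + 2 = 2 * (j + 1) by ring]
    have : (2 * (j : ℂ) + 1) ≠ 0 := by exact_mod_cast (by omega : 2 * j + 1 ≠ 0)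
    push_cast
    field_simp
    ring

lemma weightedLaplacian_eq_zero {m : ℝ} {U : Rn n → ℝ → ℂ} (h : ∀ x y, 0 < y → U x y = 0)
    (x : Rn n) {y : ℝ} (hy : 0 < y) : weightedLaplacian m U x y = 0 := by
  have h1 : (fun x' => U x' y) = fun _ => 0 := funext fun x' => h x' y hy
  have h2 : deriv (U x) =ᶠ[𝓝 y] fun _ => 0 := by
    filter_upwards [lt_mem_nhds hy] with t ht
    have : U x =ᶠ[𝓝 t] fun _ => 0 := by
      filter_upwards [lt_mem_nhds ht] with s hs using h x s hs
    rw [this.deriv_eq, deriv_const]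
  rw [weightedLaplacian, h1, normalOp, h2.deriv_eq, h2.eq_of_nhds]
  simp

lemma weightedLaplacian_iterate_eq_zero {m : ℝ} {k : ℕ}
    (hk : ∀ x y, 0 < y → ((weightedLaplacian m)^[k] V) x y = 0) {i : ℕ} (hi : k ≤ i)
    (x : Rn n) {y : ℝ} (hy : 0 < y) : ((weightedLaplacian m)^[i] V) x y = 0 := by
  induction i, hi using Nat.le_induction generalizing x y with
  | base => exact hk x y hy
  | succ i _ ih =>
    rw [Function.iterate_succ_apply']
    exact weightedLaplacian_eq_zero (fun x y hy => ih x hy) x hy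

lemma IsJetPair.eq_zero {a : ℝ} {u : ℝ → ℂ} {w z : ℕ → ℝ → ℂ} (h : IsJetPair a u w z) (ha : 0 < a)
    (ha1 : a < 1) (hu : ∀ y, 0 < y → u y = 0) : w 0 0 = 0 ∧ z 0 0 = 0 := by
  constructor
  · refine tendsto_nhds_unique (h.tendsto ha) (tendsto_const_nhds.congr' ?_)
    filter_upwards [self_mem_nhdsWithin] with y hy using (hu y hy).symm
  · have h1 : 2 * a * z 0 0 = 0 := by
      refine tendsto_nhds_unique (h.tendsto_smul_deriv ha1) (tendsto_const_nhds.congr' ?_)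
      filter_upwards [self_mem_nhdsWithin] with y hy
      have : u =ᶠ[𝓝 y] fun _ => 0 := by
        filter_upwards [lt_mem_nhds hy] with s hs using hu s hs
      rw [this.deriv_eq, deriv_const, smul_zero]
    have : (a : ℂ) ≠ 0 := by exact_mod_cast ha.ne'
    simpa [this] using h1

variable {a : UnitExp}

/-- The result of testing `Δ_m ^ i V` against `ψ`. -/
def testLoc (h : IsSmoothPair a V F G) (i : ℕ) {ψ : 𝓢(Rn n, ℂ)} (hψ : HasCompactSupport ψ) :
    LocBdd := (h.isJetPair_jetTower i hψ).toLoc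

lemma testLoc_apply (h : IsSmoothPair a V F G) (i : ℕ) {ψ : 𝓢(Rn n, ℂ)} (hψ : HasCompactSupport ψ)
    {y : ℝ} (hy : 0 < y) : (testLoc h i hψ : ℝ → ℂ) y =
      ∫ x, ((weightedLaplacian (1 - 2 * (a : ℝ)))^[i] V) x y * ψ x :=
  (h.isJetPair_jetTower i hψ).toLoc_apply hy

lemma jetTower_eq_zero (h : IsSmoothPair a V F G) {k : ℕ}
    (hk : ∀ x y, 0 < y → ((weightedLaplacian (1 - 2 * (a : ℝ)))^[k] V) x y = 0) {i : ℕ} (hi : k ≤ i)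
    {ψ : 𝓢(Rn n, ℂ)} (hψ : HasCompactSupport ψ) :
    jetTower (1 - 2 * (a : ℝ)) F i ψ 0 0 = 0 ∧ jetTower (1 + 2 * (a : ℝ)) G i ψ 0 0 = 0 :=
  (h.isJetPair_jetTower i hψ).eq_zero a.2.1 a.2.2 fun y hy => by
    simp [weightedLaplacian_iterate_eq_zero hk hi _ hy]

/-- Inverting `T` in `T u_{i,l} = u_{i+1,l} + u_{i,l+1}` gives the first order hierarchy with the
two traces as sources. It terminates because `Δ_m^k V = 0`. -/
theorem one_sub_invShift_pow_testLoc (h : IsSmoothPair a V F G) {k : ℕ}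
    (hk : ∀ x y, 0 < y → ((weightedLaplacian (1 - 2 * (a : ℝ)))^[k] V) x y = 0)
    {ψ : 𝓢(Rn n, ℂ)} (hψ : HasCompactSupport ψ) :
    ((1 - invShift a) ^ k) (fun l => testLoc h 0 (hasCompactSupport_negLap_iterate hψ l)) =
      ∑ i ∈ Finset.range k, (invSeq a ^ i) (((1 - invShift a) ^ (k - 1 - i))
        (srcSeq a (fun i l => jetTower (1 - 2 * (a : ℝ)) F i ((negLap ^ l) ψ) 0 0)
          (fun i l => jetTower (1 + 2 * (a : ℝ)) G i ((negLap ^ l) ψ) 0 0) i)) := by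
  set U : ℕ → ℕ → LocBdd := fun i l => testLoc h i (hasCompactSupport_negLap_iterate hψ l) with hU
  have step : ∀ i, (1 - invShift a) (U i) = invSeq a (U (i + 1)) +
      srcSeq a (fun i l => jetTower (1 - 2 * (a : ℝ)) F i ((negLap ^ l) ψ) 0 0)
          (fun i l => jetTower (1 + 2 * (a : ℝ)) G i ((negLap ^ l) ψ) 0 0) i := by
    intro i
    funext l
    have hc := hasCompactSupport_negLap_iterate hψ l
    have e1 := (h.isJetPair_jetTower i hc).normalInv_eq (f := U (i + 1) l + U i (l + 1))
      fun y hy => by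
        simp only [hU, Submodule.coe_add, Pi.add_apply]
        rw [testLoc_apply h _ _ hy, testLoc_apply h _ _ hy, Function.iterate_succ_apply',
          (h.smoothInterior.weightedLaplacian_iterate _ i).integral_weightedLaplacian _ hc hy,
          pow_succ', Module.End.mul_apply, sub_add_cancel]
    have e2 : (1 - invShift a) (U i) l = U i l - normalInv a (U i (l + 1)) := rfl
    have e3 : (invSeq a (U (i + 1)) +
      srcSeq a (fun i l => jetTower (1 - 2 * (a : ℝ)) F i ((negLap ^ l) ψ) 0 0)
          (fun i l => jetTower (1 + 2 * (a : ℝ)) G i ((negLap ^ l) ψ) 0 0) i) l =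
      normalInv a (U (i + 1) l) + (jetTower (1 - 2 * (a : ℝ)) F i ((negLap ^ l) ψ) 0 0 •
        powLoc a le_rfl 0 + jetTower (1 + 2 * (a : ℝ)) G i ((negLap ^ l) ψ) 0 0 •
        powLoc a (two_mul_nonneg a) 0) := rfl
    have e4 : (h.isJetPair_jetTower i hc).toLoc = U i l := rfl
    rw [map_add, e4] at e1
    rw [e2, e3, eq_sub_of_add_eq e1]
    abel
  have hUk : U k = 0 := by
    funext l
    refine LocBdd.ext_pos fun y hy => ?_
    simp only [hU]
    rw [testLoc_apply h _ _ hy]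
    simp [hk _ y hy]
  rw [← zero_add (∑ i ∈ Finset.range k, _), ← map_zero (invSeq a ^ k), ← hUk]
  exact hierarchy a step k

end Hierarchy

/-! ### Density of test functions -/

section Density

variable {n : ℕ}

/-- A factor `c` is gained at the price of one power of `|x|`: for `i = 0` because `χ(cx) ≠ 1`
forces `c|x| > 1`, for `i > 0` from the chain rule. -/
lemma exists_norm_iteratedFDeriv_cutoff_le (χ : ContDiffBump (0 : Rn n)) (hχ : χ.rIn = 1) (i : ℕ) :
    ∃ B : ℝ, 0 ≤ B ∧ ∀ c : ℝ, 0 ≤ c → c ≤ 1 → ∀ x : Rn n,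
      ‖iteratedFDeriv ℝ i (fun x => χ (c • x) - 1) x‖ ≤ c * B * (1 + ‖x‖) := by
  rcases Nat.eq_zero_or_pos i with rfl | hi
  · refine ⟨1, zero_le_one, fun c hc hc1 x => ?_⟩
    rw [norm_iteratedFDeriv_zero, mul_one, Real.norm_eq_abs]
    by_cases h : c * ‖x‖ ≤ 1
    · rw [χ.one_of_mem_closedBall (by
        rw [mem_closedBall_zero_iff, norm_smul, Real.norm_of_nonneg hc, hχ]; exact h)]
      simp only [sub_self, abs_zero]
      positivity
    · have h1 := χ.nonneg (x := c • x)
      have h2 := χ.le_one (x := c • x)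
      rw [abs_of_nonpos (by linarith)]
      nlinarith
  · have hs : ContDiff ℝ ∞ (χ : Rn n → ℝ) := χ.contDiff
    obtain ⟨B, hB⟩ := ((χ.hasCompactSupport.iteratedFDeriv (𝕜 := ℝ) i)).exists_bound_of_continuous
      (hs.continuous_iteratedFDeriv (m := i) (by exact_mod_cast le_top))
    have hB0 : 0 ≤ B := (norm_nonneg _).trans (hB 0)
    refine ⟨B, hB0, fun c hc hc1 x => ?_⟩
    set g : Rn n →L[ℝ] Rn n := c • ContinuousLinearMap.id ℝ (Rn n) with hg
    have e1 : (fun x : Rn n => χ (c • x)) = χ ∘ g := rfl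
    have hgn : ‖g‖ ≤ c := by
      rw [hg, norm_smul, Real.norm_of_nonneg hc]
      calc c * ‖ContinuousLinearMap.id ℝ (Rn n)‖ ≤ c * 1 :=
            mul_le_mul_of_nonneg_left ContinuousLinearMap.norm_id_le hc
        _ = c := mul_one c
    have hs' : ContDiff ℝ ∞ (χ ∘ g) := hs.comp g.contDiff
    have e2 : iteratedFDeriv ℝ i (fun x => χ (c • x) - 1) x = iteratedFDeriv ℝ i (χ ∘ g) x := by
      have := iteratedFDeriv_sub_apply (𝕜 := ℝ) (i := i) (f := χ ∘ g) (g := fun _ => (1 : ℝ)) (x := x)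
        (hs'.of_le (by exact_mod_cast le_top)).contDiffAt contDiffAt_const
      rw [iteratedFDeriv_const_of_ne hi.ne', Pi.zero_apply, sub_zero] at this
      exact this
    rw [e2, g.iteratedFDeriv_comp_right hs x (by exact_mod_cast le_top)]
    refine (ContinuousMultilinearMap.norm_compContinuousLinearMap_le _ _).trans ?_
    rw [Finset.prod_const, Finset.card_univ, Fintype.card_fin]
    calc ‖iteratedFDeriv ℝ i χ (g x)‖ * ‖g‖ ^ i ≤ B * c ^ i := by gcongr; exact hB _
      _ ≤ B * c := by
          gcongr
          exact pow_le_of_le_one hc hc1 hi.ne'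
      _ ≤ c * B * (1 + ‖x‖) := by
          have := norm_nonneg x
          nlinarith [mul_nonneg hc hB0]

/-- Cutoff at radius of order `1/c` with `c → 0`. The Leibniz rule bounds each seminorm of the error
by `c` times seminorms of `φ` with at most one additional power of `|x|`. -/
theorem exists_tendsto_hasCompactSupport (φ : 𝓢(Rn n, ℂ)) :
    ∃ ψ : ℕ → 𝓢(Rn n, ℂ), (∀ j, HasCompactSupport (ψ j)) ∧ Tendsto ψ atTop (𝓝 φ) := by
  set χ : ContDiffBump (0 : Rn n) := ⟨1, 2, one_pos, one_lt_two⟩ with hχ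
  have hs : ContDiff ℝ ∞ (χ : Rn n → ℝ) := χ.contDiff
  set c : ℕ → ℝ := fun j => 1 / ((j : ℝ) + 1) with hc
  have hc0 : ∀ j, 0 < c j := fun j => by simp only [hc]; positivity
  have hc1 : ∀ j, c j ≤ 1 := fun j => by
    simp only [hc]; rw [div_le_one (by positivity)]; linarith [(Nat.cast_nonneg j : (0 : ℝ) ≤ j)]
  have hcs : ∀ j, ContDiff ℝ ∞ fun x : Rn n => χ (c j • x) := fun j =>
    hs.comp (contDiff_const_smul (c j))
  have hsm : ∀ j, ContDiff ℝ ∞ fun x => χ (c j • x) • φ x := fun j => (hcs j).smul (φ.smooth ⊤)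
  have hcomp : ∀ j, HasCompactSupport fun x : Rn n => χ (c j • x) := fun j =>
    χ.hasCompactSupport.comp_smul (hc0 j).ne'
  set ψ : ℕ → 𝓢(Rn n, ℂ) := fun j =>
    HasCompactSupport.toSchwartzMap (f := fun x => χ (c j • x) • φ x) ((hcomp j).smul_right) (hsm j)
    with hψ
  have hψa : ∀ j x, ψ j x = χ (c j • x) • φ x := fun j x => rfl
  refine ⟨ψ, fun j => (hcomp j).smul_right, ?_⟩
  rw [(schwartz_withSeminorms ℝ (Rn n) ℂ).tendsto_nhds]
  rintro ⟨m, p⟩ ε hε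
  choose B hB0 hB using fun i => exists_norm_iteratedFDeriv_cutoff_le χ rfl i
  set M : ℝ := ∑ i ∈ Finset.range (p + 1), (p.choose i : ℝ) * B i *
    (SchwartzMap.seminorm ℝ m (p - i) φ + SchwartzMap.seminorm ℝ (m + 1) (p - i) φ) with hM
  have hM0 : 0 ≤ M := Finset.sum_nonneg fun i _ =>
    mul_nonneg (mul_nonneg (Nat.cast_nonneg _) (hB0 i))
      (add_nonneg (apply_nonneg _ _) (apply_nonneg _ _))
  have hbound : ∀ j, SchwartzMap.seminorm ℝ m p (ψ j - φ) ≤ c j * M := by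
    intro j
    refine SchwartzMap.seminorm_le_bound ℝ m p _ (mul_nonneg (hc0 j).le hM0) fun x => ?_
    have e1 : ((ψ j - φ : 𝓢(Rn n, ℂ)) : Rn n → ℂ) = fun x => (χ (c j • x) - 1) • φ x := by
      funext x
      rw [sub_apply, hψa, sub_smul, one_smul]
    rw [e1]
    have h1 := norm_iteratedFDeriv_smul_le (𝕜 := ℝ) (N := ∞) (f := fun x : Rn n => χ (c j • x) - 1) (g := φ)
      ((hcs j).sub contDiff_const) (φ.smooth ⊤) x (n := p) (by exact_mod_cast le_top)
    refine (mul_le_mul_of_nonneg_left h1 (by positivity)).trans ?_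
    rw [hM, Finset.mul_sum, Finset.mul_sum]
    refine Finset.sum_le_sum fun i _ => ?_
    have h2 := hB i (c j) (hc0 j).le (hc1 j) x
    have h3 := SchwartzMap.le_seminorm ℝ m (p - i) φ x
    have h4 := SchwartzMap.le_seminorm ℝ (m + 1) (p - i) φ x
    calc ‖x‖ ^ m * ((p.choose i : ℝ) * ‖iteratedFDeriv ℝ i (fun x => χ (c j • x) - 1) x‖ *
          ‖iteratedFDeriv ℝ (p - i) φ x‖)
        ≤ ‖x‖ ^ m * ((p.choose i : ℝ) * (c j * B i * (1 + ‖x‖)) *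
          ‖iteratedFDeriv ℝ (p - i) φ x‖) := by gcongr
      _ = c j * ((p.choose i : ℝ) * B i) * (‖x‖ ^ m * ‖iteratedFDeriv ℝ (p - i) φ x‖ +
          ‖x‖ ^ (m + 1) * ‖iteratedFDeriv ℝ (p - i) φ x‖) := by ring
      _ ≤ c j * ((p.choose i : ℝ) * B i) * (SchwartzMap.seminorm ℝ m (p - i) φ +
          SchwartzMap.seminorm ℝ (m + 1) (p - i) φ) := by
            have := mul_nonneg (hc0 j).le (mul_nonneg (Nat.cast_nonneg (α := ℝ) (p.choose i)) (hB0 i))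
            gcongr
      _ = _ := by ring
  have hlim : Tendsto (fun j => c j * M) atTop (𝓝 0) := by
    simpa [hc] using (tendsto_one_div_add_atTop_nhds_zero_nat (𝕜 := ℝ)).mul_const M
  filter_upwards [hlim.eventually_lt_const hε] with j hj
  exact (hbound j).trans_lt hj

/-! ### Weighted Fourier norms of test functions -/

/-- The weight `1 + |2 π ξ|²`. -/
def fweight (ξ : Rn n) : ℝ := 1 + (2 * Real.pi * ‖ξ‖) ^ 2

lemma one_le_fweight (ξ : Rn n) : 1 ≤ fweight ξ := by
  unfold fweight; nlinarith [sq_nonneg (2 * Real.pi * ‖ξ‖)]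

lemma fweight_pos (ξ : Rn n) : 0 < fweight ξ := by linarith [one_le_fweight ξ]

lemma continuous_fweight : Continuous (fweight : Rn n → ℝ) := by unfold fweight; fun_prop

lemma hasTemperateGrowth_fweight : (fun ξ : Rn n => (fweight ξ : ℂ)).HasTemperateGrowth := by
  have h : (fun ξ : Rn n => (fweight ξ : ℂ)) =
      Complex.ofReal ∘ fun ξ : Rn n => 1 + (2 * Real.pi) ^ 2 * ‖ξ‖ ^ 2 := by
    funext ξ; rw [fweight, mul_pow]; rfl
  rw [h]
  exact Function.HasTemperateGrowth.comp Function.Complex.hasTemperateGrowth_ofReal (by fun_prop)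

lemma hasTemperateGrowth_fweight_inv (K : ℕ) :
    (fun ξ : Rn n => ((fweight ξ : ℂ) ^ K)⁻¹).HasTemperateGrowth := by
  have h : (fun ξ : Rn n => ((fweight ξ : ℂ) ^ K)⁻¹) =
      Complex.ofReal ∘ (fun ξ : Rn n => (1 + ‖ξ‖ ^ 2) ^ (-(K : ℝ))) ∘
        ((2 * Real.pi) • ContinuousLinearMap.id ℝ (Rn n)) := by
    funext ξ
    have h0 : (0 : ℝ) ≤ 2 * Real.pi := by positivity
    simp only [Function.comp, smul_apply, ContinuousLinearMap.id_apply, norm_smul,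
      Real.norm_of_nonneg h0]
    rw [Real.rpow_neg (by positivity), Real.rpow_natCast, fweight]
    push_cast
    rfl
  rw [h]
  exact Function.HasTemperateGrowth.comp Function.Complex.hasTemperateGrowth_ofReal
    ((Function.hasTemperateGrowth_one_add_norm_sq_rpow (Rn n) _).comp
      (ContinuousLinearMap.hasTemperateGrowth _))

lemma hasTemperateGrowth_fweight_pow (K : ℕ) :
    (fun ξ : Rn n => (fweight ξ : ℂ) ^ K).HasTemperateGrowth := hasTemperateGrowth_fweight.pow K

/-- `f ↦ (1 + |2 π ξ|²) ^ K 𝓕⁻ f` as an element of `L²`. -/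
def weightedFourierInv (K : ℕ) : 𝓢(Rn n, ℂ) →L[ℂ] Lp ℂ 2 (volume : Measure (Rn n)) :=
  (SchwartzMap.toLpCLM ℂ ℂ 2 volume).comp ((SchwartzMap.smulLeftCLM ℂ fun ξ => (fweight ξ : ℂ) ^ K).comp
    ((FourierTransform.fourierInvCLM ℂ 𝓢(Rn n, ℂ))))

lemma weightedFourierInv_ae (K : ℕ) (ψ : 𝓢(Rn n, ℂ)) :
    weightedFourierInv K ψ =ᵐ[volume] fun ξ => (fweight ξ : ℂ) ^ K * (𝓕⁻ ψ : 𝓢(Rn n, ℂ)) ξ := by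
  have h := SchwartzMap.coeFn_toLp (SchwartzMap.smulLeftCLM ℂ (fun ξ : Rn n => (fweight ξ : ℂ) ^ K)
    (𝓕⁻ ψ : 𝓢(Rn n, ℂ))) 2 volume
  refine h.trans (Eventually.of_forall fun ξ => ?_)
  rw [SchwartzMap.smulLeftCLM_apply_apply (hasTemperateGrowth_fweight_pow K)]
  simp

lemma denseRange_weightedFourierInv (K : ℕ) :
    DenseRange (weightedFourierInv (n := n) K) := by
  have h1 := SchwartzMap.denseRange_toLpCLM (E := Rn n) (F := ℂ) (p := 2) (by norm_num)
    (μ := volume)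
  refine Dense.mono ?_ h1
  rintro _ ⟨χ, rfl⟩
  refine ⟨𝓕 (SchwartzMap.smulLeftCLM ℂ (fun ξ : Rn n => ((fweight ξ : ℂ) ^ K)⁻¹) χ), ?_⟩
  have h3 := hasTemperateGrowth_fweight_inv (n := n) K
  simp only [weightedFourierInv, ContinuousLinearMap.comp_apply, SchwartzMap.toLpCLM_apply]
  congr 1
  ext ξ
  have e : (FourierTransform.fourierInvCLM ℂ 𝓢(Rn n, ℂ))
      (𝓕 (SchwartzMap.smulLeftCLM ℂ (fun ξ : Rn n => ((fweight ξ : ℂ) ^ K)⁻¹) χ)) =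
      SchwartzMap.smulLeftCLM ℂ (fun ξ : Rn n => ((fweight ξ : ℂ) ^ K)⁻¹) χ :=
    FourierTransform.fourierInv_fourier_eq (F := 𝓢(Rn n, ℂ)) _
  have h0 : (fweight ξ : ℂ) ≠ 0 := by exact_mod_cast (fweight_pos ξ).ne'
  rw [e, SchwartzMap.smulLeftCLM_apply_apply (hasTemperateGrowth_fweight_pow K),
    SchwartzMap.smulLeftCLM_apply_apply h3]
  rw [smul_smul, mul_inv_cancel₀ (pow_ne_zero _ h0), one_smul]

theorem exists_tendsto_weightedFourierInv (K : ℕ) (g : Lp ℂ 2 (volume : Measure (Rn n))) :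
    ∃ ψ : ℕ → 𝓢(Rn n, ℂ), (∀ j, HasCompactSupport (ψ j)) ∧
      Tendsto (fun j => weightedFourierInv K (ψ j)) atTop (𝓝 g) := by
  have h : g ∈ closure (weightedFourierInv (n := n) K '' {ψ | HasCompactSupport ψ}) := by
    have h1 : Dense {ψ : 𝓢(Rn n, ℂ) | HasCompactSupport ψ} := by
      intro φ
      obtain ⟨ψ, hψ, hlim⟩ := exists_tendsto_hasCompactSupport φ
      exact mem_closure_of_tendsto hlim (Eventually.of_forall hψ)
    exact (denseRange_weightedFourierInv K).dense_image (weightedFourierInv K).continuous h1 g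
  obtain ⟨x, hx, hlim⟩ := mem_closure_iff_seq_limit.1 h
  choose ψ hψ using hx
  refine ⟨ψ, fun j => (hψ j).1, ?_⟩
  simpa only [(hψ _).2] using hlim

end Density

/-! ### Weighted square integrable symbols -/

section Symbols

variable {n : ℕ}

/-- The frequency `2 π |ξ|`. -/
def freq (ξ : Rn n) : ℝ := 2 * Real.pi * ‖ξ‖

lemma freq_nonneg (ξ : Rn n) : 0 ≤ freq ξ := by unfold freq; positivity

lemma continuous_freq : Continuous (freq : Rn n → ℝ) := by unfold freq; fun_prop

lemma fweight_eq (ξ : Rn n) : fweight ξ = 1 + freq ξ ^ 2 := rfl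

lemma fourier_negLap (ψ : 𝓢(Rn n, ℂ)) (ξ : Rn n) :
    (𝓕 (negLap ψ) : 𝓢(Rn n, ℂ)) ξ = (freq ξ : ℂ) ^ 2 * (𝓕 ψ : 𝓢(Rn n, ℂ)) ξ := by
  have h1 : negLap ψ = ((2 * Real.pi) ^ 2 : ℝ) •
      (𝓕⁻ (SchwartzMap.smulLeftCLM ℂ (fun x : Rn n => ‖x‖ ^ 2) (𝓕 ψ)) : 𝓢(Rn n, ℂ)) := by
    ext x
    have e : negLap ψ = -Δ ψ := by
      ext x; rw [negLap_apply, ← SchwartzMap.laplacian_apply]; rfl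
    rw [e, SchwartzMap.laplacian_eq_fourierMultiplierCLM, SchwartzMap.fourierMultiplierCLM_apply]
    simp
  have h2 : (fun x : Rn n => ‖x‖ ^ 2).HasTemperateGrowth := by fun_prop
  rw [h1, FourierTransform.fourier_smul, FourierTransform.fourier_fourierInv_eq,
    smul_apply, SchwartzMap.smulLeftCLM_apply_apply h2, freq]
  simp only [Complex.real_smul]
  push_cast
  ring

lemma fourierInv_eq_fourier_neg (ψ : 𝓢(Rn n, ℂ)) (ξ : Rn n) :
    (𝓕⁻ ψ : 𝓢(Rn n, ℂ)) ξ = (𝓕 ψ : 𝓢(Rn n, ℂ)) (-ξ) := by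
  rw [SchwartzMap.fourierInv_coe, SchwartzMap.fourier_coe, Real.fourierInv_eq_fourier_neg]

lemma fourierInv_negLap_pow (ψ : 𝓢(Rn n, ℂ)) (q : ℕ) (ξ : Rn n) :
    (𝓕⁻ ((negLap ^ q) ψ) : 𝓢(Rn n, ℂ)) ξ =
      (freq ξ : ℂ) ^ (2 * q) * (𝓕⁻ ψ : 𝓢(Rn n, ℂ)) ξ := by
  induction q with
  | zero => simp
  | succ q ih =>
    rw [pow_succ', Module.End.mul_apply, fourierInv_eq_fourier_neg, fourier_negLap,
      ← fourierInv_eq_fourier_neg, ih]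
    simp only [freq, norm_neg]
    ring

lemma integral_mul_eq_integral_fourier_mul (g : Lp ℂ 2 (volume : Measure (Rn n)))
    (ψ : 𝓢(Rn n, ℂ)) :
    ∫ x, g x * ψ x = ∫ ξ, (𝓕 g : Lp ℂ 2 (volume : Measure (Rn n))) ξ * (𝓕⁻ ψ : 𝓢(Rn n, ℂ)) ξ := by
  have h := congrArg (fun d : 𝓢'(Rn n, ℂ) => d (𝓕⁻ ψ))
    (MeasureTheory.Lp.fourier_toTemperedDistribution_eq g)
  simp only [TemperedDistribution.fourier_apply, MeasureTheory.Lp.toTemperedDistribution_apply,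
    FourierTransform.fourier_fourierInv_eq, smul_eq_mul] at h
  simpa only [mul_comm] using h

/-- `(1 + |2 π ξ|²) ^ (-K) t` is square integrable. -/
def SymbolClass (K : ℕ) (t : Rn n → ℂ) : Prop :=
  MemLp (fun ξ => ((fweight ξ : ℂ) ^ K)⁻¹ * t ξ) 2 volume

lemma fweight_ne_zero (ξ : Rn n) : (fweight ξ : ℂ) ≠ 0 := by exact_mod_cast (fweight_pos ξ).ne'

lemma aestronglyMeasurable_fweight_pow (K : ℕ) :
    AEStronglyMeasurable (fun ξ : Rn n => (fweight ξ : ℂ) ^ K) volume :=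
  ((Complex.continuous_ofReal.comp continuous_fweight).pow K).aestronglyMeasurable

namespace SymbolClass

variable {K : ℕ} {s t : Rn n → ℂ}

lemma aestronglyMeasurable (h : SymbolClass K t) : AEStronglyMeasurable t volume := by
  have := (aestronglyMeasurable_fweight_pow K).mul h.1
  refine this.congr (Eventually.of_forall fun ξ => ?_)
  simp only [Pi.mul_apply]
  rw [← mul_assoc, mul_inv_cancel₀ (pow_ne_zero K (fweight_ne_zero ξ)), one_mul]

lemma freq_pow_mul (h : SymbolClass K t) {L : ℕ} (q : ℕ) (hL : K + q ≤ L) :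
    SymbolClass L fun ξ => (freq ξ : ℂ) ^ (2 * q) * t ξ := by
  refine h.mono ?_ (Eventually.of_forall fun ξ => ?_)
  · refine AEStronglyMeasurable.mul ?_ (AEStronglyMeasurable.mul ?_ h.aestronglyMeasurable)
    · refine Continuous.aestronglyMeasurable (Continuous.inv₀ ?_ fun ξ => pow_ne_zero _
        (fweight_ne_zero ξ))
      exact (Complex.continuous_ofReal.comp continuous_fweight).pow L
    · exact ((Complex.continuous_ofReal.comp continuous_freq).pow _).aestronglyMeasurable
  · simp only [norm_mul, norm_inv, norm_pow, Complex.norm_real,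
      Real.norm_of_nonneg (freq_nonneg ξ), Real.norm_of_nonneg (fweight_pos ξ).le]
    have hw := one_le_fweight ξ
    have hw0 := fweight_pos ξ
    have h1 : freq ξ ^ (2 * q) ≤ fweight ξ ^ q := by
      rw [pow_mul]
      exact pow_le_pow_left₀ (sq_nonneg _) (by rw [fweight_eq]; linarith) q
    have h2 : fweight ξ ^ (K + q) ≤ fweight ξ ^ L := pow_le_pow_right₀ hw hL
    rw [← mul_assoc]
    refine mul_le_mul_of_nonneg_right ?_ (norm_nonneg _)
    rw [inv_mul_le_iff₀ (by positivity), ← div_eq_mul_inv, le_div_iff₀ (by positivity)]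
    calc freq ξ ^ (2 * q) * fweight ξ ^ K ≤ fweight ξ ^ q * fweight ξ ^ K := by gcongr
      _ = fweight ξ ^ (K + q) := by ring
      _ ≤ _ := h2

lemma weaken (h : SymbolClass K t) {L : ℕ} (hL : K ≤ L) : SymbolClass L t := by
  simpa using h.freq_pow_mul 0 (by simpa using hL)

lemma const_mul (h : SymbolClass K t) (c : ℂ) : SymbolClass K fun ξ => c * t ξ := by
  refine (MemLp.const_mul h c).ae_eq (Eventually.of_forall fun ξ => ?_)
  simp only; ring

lemma add (hs : SymbolClass K s) (ht : SymbolClass K t) : SymbolClass K fun ξ => s ξ + t ξ := by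
  refine (MemLp.add hs ht).ae_eq (Eventually.of_forall fun ξ => ?_)
  simp only [Pi.add_apply]; ring

lemma sub (hs : SymbolClass K s) (ht : SymbolClass K t) : SymbolClass K fun ξ => s ξ - t ξ := by
  refine (MemLp.sub hs ht).ae_eq (Eventually.of_forall fun ξ => ?_)
  simp only [Pi.sub_apply]; ring

lemma zero (K : ℕ) : SymbolClass K (fun _ : Rn n => 0) := by
  simp [SymbolClass]

lemma sum {ι : Type*} {t : ι → Rn n → ℂ} (I : Finset ι) (ht : ∀ i ∈ I, SymbolClass K (t i)) :
    SymbolClass K fun ξ => ∑ i ∈ I, t i ξ := by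
  classical
  induction I using Finset.induction_on with
  | empty => simpa using zero K
  | insert i I hi ih =>
    simp only [Finset.sum_insert hi]
    exact (ht i (by simp)).add (ih fun j hj => ht j (by simp [hj]))

lemma integrable_mul (h : SymbolClass K t) {φ : Rn n → ℂ}
    (hφ : MemLp (fun ξ => (fweight ξ : ℂ) ^ K * φ ξ) 2 volume) :
    Integrable (fun ξ => t ξ * φ ξ) volume := by
  refine (MemLp.integrable_mul (p := 2) (q := 2) h hφ).congr (Eventually.of_forall fun ξ => ?_)
  have := pow_ne_zero K (fweight_ne_zero ξ)
  simp only [Pi.mul_apply]; field_simp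

lemma norm_integral_mul_le (h : SymbolClass K t) {φ : Rn n → ℂ}
    (hφ : MemLp (fun ξ => (fweight ξ : ℂ) ^ K * φ ξ) 2 volume) :
    ‖∫ ξ, t ξ * φ ξ‖ ≤ (eLpNorm (fun ξ => ((fweight ξ : ℂ) ^ K)⁻¹ * t ξ) 2 volume).toReal *
      (eLpNorm (fun ξ => (fweight ξ : ℂ) ^ K * φ ξ) 2 volume).toReal := by
  have e : ∀ ξ, t ξ * φ ξ =
      (((fweight ξ : ℂ) ^ K)⁻¹ * t ξ) • ((fweight ξ : ℂ) ^ K * φ ξ) := fun ξ => by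
    have := pow_ne_zero K (fweight_ne_zero ξ)
    rw [smul_eq_mul]; field_simp
  have h1 : eLpNorm (fun ξ => t ξ * φ ξ) 1 volume ≤
      eLpNorm (fun ξ => ((fweight ξ : ℂ) ^ K)⁻¹ * t ξ) 2 volume *
        eLpNorm (fun ξ => (fweight ξ : ℂ) ^ K * φ ξ) 2 volume := by
    have h2 := eLpNorm_smul_le_mul_eLpNorm (p := 2) (q := 2) (r := 1) hφ.1 h.1
    refine le_trans (eLpNorm_congr_ae (Eventually.of_forall fun ξ => ?_)).le h2
    exact e ξ
  rw [← ENNReal.toReal_mul]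
  refine le_trans ?_ (ENNReal.toReal_mono (ENNReal.mul_ne_top h.2.ne hφ.2.ne) h1)
  rw [eLpNorm_one_eq_lintegral_enorm]
  refine (norm_integral_le_integral_norm _).trans_eq ?_
  rw [integral_norm_eq_lintegral_enorm (h.integrable_mul hφ).1]

end SymbolClass

lemma memLp_fourierInv (K : ℕ) (ψ : 𝓢(Rn n, ℂ)) :
    MemLp (fun ξ => (fweight ξ : ℂ) ^ K * (𝓕⁻ ψ : 𝓢(Rn n, ℂ)) ξ) 2 volume :=
  (Lp.memLp (weightedFourierInv K ψ)).ae_eq (weightedFourierInv_ae K ψ)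

lemma toReal_eLpNorm_fourierInv (K : ℕ) (ψ : 𝓢(Rn n, ℂ)) :
    (eLpNorm (fun ξ => (fweight ξ : ℂ) ^ K * (𝓕⁻ ψ : 𝓢(Rn n, ℂ)) ξ) 2 volume).toReal =
      ‖weightedFourierInv K ψ‖ := by
  rw [Lp.norm_def, eLpNorm_congr_ae (weightedFourierInv_ae K ψ)]

lemma norm_weightedFourierInv_negLap_le {K L : ℕ} (q : ℕ) (h : K + q ≤ L) (ψ : 𝓢(Rn n, ℂ)) :
    ‖weightedFourierInv K ((negLap ^ q) ψ)‖ ≤ ‖weightedFourierInv L ψ‖ := by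
  refine Lp.norm_le_norm_of_ae_le ?_
  filter_upwards [weightedFourierInv_ae K ((negLap ^ q) ψ), weightedFourierInv_ae L ψ] with ξ h1 h2
  rw [h1, h2, fourierInv_negLap_pow, ← mul_assoc]
  simp only [norm_mul, norm_pow, Complex.norm_real,
      Real.norm_of_nonneg (freq_nonneg ξ), Real.norm_of_nonneg (fweight_pos ξ).le]
  have hw := one_le_fweight ξ
  have hw0 := fweight_pos ξ
  refine mul_le_mul_of_nonneg_right ?_ (norm_nonneg _)
  calc fweight ξ ^ K * freq ξ ^ (2 * q) ≤ fweight ξ ^ K * fweight ξ ^ q := by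
        rw [pow_mul]
        gcongr
        rw [fweight_eq]; linarith
    _ = fweight ξ ^ (K + q) := by ring
    _ ≤ _ := pow_le_pow_right₀ hw h

lemma norm_weightedFourierInv_mono {K L : ℕ} (h : K ≤ L) (ψ : 𝓢(Rn n, ℂ)) :
    ‖weightedFourierInv K ψ‖ ≤ ‖weightedFourierInv L ψ‖ := by
  simpa using norm_weightedFourierInv_negLap_le (K := K) (L := L) 0 (by simpa using h) ψ

/-- Compactly supported Schwartz functions, i.e. test functions. -/
def testFun (n : ℕ) : Submodule ℂ 𝓢(Rn n, ℂ) where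
  carrier := {ψ | HasCompactSupport ψ}
  add_mem' h1 h2 := HasCompactSupport.add h1 h2
  zero_mem' := HasCompactSupport.zero
  smul_mem' c _ h := HasCompactSupport.smul_left (f := fun _ => c) h

/-- A linear functional on test functions which is bounded in a weighted norm has a symbol. -/
theorem exists_symbol {τ : 𝓢(Rn n, ℂ) → ℂ} {K : ℕ} {C : ℝ}
    (hlin : ∀ (c : ℂ) (ψ χ : 𝓢(Rn n, ℂ)), HasCompactSupport ψ → HasCompactSupport χ →
      τ (c • ψ + χ) = c * τ ψ + τ χ)
    (hτ : ∀ ψ : 𝓢(Rn n, ℂ), HasCompactSupport ψ → ‖τ ψ‖ ≤ C * ‖weightedFourierInv K ψ‖) :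
    ∃ t, SymbolClass K t ∧ ∀ ψ : 𝓢(Rn n, ℂ), HasCompactSupport ψ →
      τ ψ = ∫ ξ, t ξ * (𝓕⁻ ψ : 𝓢(Rn n, ℂ)) ξ := by
  have h0 : τ 0 = 0 := by
    have := hlin 1 0 0 HasCompactSupport.zero HasCompactSupport.zero
    simpa using this
  let f : testFun n →ₗ[ℂ] ℂ :=
    { toFun := fun ψ => τ ψ
      map_add' := fun ψ χ => by simpa using hlin 1 ψ χ ψ.2 χ.2
      map_smul' := fun c ψ => by simpa [h0] using hlin c ψ 0 ψ.2 HasCompactSupport.zero }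
  let e : testFun n →ₗ[ℂ] Lp ℂ 2 (volume : Measure (Rn n)) :=
    (weightedFourierInv K).toLinearMap.comp (testFun n).subtype
  have hd : DenseRange e := fun g => by
    obtain ⟨ψ, hψ, hlim⟩ := exists_tendsto_weightedFourierInv K g
    exact mem_closure_of_tendsto hlim (Eventually.of_forall fun j => ⟨⟨ψ j, hψ j⟩, rfl⟩)
  let T := f.extendOfNorm e
  have hT : ∀ ψ : 𝓢(Rn n, ℂ), HasCompactSupport ψ → T (weightedFourierInv K ψ) = τ ψ :=
    fun ψ hψ => LinearMap.extendOfNorm_eq (f := f) hd ⟨C, fun x => hτ x x.2⟩ ⟨ψ, hψ⟩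
  -- Riesz representation of the bounded extension. The inner product is conjugate linear in its
  -- first argument, so the symbol is the conjugate of `g` times the weight.
  set g := (InnerProductSpace.toDual ℂ (Lp ℂ 2 (volume : Measure (Rn n)))).symm T with hg
  have hconj : MemLp (fun ξ => (starRingEnd ℂ) (g ξ)) 2 volume := (Lp.memLp g).star
  refine ⟨fun ξ => (fweight ξ : ℂ) ^ K * (starRingEnd ℂ) (g ξ), ?_, fun ψ hψ => ?_⟩
  · refine hconj.ae_eq (Eventually.of_forall fun ξ => ?_)
    have := pow_ne_zero K (fweight_ne_zero ξ)
    simp only; field_simp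
  · rw [← hT ψ hψ, ← InnerProductSpace.toDual_symm_apply, L2.inner_def]
    refine integral_congr_ae ?_
    filter_upwards [weightedFourierInv_ae K ψ] with ξ h
    rw [h, RCLike.inner_apply, ← hg]
    ring

/-- By Cauchy–Schwarz the pairing is continuous in the weighted norm. Identities known for test
functions thereby extend to arbitrary weighted `L²` functions on the Fourier side, in particular to
cutoffs to compact sets. -/
theorem tendsto_integral_symbol_mul {K : ℕ} {t φ : Rn n → ℂ} (ht : SymbolClass K t)
    (hφ : MemLp (fun ξ => (fweight ξ : ℂ) ^ K * φ ξ) 2 volume) {ψ : ℕ → 𝓢(Rn n, ℂ)}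
    (hψ : Tendsto (fun j => weightedFourierInv K (ψ j)) atTop (𝓝 hφ.toLp)) :
    Tendsto (fun j => ∫ ξ, t ξ * (𝓕⁻ (ψ j) : 𝓢(Rn n, ℂ)) ξ) atTop (𝓝 (∫ ξ, t ξ * φ ξ)) := by
  have hb : ∀ j, ‖(∫ ξ, t ξ * (𝓕⁻ (ψ j) : 𝓢(Rn n, ℂ)) ξ) - ∫ ξ, t ξ * φ ξ‖ ≤
      (eLpNorm (fun ξ => ((fweight ξ : ℂ) ^ K)⁻¹ * t ξ) 2 volume).toReal *
        ‖weightedFourierInv K (ψ j) - hφ.toLp‖ := fun j => by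
    have e : (fun ξ => (fweight ξ : ℂ) ^ K * ((𝓕⁻ (ψ j) : 𝓢(Rn n, ℂ)) ξ - φ ξ)) =ᵐ[volume]
        (weightedFourierInv K (ψ j) - hφ.toLp : Lp ℂ 2 (volume : Measure (Rn n))) := by
      filter_upwards [weightedFourierInv_ae K (ψ j), hφ.coeFn_toLp,
        Lp.coeFn_sub (weightedFourierInv K (ψ j)) hφ.toLp] with ξ h1 h2 h3
      rw [h3, Pi.sub_apply, h1, h2]; ring
    have h1 := ht.norm_integral_mul_le (φ := fun ξ => (𝓕⁻ (ψ j) : 𝓢(Rn n, ℂ)) ξ - φ ξ)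
      ((Lp.memLp _).ae_eq e.symm)
    rw [eLpNorm_congr_ae e, ← Lp.norm_def] at h1
    rwa [← integral_sub (ht.integrable_mul (memLp_fourierInv K _)) (ht.integrable_mul hφ),
      integral_congr_ae (Eventually.of_forall fun ξ => (mul_sub _ _ _).symm)]
  rw [tendsto_iff_norm_sub_tendsto_zero]
  refine squeeze_zero (fun _ => norm_nonneg _) hb ?_
  simpa using (tendsto_iff_norm_sub_tendsto_zero.1 hψ).const_mul
    (eLpNorm (fun ξ => ((fweight ξ : ℂ) ^ K)⁻¹ * t ξ) 2 volume).toReal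

lemma memLp_fweight_mul_indicator (K : ℕ) {B : Set (Rn n)} (hB : IsCompact B) {φ : Rn n → ℂ}
    (hφ : Continuous φ) :
    MemLp (fun ξ => (fweight ξ : ℂ) ^ K * B.indicator φ ξ) 2 volume := by
  have h : Continuous fun ξ : Rn n => (fweight ξ : ℂ) ^ K * φ ξ :=
    ((Complex.continuous_ofReal.comp continuous_fweight).pow K).mul hφ
  have h1 : (fun ξ => (fweight ξ : ℂ) ^ K * B.indicator φ ξ) =
      B.indicator fun ξ => (fweight ξ : ℂ) ^ K * φ ξ := by
    funext ξ; by_cases hξ : ξ ∈ B <;> simp [hξ]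
  rw [h1, memLp_indicator_iff_restrict hB.measurableSet]
  have : IsFiniteMeasure (volume.restrict B) := ⟨by simpa using hB.measure_lt_top⟩
  obtain ⟨C, hC⟩ := hB.exists_bound_of_continuousOn h.continuousOn
  exact MemLp.of_bound h.aestronglyMeasurable C
    ((ae_restrict_iff' hB.measurableSet).2 (Eventually.of_forall hC))

/-- A symbol which vanishes on all test functions is zero. -/
theorem SymbolClass.ae_eq_zero {K : ℕ} {t : Rn n → ℂ} (ht : SymbolClass K t)
    (h : ∀ ψ : 𝓢(Rn n, ℂ), HasCompactSupport ψ → ∫ ξ, t ξ * (𝓕⁻ ψ : 𝓢(Rn n, ℂ)) ξ = 0) :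
    t =ᵐ[volume] 0 := by
  have key : ∀ B : Set (Rn n), IsCompact B → ∫ ξ, t ξ * B.indicator (fun _ => (1:ℂ)) ξ = 0 := by
    intro B hB
    have hφ := memLp_fweight_mul_indicator K hB (φ := fun _ => (1 : ℂ)) continuous_const
    obtain ⟨ψ, hψ, hlim⟩ := exists_tendsto_weightedFourierInv K hφ.toLp
    refine tendsto_nhds_unique (tendsto_integral_symbol_mul ht hφ hlim) ?_
    simp only [h _ (hψ _), tendsto_const_nhds]
  have e : ∀ B : Set (Rn n), (fun ξ => t ξ * B.indicator (fun _ => (1:ℂ)) ξ) = B.indicator t := by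
    intro B; funext ξ; by_cases hξ : ξ ∈ B <;> simp [hξ]
  refine ae_eq_zero_of_forall_setIntegral_isCompact_eq_zero' ?_ fun B hB => ?_
  · rw [locallyIntegrable_iff]
    intro B hB
    have := ht.integrable_mul
      (memLp_fweight_mul_indicator K hB (φ := fun _ => (1 : ℂ)) continuous_const)
    rwa [e, integrable_indicator_iff hB.measurableSet] at this
  · rw [← integral_indicator hB.measurableSet, ← e, key B hB]

end Symbols

/-! ### Coefficients of sums of powers -/

section Coefficients

lemma normalInv_pow_powLoc (a : UnitExp) {b : ℝ} (hb : 0 ≤ b) (m i : ℕ) :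
    (normalInv a ^ i) (powLoc a hb m) = powLoc a hb (m + i) := by
  induction i with
  | zero => rfl
  | succ i ih => rw [pow_succ', Module.End.mul_apply, ih, normalInv_powLoc, add_assoc]

/-- The coefficients of the normalized powers in the source of the iterated equation. -/
def srcCoeff (k : ℕ) (t : ℕ → ℕ → ℂ) (m : ℕ) : ℂ :=
  ∑ i ∈ Finset.range (m + 1), ((-1) ^ (m - i) * (k - 1 - i).choose (m - i) : ℂ) * t i (m - i)

/-- Expand `(1 - X)^(k-1-i)`; each `T⁻¹` raises the normalized power by one, so collecting the terms
with `i + q = m` gives a finite sum of powers. -/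
theorem source_apply (a : UnitExp) (k : ℕ) (t s : ℕ → ℕ → ℂ) (l : ℕ) {y : ℝ} (hy : 0 < y) :
    (((∑ i ∈ Finset.range k, (invSeq a ^ i) (((1 - invShift a) ^ (k - 1 - i)) (srcSeq a t s i))) l :
      LocBdd) : ℝ → ℂ) y = ∑ m ∈ Finset.range k,
        (srcCoeff k (fun i q => t i (l + q)) m * (powFun a 0 m y : ℂ) +
          srcCoeff k (fun i q => s i (l + q)) m * (powFun a (2 * a) m y : ℂ)) := by
  have h1 : ∀ i ∈ Finset.range k,
      (((invSeq a ^ i) (((1 - invShift a) ^ (k - 1 - i)) (srcSeq a t s i)) l : LocBdd) : ℝ → ℂ) y =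
      ∑ q ∈ Finset.range (k - i), ((-1) ^ q * (k - 1 - i).choose q : ℂ) *
        (t i (l + q) * (powFun a 0 (i + q) y : ℂ) +
          s i (l + q) * (powFun a (2 * a) (i + q) y : ℂ)) := by
    intro i hi
    rw [invSeq_pow_apply, one_sub_invShift_pow_apply, map_sum,
      show k - 1 - i + 1 = k - i by have := Finset.mem_range.1 hi; omega]
    simp only [map_smul, srcSeq, map_add, normalInv_pow_powLoc]
    rw [Submodule.coe_sum, Finset.sum_apply]
    refine Finset.sum_congr rfl fun q _ => ?_
    simp only [Submodule.coe_smul, Submodule.coe_add, Pi.smul_apply, Pi.add_apply, smul_eq_mul,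
      powLoc_apply a _ _ hy, zero_add, add_comm q i]
  rw [Finset.sum_apply, Submodule.coe_sum, Finset.sum_apply, Finset.sum_congr rfl h1,
    ← Finset.sum_range_diag_flip k fun i q => ((-1) ^ q * (k - 1 - i).choose q : ℂ) *
        (t i (l + q) * (powFun a 0 (i + q) y : ℂ) +
          s i (l + q) * (powFun a (2 * a) (i + q) y : ℂ))]
  refine Finset.sum_congr rfl fun m _ => ?_
  rw [srcCoeff, srcCoeff, Finset.sum_mul, Finset.sum_mul, ← Finset.sum_add_distrib]
  refine Finset.sum_congr rfl fun i hi => ?_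
  rw [show i + (m - i) = m by have := Finset.mem_range.1 hi; omega]
  ring

/-- The polynomial is the Lagrange basis polynomial of the nodes. Its coefficients, applied to the
power sums, isolate one amplitude by a formula independent of the amplitudes. -/
lemma exists_polynomial_extract {ι : Type*} [DecidableEq ι] (I : Finset ι) (g : ι → ℝ)
    (hg : Set.InjOn g I) {i : ι} (hi : i ∈ I) :
    ∃ p : Polynomial ℝ, ∀ A : ι → ℂ,
      ∑ r ∈ p.support, (p.coeff r : ℂ) * ∑ j ∈ I, A j * ((g j ^ r : ℝ) : ℂ) = A i := by
  refine ⟨Lagrange.basis I g i, fun A => ?_⟩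
  have h : ∀ j ∈ I, A j * (((Lagrange.basis I g i).eval (g j) : ℝ) : ℂ) = if j = i then A j else 0 := by
    intro j hj
    split_ifs with hij
    · subst hij; rw [Lagrange.eval_basis_self hg hi]; simp
    · rw [Lagrange.eval_basis_of_ne (Ne.symm hij) hj]; simp
  rw [← Finset.sum_ite_eq' I i A |>.trans (if_pos hi), ← Finset.sum_congr rfl h]
  simp only [Finset.mul_sum]
  rw [Finset.sum_comm]
  refine Finset.sum_congr rfl fun j _ => ?_
  rw [Polynomial.eval_eq_sum, Polynomial.sum_def]
  push_cast
  rw [Finset.mul_sum]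
  exact Finset.sum_congr rfl fun r _ => by ring

/-- The bases of the geometric sequences obtained by evaluating powers at `2 ^ r`. -/
def node (a : ℝ) : ℕ ⊕ ℕ → ℝ :=
  Sum.elim (fun m => (2 : ℝ) ^ (2 * m : ℝ)) fun m => (2 : ℝ) ^ (2 * a + 2 * m : ℝ)

lemma node_injective (a : UnitExp) : Function.Injective (node a) := by
  have h2 : ∀ {x y : ℝ}, (2 : ℝ) ^ x = 2 ^ y → x = y := fun {x y} h =>
    (Real.rpow_right_inj (by norm_num) (by norm_num)).1 h
  have ha := a.2.1
  have ha1 := a.2.2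
  have hne : ∀ m m' : ℕ, (2 * m : ℝ) ≠ 2 * a + 2 * m' := by
    intro m m' h
    have h1 : ((m : ℤ) - m' : ℤ) = (a : ℝ) := by push_cast; linarith
    have h3 : (0 : ℤ) < (m : ℤ) - m' := by
      have : (0 : ℝ) < (((m : ℤ) - m' : ℤ) : ℝ) := by rw [h1]; exact ha
      exact_mod_cast this
    have h4 : (m : ℤ) - m' < 1 := by
      have : (((m : ℤ) - m' : ℤ) : ℝ) < 1 := by rw [h1]; exact ha1
      exact_mod_cast this
    omega
  rintro (m | m) (m' | m') h <;> have h := h2 h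
  · have : (m : ℝ) = m' := by linarith
    exact congrArg _ (by exact_mod_cast this)
  · exact absurd h (hne _ _)
  · exact absurd h.symm (hne _ _)
  · have : (m : ℝ) = m' := by linarith
    exact congrArg _ (by exact_mod_cast this)

variable {X : Type*}

/-- If sums of powers are bounded at each point, uniformly in a parameter, then so are the
coefficients. -/
theorem exists_norm_coeff_le (a : UnitExp) (k : ℕ) {A B : ℕ → X → ℂ} {N : X → ℝ}
    (h : ∀ y : ℝ, 0 < y → ∃ D : ℝ, ∀ x, ‖∑ m ∈ Finset.range k, (A m x * (powFun a 0 m y : ℂ) +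
      B m x * (powFun a (2 * a) m y : ℂ))‖ ≤ D * N x) {m : ℕ} (hm : m < k) :
    (∃ D : ℝ, ∀ x, ‖A m x‖ ≤ D * N x) ∧ ∃ D : ℝ, ∀ x, ‖B m x‖ ≤ D * N x := by
  set I := (Finset.range k).disjSum (Finset.range k) with hI
  set E : X → ℕ ⊕ ℕ → ℂ := fun x => Sum.elim (fun m => A m x * ((powConst a 0 m : ℝ) : ℂ)⁻¹)
    fun m => B m x * ((powConst a (2 * a) m : ℝ) : ℂ)⁻¹ with hE
  have hpow : ∀ (b : ℝ) (m r : ℕ), powFun a b m (2 ^ r) =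
      (powConst a b m)⁻¹ * ((2 : ℝ) ^ (b + 2 * m : ℝ)) ^ r := by
    intro b m r
    rw [powFun, ← Real.rpow_natCast, ← Real.rpow_mul (by norm_num), ← Real.rpow_natCast,
      ← Real.rpow_mul (by norm_num), mul_comm (r : ℝ), div_eq_inv_mul]
  -- At `y = 2^r` each power of `y` becomes a geometric sequence in `r`. The bases are distinct
  -- because `a` is not an integer.
  have hval : ∀ x (r : ℕ), ∑ m ∈ Finset.range k, (A m x * (powFun a 0 m (2 ^ r) : ℂ) +
      B m x * (powFun a (2 * a) m (2 ^ r) : ℂ)) = ∑ j ∈ I, E x j * ((node a j ^ r : ℝ) : ℂ) := by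
    intro x r
    rw [hI, Finset.sum_disjSum, ← Finset.sum_add_distrib]
    refine Finset.sum_congr rfl fun m _ => ?_
    simp only [hE, node, Sum.elim_inl, Sum.elim_inr, hpow]
    push_cast
    rw [zero_add]
    ring
  have key : ∀ j ∈ I, ∃ D : ℝ, ∀ x, ‖E x j‖ ≤ D * N x := by
    intro j hj
    obtain ⟨p, hp⟩ := exists_polynomial_extract I (node a) (node_injective a).injOn hj
    choose D hD using fun r : ℕ => h (2 ^ r) (by positivity)
    refine ⟨∑ r ∈ p.support, |p.coeff r| * D r, fun x => ?_⟩
    rw [← hp (E x), Finset.sum_mul]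
    refine (norm_sum_le _ _).trans (Finset.sum_le_sum fun r _ => ?_)
    rw [norm_mul, Complex.norm_real, Real.norm_eq_abs, mul_assoc, ← hval]
    exact mul_le_mul_of_nonneg_left (hD r x) (abs_nonneg _)
  have fin : ∀ (c : ℝ) (z : X → ℂ), 0 < c → (∃ D : ℝ, ∀ x, ‖z x * (c : ℂ)⁻¹‖ ≤ D * N x) →
      ∃ D : ℝ, ∀ x, ‖z x‖ ≤ D * N x := by
    rintro c z hc ⟨D, hD⟩
    refine ⟨D * c, fun x => ?_⟩
    have := hD x
    rw [norm_mul, norm_inv, Complex.norm_real, Real.norm_of_nonneg hc.le,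
      ← div_eq_mul_inv, div_le_iff₀ hc] at this
    linarith
  exact ⟨fin _ _ (powConst_pos a.2.1 a.2.2 le_rfl m) (key (Sum.inl m) (by simp [hI, hm])),
    fin _ _ (powConst_pos a.2.1 a.2.2 (two_mul_nonneg a) m) (key (Sum.inr m) (by simp [hI, hm]))⟩

end Coefficients

/-! ### The symbols of the boundary traces -/

section TraceSymbols

variable {n : ℕ} {V F G : Rn n → ℝ → ℂ}

open scoped Classical in
/-- The Fourier transform of `V(·, y)`. -/
def sliceFourier (V : Rn n → ℝ → ℂ) (y : ℝ) : Rn n → ℂ :=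
  if h : MemLp (fun x => V x y) 2 volume then
    (𝓕 (h.toLp : Lp ℂ 2 (volume : Measure (Rn n))) : Lp ℂ 2 (volume : Measure (Rn n))) else 0

lemma memLp_sliceFourier (V : Rn n → ℝ → ℂ) (y : ℝ) : MemLp (sliceFourier V y) 2 volume := by
  unfold sliceFourier
  split_ifs with h
  · exact Lp.memLp _
  · exact MemLp.zero

lemma eLpNorm_sliceFourier {y : ℝ} (h : MemLp (fun x => V x y) 2 volume) :
    eLpNorm (sliceFourier V y) 2 volume = eLpNorm (fun x => V x y) 2 volume := by
  have h1 := Lp.norm_fourier_eq (h.toLp : Lp ℂ 2 (volume : Measure (Rn n)))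
  rw [Lp.norm_def, Lp.norm_toLp,
    ENNReal.toReal_eq_toReal_iff' (Lp.memLp _).eLpNorm_ne_top h.eLpNorm_ne_top] at h1
  rw [sliceFourier, dif_pos h, h1]

lemma integral_slice_mul {y : ℝ} (h : MemLp (fun x => V x y) 2 volume) (ψ : 𝓢(Rn n, ℂ)) :
    ∫ x, V x y * ψ x = ∫ ξ, sliceFourier V y ξ * (𝓕⁻ ψ : 𝓢(Rn n, ℂ)) ξ := by
  rw [sliceFourier, dif_pos h, ← integral_mul_eq_integral_fourier_mul]
  refine integral_congr_ae ?_
  filter_upwards [h.coeFn_toLp] with x hx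
  rw [hx]

lemma symbolClass_of_memLp {t : Rn n → ℂ} (ht : MemLp t 2 volume) : SymbolClass 0 t := by
  simpa [SymbolClass] using ht

lemma symbolClass_sliceFourier (V : Rn n → ℝ → ℂ) (K : ℕ) (y : ℝ) :
    SymbolClass K (sliceFourier V y) :=
  (symbolClass_of_memLp (memLp_sliceFourier V y)).weaken (Nat.zero_le K)

/-- Bounds of functionals in terms of weighted norms of the Fourier transform. -/
def WeightBounded (τ : 𝓢(Rn n, ℂ) → ℂ) : Prop :=
  ∃ (K : ℕ) (C : ℝ), 0 ≤ C ∧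
    ∀ ψ : 𝓢(Rn n, ℂ), HasCompactSupport ψ → ‖τ ψ‖ ≤ C * ‖weightedFourierInv K ψ‖

namespace WeightBounded

variable {τ σ : 𝓢(Rn n, ℂ) → ℂ}

lemma zero : WeightBounded (fun _ : 𝓢(Rn n, ℂ) => 0) := ⟨0, 0, le_rfl, fun ψ _ => by simp⟩

lemma add (h : WeightBounded τ) (h' : WeightBounded σ) : WeightBounded fun ψ => τ ψ + σ ψ := by
  obtain ⟨K, C, hC, hb⟩ := h
  obtain ⟨K', C', hC', hb'⟩ := h'
  refine ⟨K + K', C + C', by positivity, fun ψ hψ => (norm_add_le _ _).trans ?_⟩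
  rw [add_mul]
  exact add_le_add
    ((hb ψ hψ).trans (mul_le_mul_of_nonneg_left (norm_weightedFourierInv_mono (by omega) ψ) hC))
    ((hb' ψ hψ).trans (mul_le_mul_of_nonneg_left (norm_weightedFourierInv_mono (by omega) ψ) hC'))

lemma const_mul (h : WeightBounded τ) (c : ℂ) : WeightBounded fun ψ => c * τ ψ := by
  obtain ⟨K, C, hC, hb⟩ := h
  refine ⟨K, ‖c‖ * C, by positivity, fun ψ hψ => ?_⟩
  rw [norm_mul, mul_assoc]
  exact mul_le_mul_of_nonneg_left (hb ψ hψ) (norm_nonneg c)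

lemma sum {ι : Type*} {τ : ι → 𝓢(Rn n, ℂ) → ℂ} (I : Finset ι)
    (h : ∀ i ∈ I, WeightBounded (τ i)) : WeightBounded fun ψ => ∑ i ∈ I, τ i ψ := by
  classical
  induction I using Finset.induction_on with
  | empty => simpa using zero
  | insert i I hi ih =>
    simp only [Finset.sum_insert hi]
    exact (h i (by simp)).add (ih fun j hj => h j (by simp [hj]))

lemma comp_negLap (h : WeightBounded τ) (q : ℕ) : WeightBounded fun ψ => τ ((negLap ^ q) ψ) := by
  obtain ⟨K, C, hC, hb⟩ := h
  exact ⟨K + q, C, hC, fun ψ hψ => (hb _ (hasCompactSupport_negLap_iterate hψ q)).trans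
    (mul_le_mul_of_nonneg_left (norm_weightedFourierInv_negLap_le q le_rfl ψ) hC)⟩

/-- The system is triangular: the `m`-th source coefficient is `τ m ψ`, with coefficient `1`, plus
earlier functionals evaluated at powers of `-Δ` applied to `ψ`, which cost only a larger weight. -/
lemma of_srcCoeff {k : ℕ} {τ : ℕ → 𝓢(Rn n, ℂ) → ℂ}
    (h : ∀ m < k, WeightBounded fun ψ => srcCoeff k (fun i q => τ i ((negLap ^ q) ψ)) m) :
    ∀ m < k, WeightBounded (τ m) := by
  intro m
  induction m using Nat.strong_induction_on with
  | _ m ih =>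
    intro hm
    have h1 := (h m hm).add (WeightBounded.const_mul (sum (Finset.range m) fun i hi =>
      ((ih i (Finset.mem_range.1 hi) ((Finset.mem_range.1 hi).trans hm)).comp_negLap
        (m - i)).const_mul ((-1) ^ (m - i) * (k - 1 - i).choose (m - i) : ℂ)) (-1))
    convert h1 using 2 with ψ
    rw [srcCoeff, Finset.sum_range_succ]
    simp

end WeightBounded

lemma HasModerateL2Growth.exists_norm_integral_le (h : HasModerateL2Growth V) :
    ∃ (C : ℝ) (P : ℕ), 0 ≤ C ∧ ∀ y : ℝ, 0 < y → ∀ φ : Rn n → ℂ, MemLp φ 2 volume →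
      ‖∫ ξ, sliceFourier V y ξ * φ ξ‖ ≤ C * (1 + y) ^ P * (eLpNorm φ 2 volume).toReal := by
  obtain ⟨C, P, hC⟩ := h
  refine ⟨|C|, P, abs_nonneg C, fun y hy φ hφ => ?_⟩
  have h1 := (symbolClass_sliceFourier V 0 y).norm_integral_mul_le (φ := φ) (by simpa using hφ)
  simp only [pow_zero, inv_one, one_mul] at h1
  refine h1.trans (mul_le_mul_of_nonneg_right ?_ ENNReal.toReal_nonneg)
  rw [eLpNorm_sliceFourier (hC y hy).1]
  refine (ENNReal.toReal_mono ENNReal.ofReal_ne_top (hC y hy).2).trans ?_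
  rw [ENNReal.toReal_ofReal']
  have : 0 ≤ (1 + y) ^ P := by positivity
  refine max_le (mul_le_mul_of_nonneg_right (le_abs_self C) this) (by positivity)

lemma HasModerateL2Growth.memLp (h : HasModerateL2Growth V) {y : ℝ} (hy : 0 < y) :
    MemLp (fun x => V x y) 2 volume := by
  obtain ⟨C, P, hC⟩ := h
  exact (hC y hy).1

variable {a : UnitExp}

/-- The traces of `Δ_m ^ i V`, tested against `ψ`, are linear in `ψ`. -/
lemma IsSmoothPair.jetTower_linear (h : IsSmoothPair a V F G) (i : ℕ) (c : ℂ) {ψ χ : 𝓢(Rn n, ℂ)}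
    (hψ : HasCompactSupport ψ) (hχ : HasCompactSupport χ) :
    jetTower (1 - 2 * (a : ℝ)) F i (c • ψ + χ) 0 0 =
      c * jetTower (1 - 2 * (a : ℝ)) F i ψ 0 0 + jetTower (1 - 2 * (a : ℝ)) F i χ 0 0 ∧
    jetTower (1 + 2 * (a : ℝ)) G i (c • ψ + χ) 0 0 =
      c * jetTower (1 + 2 * (a : ℝ)) G i ψ 0 0 + jetTower (1 + 2 * (a : ℝ)) G i χ 0 0 := by
  have hsum : HasCompactSupport ((c • ψ + χ : 𝓢(Rn n, ℂ)) : Rn n → ℂ) :=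
    (testFun n).add_mem ((testFun n).smul_mem c hψ) hχ
  have j1 := h.isJetPair_jetTower i hψ
  have j2 := h.isJetPair_jetTower i hχ
  have j3 := h.isJetPair_jetTower i hsum
  set W := (weightedLaplacian (1 - 2 * (a : ℝ)))^[i] V with hW
  have hlin : ∀ y, 0 < y → ∫ x, W x y * (c • ψ + χ : 𝓢(Rn n, ℂ)) x =
      c * (∫ x, W x y * ψ x) + ∫ x, W x y * χ x := by
    intro y hy
    have hsm := h.smoothInterior.weightedLaplacian_iterate (1 - 2 * (a : ℝ)) i
    have i1 := hsm.integrable hy ψ.continuous hψ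
    have i2 := hsm.integrable hy χ.continuous hχ
    rw [← integral_const_mul, ← integral_add (i1.const_mul c) i2]
    refine integral_congr_ae (Eventually.of_forall fun x => ?_)
    simp only [add_apply, smul_apply, smul_eq_mul]
    ring
  constructor
  · refine tendsto_nhds_unique (j3.tendsto a.2.1)
      ((((j1.tendsto a.2.1).const_mul c).add (j2.tendsto a.2.1)).congr' ?_)
    filter_upwards [self_mem_nhdsWithin] with y hy using (hlin y hy).symm
  · have ha : (2 * ((a : ℝ) : ℂ)) ≠ 0 := mul_ne_zero two_ne_zero (by exact_mod_cast a.2.1.ne')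
    refine mul_left_cancel₀ ha (tendsto_nhds_unique (j3.tendsto_smul_deriv a.2.2)
      (Tendsto.congr' ?_ ((((j1.tendsto_smul_deriv a.2.2).const_mul c).add
        (j2.tendsto_smul_deriv a.2.2)).trans_eq ?_)))
    · filter_upwards [self_mem_nhdsWithin] with y hy
      have e : (fun y => ∫ x, W x y * (c • ψ + χ : 𝓢(Rn n, ℂ)) x) =ᶠ[𝓝 y]
          fun y => c * (∫ x, W x y * ψ x) + ∫ x, W x y * χ x := by
        filter_upwards [lt_mem_nhds hy] with t ht using hlin t ht
      have e2 := ((j1.hasDerivAt hy).const_mul c).add (j2.hasDerivAt hy)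
      rw [e.deriv_eq, HasDerivAt.deriv (f := fun y => c * (∫ x, W x y * ψ x) + ∫ x, W x y * χ x) e2,
        j1.deriv_eq hy, j2.deriv_eq hy]
      simp only [Complex.real_smul]
      ring
    · congr 1; ring

theorem testLoc_equation (h : IsSmoothPair a V F G) {k : ℕ}
    (hk : ∀ x y, 0 < y → ((weightedLaplacian (1 - 2 * (a : ℝ)))^[k] V) x y = 0)
    {ψ : 𝓢(Rn n, ℂ)} (hψ : HasCompactSupport ψ) {y : ℝ} (hy : 0 < y) :
    ∑ q ∈ Finset.range (k + 1), ((-1) ^ q * k.choose q : ℂ) *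
      ((normalInv a ^ q) (testLoc h 0 (hasCompactSupport_negLap_iterate hψ q)) : ℝ → ℂ) y =
    ∑ m ∈ Finset.range k,
      (srcCoeff k (fun i q => jetTower (1 - 2 * (a : ℝ)) F i ((negLap ^ q) ψ) 0 0) m *
          (powFun a 0 m y : ℂ) +
        srcCoeff k (fun i q => jetTower (1 + 2 * (a : ℝ)) G i ((negLap ^ q) ψ) 0 0) m *
          (powFun a (2 * a) m y : ℂ)) := by
  have e := congrArg (fun u : ℕ → LocBdd => (u 0 : ℝ → ℂ) y) (one_sub_invShift_pow_testLoc h hk hψ)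
  simp only [one_sub_invShift_pow_apply, source_apply a k _ _ 0 hy, zero_add] at e
  rw [← e, Submodule.coe_sum, Finset.sum_apply]
  rfl

lemma norm_testLoc_le (h : IsSmoothPair a V F G) {C : ℝ} {P : ℕ} (hC0 : 0 ≤ C)
    (hV : ∀ y : ℝ, 0 < y → MemLp (fun x => V x y) 2 volume)
    (hC : ∀ y : ℝ, 0 < y → ∀ φ : Rn n → ℂ, MemLp φ 2 volume →
      ‖∫ ξ, sliceFourier V y ξ * φ ξ‖ ≤ C * (1 + y) ^ P * (eLpNorm φ 2 volume).toReal)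
    {ψ : 𝓢(Rn n, ℂ)} (hψ : HasCompactSupport ψ) {y Y : ℝ} (hY : 0 ≤ Y) (hy : y ≤ Y) :
    ‖(testLoc h 0 hψ : ℝ → ℂ) y‖ ≤ C * (1 + Y) ^ P * ‖weightedFourierInv 0 ψ‖ := by
  rcases le_or_gt y 0 with h0 | h0
  · rw [(testLoc h 0 hψ).2.2.1 y h0, norm_zero]; positivity
  · rw [testLoc_apply h 0 hψ h0, Function.iterate_zero, id, integral_slice_mul (hV y h0)]
    have h1 := memLp_fourierInv 0 ψ
    have h2 := toReal_eLpNorm_fourierInv 0 ψ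
    simp only [pow_zero, one_mul] at h1 h2
    refine (hC y h0 _ h1).trans ?_
    rw [h2]
    gcongr

/-- The traces of a solution of moderate growth have symbols. -/
theorem exists_trace_symbols (h : IsSmoothPair a V F G) (hV : HasModerateL2Growth V) {k : ℕ}
    (hk : ∀ x y, 0 < y → ((weightedLaplacian (1 - 2 * (a : ℝ)))^[k] V) x y = 0) :
    ∃ (K : ℕ) (t s : ℕ → Rn n → ℂ), (∀ i, SymbolClass K (t i)) ∧ (∀ i, SymbolClass K (s i)) ∧
      (∀ i, k ≤ i → t i = 0) ∧ (∀ i, k ≤ i → s i = 0) ∧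
      (∀ i (ψ : 𝓢(Rn n, ℂ)), HasCompactSupport ψ → jetTower (1 - 2 * (a : ℝ)) F i ψ 0 0 =
        ∫ ξ, t i ξ * (𝓕⁻ ψ : 𝓢(Rn n, ℂ)) ξ) ∧
      ∀ i (ψ : 𝓢(Rn n, ℂ)), HasCompactSupport ψ → jetTower (1 + 2 * (a : ℝ)) G i ψ 0 0 =
        ∫ ξ, s i ξ * (𝓕⁻ ψ : 𝓢(Rn n, ℂ)) ξ := by
  obtain ⟨C, P, hC0, hC⟩ := hV.exists_norm_integral_le
  -- The side of the equation involving `V` itself needs only the `L²` bound on `(0, y]` and at most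
  -- `k` powers of `-Δ` on `ψ`. Near `0` this uses that the norms stay bounded there.
  have hbd : ∀ y : ℝ, 0 < y → ∃ D : ℝ, ∀ ψ : testFun n,
      ‖∑ m ∈ Finset.range k,
      (srcCoeff k (fun i q => jetTower (1 - 2 * (a : ℝ)) F i ((negLap ^ q) ψ.1) 0 0) m *
          (powFun a 0 m y : ℂ) +
        srcCoeff k (fun i q => jetTower (1 + 2 * (a : ℝ)) G i ((negLap ^ q) ψ.1) 0 0) m *
          (powFun a (2 * a) m y : ℂ))‖ ≤ D * ‖weightedFourierInv k ψ.1‖ := by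
    intro y hy
    refine ⟨∑ q ∈ Finset.range (k + 1), (k.choose q : ℝ) * (C * (1 + y) ^ P * powFun a 0 q y),
      fun ψ => ?_⟩
    rw [← testLoc_equation h hk ψ.2 hy, Finset.sum_mul]
    refine (norm_sum_le _ _).trans (Finset.sum_le_sum fun q hq => ?_)
    rw [norm_mul, norm_mul, norm_pow, norm_neg, norm_one, one_pow, one_mul, Complex.norm_natCast,
      mul_assoc]
    refine mul_le_mul_of_nonneg_left ?_ (Nat.cast_nonneg _)
    have h1 := norm_normalInv_pow_le a (fun t ht => norm_testLoc_le h hC0 (fun y hy => hV.memLp hy)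
      hC (hasCompactSupport_negLap_iterate ψ.2 q) hy.le ht) q hy le_rfl
    refine h1.trans ?_
    have h2 := norm_weightedFourierInv_negLap_le (K := 0) (L := k) q
      (by have := Finset.mem_range.1 hq; omega) ψ.1
    have h3 := powFun_nonneg a.2.1 a.2.2 le_rfl q hy.le
    calc _ = C * (1 + y) ^ P * powFun a 0 q y * ‖weightedFourierInv 0 ((negLap ^ q) ψ.1)‖ := by ring
      _ ≤ _ := by gcongr
  have habs : ∀ {τ : 𝓢(Rn n, ℂ) → ℂ}, (∃ D : ℝ, ∀ ψ : testFun n,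
      ‖τ ψ.1‖ ≤ D * ‖weightedFourierInv k ψ.1‖) → WeightBounded τ := by
    rintro τ ⟨D, hD⟩
    exact ⟨k, |D|, abs_nonneg D, fun ψ hψ => (hD ⟨ψ, hψ⟩).trans
      (mul_le_mul_of_nonneg_right (le_abs_self D) (norm_nonneg _))⟩
  have hco := fun m (hm : m < k) => exists_norm_coeff_le a k
    (A := fun m (ψ : testFun n) =>
      srcCoeff k (fun i q => jetTower (1 - 2 * (a : ℝ)) F i ((negLap ^ q) ψ.1) 0 0) m)
    (B := fun m (ψ : testFun n) =>
      srcCoeff k (fun i q => jetTower (1 + 2 * (a : ℝ)) G i ((negLap ^ q) ψ.1) 0 0) m)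
    (N := fun ψ => ‖weightedFourierInv k ψ.1‖) hbd hm
  have bF := WeightBounded.of_srcCoeff
    (τ := fun i (ψ : 𝓢(Rn n, ℂ)) => jetTower (1 - 2 * (a : ℝ)) F i ψ 0 0)
    fun m hm => habs (hco m hm).1
  have bG := WeightBounded.of_srcCoeff
    (τ := fun i (ψ : 𝓢(Rn n, ℂ)) => jetTower (1 + 2 * (a : ℝ)) G i ψ 0 0)
    fun m hm => habs (hco m hm).2
  have ex : ∀ τ : ℕ → 𝓢(Rn n, ℂ) → ℂ, (∀ i < k, WeightBounded (τ i)) →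
      (∀ i ≥ k, ∀ ψ : 𝓢(Rn n, ℂ), HasCompactSupport ψ → τ i ψ = 0) →
      (∀ i (c : ℂ) (ψ χ : 𝓢(Rn n, ℂ)), HasCompactSupport ψ → HasCompactSupport χ →
        τ i (c • ψ + χ) = c * τ i ψ + τ i χ) →
      ∀ i, ∃ (K : ℕ) (t : Rn n → ℂ), SymbolClass K t ∧ (k ≤ i → t = 0) ∧
        ∀ ψ : 𝓢(Rn n, ℂ), HasCompactSupport ψ → τ i ψ = ∫ ξ, t ξ * (𝓕⁻ ψ : 𝓢(Rn n, ℂ)) ξ := by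
    intro τ hb hz hl i
    rcases lt_or_ge i k with hi | hi
    · obtain ⟨K, C, -, hC⟩ := hb i hi
      obtain ⟨t, ht, hτ⟩ := exists_symbol (hl i) hC
      exact ⟨K, t, ht, fun h => absurd hi (not_lt.2 h), hτ⟩
    · exact ⟨0, 0, SymbolClass.zero 0, fun _ => rfl, fun ψ hψ => by simp [hz i hi ψ hψ]⟩
  choose K t ht ht0 hτ using ex _ bF (fun i hi ψ hψ => (jetTower_eq_zero h hk hi hψ).1)
    fun i c ψ χ hψ hχ => (h.jetTower_linear i c hψ hχ).1
  choose L s hs hs0 hσ using ex _ bG (fun i hi ψ hψ => (jetTower_eq_zero h hk hi hψ).2)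
    fun i c ψ χ hψ hχ => (h.jetTower_linear i c hψ hχ).2
  set M := ∑ i ∈ Finset.range k, (K i + L i) with hM
  have hle : ∀ i < k, K i + L i ≤ M := fun i hi =>
    Finset.single_le_sum (f := fun i => K i + L i) (fun _ _ => Nat.zero_le _) (Finset.mem_range.2 hi)
  refine ⟨M, t, s, fun i => ?_, fun i => ?_, ht0, hs0, hτ, hσ⟩
  · rcases lt_or_ge i k with hi | hi
    · exact (ht i).weaken (by have := hle i hi; omega)
    · rw [ht0 i hi]; exact SymbolClass.zero M
  · rcases lt_or_ge i k with hi | hi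
    · exact (hs i).weaken (by have := hle i hi; omega)
    · rw [hs0 i hi]; exact SymbolClass.zero M

end TraceSymbols

/-! ### The equation at fixed frequency -/

section Extension

variable {n : ℕ} {V F G : Rn n → ℝ → ℂ} {a : UnitExp}

/-- The polynomial growth of `V(·, y)` in `L²`, in dual form. -/
structure SliceBound (V : Rn n → ℝ → ℂ) (C : ℝ) (P : ℕ) : Prop where
  nonneg : 0 ≤ C
  memLp : ∀ y : ℝ, 0 < y → MemLp (fun x => V x y) 2 volume
  bound : ∀ y : ℝ, 0 < y → ∀ φ : Rn n → ℂ, MemLp φ 2 volume →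
      ‖∫ ξ, sliceFourier V y ξ * φ ξ‖ ≤ C * (1 + y) ^ P * (eLpNorm φ 2 volume).toReal

lemma HasModerateL2Growth.exists_sliceBound (h : HasModerateL2Growth V) :
    ∃ C P, SliceBound V C P := by
  obtain ⟨C, P, h0, hb⟩ := h.exists_norm_integral_le
  exact ⟨C, P, h0, fun y hy => h.memLp hy, hb⟩

lemma memLp_freq_pow_mul {K q L : ℕ} (hL : q + K ≤ L) {φ : Rn n → ℂ}
    (hφ : MemLp (fun ξ => (fweight ξ : ℂ) ^ L * φ ξ) 2 volume) :
    MemLp (fun ξ => (fweight ξ : ℂ) ^ K * ((freq ξ : ℂ) ^ (2 * q) * φ ξ)) 2 volume ∧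
    (eLpNorm (fun ξ => (fweight ξ : ℂ) ^ K * ((freq ξ : ℂ) ^ (2 * q) * φ ξ)) 2 volume).toReal ≤
      (eLpNorm (fun ξ => (fweight ξ : ℂ) ^ L * φ ξ) 2 volume).toReal := by
  have h0 : SymbolClass 0 fun ξ => (fweight ξ : ℂ) ^ L * φ ξ := symbolClass_of_memLp hφ
  have hmφ : AEStronglyMeasurable φ volume := by
    have hc : Continuous fun ξ : Rn n => ((fweight ξ : ℂ) ^ L)⁻¹ :=
      ((Complex.continuous_ofReal.comp continuous_fweight).pow L).inv₀ fun ξ =>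
        pow_ne_zero _ (fweight_ne_zero ξ)
    refine (hc.aestronglyMeasurable.mul hφ.1).congr (Eventually.of_forall fun ξ => ?_)
    simp only [Pi.mul_apply]
    rw [← mul_assoc, inv_mul_cancel₀ (pow_ne_zero L (fweight_ne_zero ξ)), one_mul]
  have hle : ∀ ξ, ‖(fweight ξ : ℂ) ^ K * ((freq ξ : ℂ) ^ (2 * q) * φ ξ)‖ ≤
      ‖(fweight ξ : ℂ) ^ L * φ ξ‖ := by
    intro ξ
    rw [← mul_assoc]
    simp only [norm_mul, norm_pow, Complex.norm_real, Real.norm_of_nonneg (freq_nonneg ξ),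
      Real.norm_of_nonneg (fweight_pos ξ).le]
    have hw := one_le_fweight ξ
    refine mul_le_mul_of_nonneg_right ?_ (norm_nonneg _)
    calc fweight ξ ^ K * freq ξ ^ (2 * q) ≤ fweight ξ ^ K * fweight ξ ^ q := by
          have := fweight_pos ξ
          rw [pow_mul]
          gcongr
          rw [fweight_eq]; linarith
      _ = fweight ξ ^ (q + K) := by ring
      _ ≤ _ := pow_le_pow_right₀ hw hL
  have hm : MemLp (fun ξ => (fweight ξ : ℂ) ^ K * ((freq ξ : ℂ) ^ (2 * q) * φ ξ)) 2 volume :=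
    hφ.mono ((aestronglyMeasurable_fweight_pow K).mul
      (((Complex.continuous_ofReal.comp continuous_freq).pow _).aestronglyMeasurable.mul hmφ))
      (Eventually.of_forall hle)
  exact ⟨hm, ENNReal.toReal_mono hφ.2.ne (eLpNorm_mono hle)⟩

lemma testLoc_zero_apply (h : IsSmoothPair a V F G) {C : ℝ} {P : ℕ} (hV : SliceBound V C P)
    {ψ : 𝓢(Rn n, ℂ)} (hψ : HasCompactSupport ψ) {y : ℝ} (hy : 0 < y) :
    (testLoc h 0 hψ : ℝ → ℂ) y = ∫ ξ, sliceFourier V y ξ * (𝓕⁻ ψ : 𝓢(Rn n, ℂ)) ξ := by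
  rw [testLoc_apply h 0 hψ hy, Function.iterate_zero, id, integral_slice_mul (hV.memLp y hy)]

/-- The pairing of the Fourier transform of `V(·, y)` with `φ`, as a function of `y`. -/
def sliceLoc (h : IsSmoothPair a V F G) {C : ℝ} {P : ℕ} (hV : SliceBound V C P) {φ : Rn n → ℂ}
    (hφ : MemLp φ 2 volume) : LocBdd :=
  ⟨(Set.Ioi 0).indicator fun y => ∫ ξ, sliceFourier V y ξ * φ ξ, by
    have hφ' : MemLp (fun ξ => (fweight ξ : ℂ) ^ 0 * φ ξ) 2 volume := by simpa using hφ
    refine ⟨?_, fun y hy => by simp [hy], fun Y =>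
      ⟨C * (1 + |Y|) ^ P * (eLpNorm φ 2 volume).toReal, fun y hy => ?_⟩⟩
    -- Measurability in `y` is inherited as a pointwise limit of pairings with test functions, which
    -- are measurable already.
    · obtain ⟨ψ, hψ, hlim⟩ := exists_tendsto_weightedFourierInv 0 hφ'.toLp
      refine measurable_of_tendsto_metrizable (f := fun j => (testLoc h 0 (hψ j) : ℝ → ℂ))
        (fun j => (testLoc h 0 (hψ j)).2.1) ?_
      rw [tendsto_pi_nhds]
      intro y
      by_cases hy : 0 < y
      · simp only [Set.indicator_of_mem (Set.mem_Ioi.2 hy), testLoc_zero_apply h hV (hψ _) hy]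
        exact tendsto_integral_symbol_mul (symbolClass_sliceFourier V 0 y) hφ' hlim
      · simp only [Set.indicator_of_notMem (mt Set.mem_Ioi.1 hy),
          (testLoc h 0 (hψ _)).2.2.1 y (not_lt.1 hy), tendsto_const_nhds]
    · have hC := hV.nonneg
      by_cases h0 : 0 < y
      · rw [Set.indicator_of_mem (Set.mem_Ioi.2 h0)]
        refine (hV.bound y h0 φ hφ).trans ?_
        have := hy.trans (le_abs_self Y)
        gcongr
      · rw [Set.indicator_of_notMem (mt Set.mem_Ioi.1 h0), norm_zero]
        positivity⟩

lemma sliceLoc_apply (h : IsSmoothPair a V F G) {C : ℝ} {P : ℕ} (hV : SliceBound V C P)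
    {φ : Rn n → ℂ} (hφ : MemLp φ 2 volume) {y : ℝ} (hy : 0 < y) :
    (sliceLoc h hV hφ : ℝ → ℂ) y = ∫ ξ, sliceFourier V y ξ * φ ξ := by
  simp [sliceLoc, hy]

lemma memLp_freq_pow_mul_of_forall {φ : Rn n → ℂ}
    (hφ : ∀ K : ℕ, MemLp (fun ξ => (fweight ξ : ℂ) ^ K * φ ξ) 2 volume) (q : ℕ) :
    MemLp (fun ξ => (freq ξ : ℂ) ^ (2 * q) * φ ξ) 2 volume := by
  simpa using (memLp_freq_pow_mul (K := 0) (q := q) le_rfl (hφ (q + 0))).1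

/-- The symbols of the traces of `Δ_m ^ i V`. -/
structure TraceSymbols (a : UnitExp) (F G : Rn n → ℝ → ℂ) (k K : ℕ) (t s : ℕ → Rn n → ℂ) :
    Prop where
  left : ∀ i, SymbolClass K (t i)
  right : ∀ i, SymbolClass K (s i)
  left_zero : ∀ i, k ≤ i → t i = 0
  right_zero : ∀ i, k ≤ i → s i = 0
  left_eq : ∀ i (ψ : 𝓢(Rn n, ℂ)), HasCompactSupport ψ → jetTower (1 - 2 * (a : ℝ)) F i ψ 0 0 =
    ∫ ξ, t i ξ * (𝓕⁻ ψ : 𝓢(Rn n, ℂ)) ξ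
  right_eq : ∀ i (ψ : 𝓢(Rn n, ℂ)), HasCompactSupport ψ → jetTower (1 + 2 * (a : ℝ)) G i ψ 0 0 =
    ∫ ξ, s i ξ * (𝓕⁻ ψ : 𝓢(Rn n, ℂ)) ξ

lemma tendsto_srcCoeff {K k : ℕ} {t : ℕ → Rn n → ℂ} (ht : ∀ i, SymbolClass K (t i))
    {τ : ℕ → 𝓢(Rn n, ℂ) → ℂ} (hτ : ∀ i (ψ : 𝓢(Rn n, ℂ)), HasCompactSupport ψ →
      τ i ψ = ∫ ξ, t i ξ * (𝓕⁻ ψ : 𝓢(Rn n, ℂ)) ξ) {φ : Rn n → ℂ}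
    (hφ : MemLp (fun ξ => (fweight ξ : ℂ) ^ (K + k) * φ ξ) 2 volume) {ψ : ℕ → 𝓢(Rn n, ℂ)}
    (hψ : ∀ j, HasCompactSupport (ψ j))
    (hlim : Tendsto (fun j => weightedFourierInv (K + k) (ψ j)) atTop (𝓝 hφ.toLp)) {m : ℕ}
    (hm : m < k) :
    Tendsto (fun j => srcCoeff k (fun i q => τ i ((negLap ^ q) (ψ j))) m) atTop
      (𝓝 (srcCoeff k (fun i q => ∫ ξ, t i ξ * ((freq ξ : ℂ) ^ (2 * q) * φ ξ)) m)) := by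
  unfold srcCoeff
  refine tendsto_finsetSum _ fun i _ => Tendsto.const_mul _ ?_
  have h1 := tendsto_integral_symbol_mul
    ((ht i).freq_pow_mul (L := K + k) (m - i) (by omega)) hφ hlim
  refine (h1.congr fun j => ?_).trans_eq (congrArg _ ?_)
  · beta_reduce
    rw [hτ i _ (hasCompactSupport_negLap_iterate (hψ j) _)]
    refine integral_congr_ae (Eventually.of_forall fun ξ => ?_)
    simp only [fourierInv_negLap_pow]; ring
  · refine integral_congr_ae (Eventually.of_forall fun ξ => ?_)
    simp only; ring

/-- The tested equation survives the limit from test functions to `φ`: now that the traces have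
symbols, both sides are continuous in a weighted norm. -/
theorem sliceLoc_equation (h : IsSmoothPair a V F G) {C : ℝ} {P : ℕ} (hV : SliceBound V C P) {k : ℕ}
    (hk : ∀ x y, 0 < y → ((weightedLaplacian (1 - 2 * (a : ℝ)))^[k] V) x y = 0) {K : ℕ}
    {t s : ℕ → Rn n → ℂ} (hts : TraceSymbols a F G k K t s) {φ : Rn n → ℂ}
    (hφ : ∀ K : ℕ, MemLp (fun ξ => (fweight ξ : ℂ) ^ K * φ ξ) 2 volume) {y : ℝ} (hy : 0 < y) :
    ∑ q ∈ Finset.range (k + 1), ((-1) ^ q * k.choose q : ℂ) *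
      ((normalInv a ^ q) (sliceLoc h hV (memLp_freq_pow_mul_of_forall hφ q)) : ℝ → ℂ) y =
    ∑ m ∈ Finset.range k,
      (srcCoeff k (fun i q => ∫ ξ, t i ξ * ((freq ξ : ℂ) ^ (2 * q) * φ ξ)) m *
          (powFun a 0 m y : ℂ) +
        srcCoeff k (fun i q => ∫ ξ, s i ξ * ((freq ξ : ℂ) ^ (2 * q) * φ ξ)) m *
          (powFun a (2 * a) m y : ℂ)) := by
  -- Weight `K` absorbs the growth of the symbols and the additional `k` absorbs up to `k` factors
  -- of the squared frequency.
  obtain ⟨ψ, hψ, hlim⟩ := exists_tendsto_weightedFourierInv (K + k) (hφ (K + k)).toLp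
  have hR : Tendsto (fun j => ∑ m ∈ Finset.range k,
      (srcCoeff k (fun i q => jetTower (1 - 2 * (a : ℝ)) F i ((negLap ^ q) (ψ j)) 0 0) m *
          (powFun a 0 m y : ℂ) +
        srcCoeff k (fun i q => jetTower (1 + 2 * (a : ℝ)) G i ((negLap ^ q) (ψ j)) 0 0) m *
          (powFun a (2 * a) m y : ℂ))) atTop (𝓝 (∑ m ∈ Finset.range k,
      (srcCoeff k (fun i q => ∫ ξ, t i ξ * ((freq ξ : ℂ) ^ (2 * q) * φ ξ)) m *
          (powFun a 0 m y : ℂ) +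
        srcCoeff k (fun i q => ∫ ξ, s i ξ * ((freq ξ : ℂ) ^ (2 * q) * φ ξ)) m *
          (powFun a (2 * a) m y : ℂ)))) := by
    refine tendsto_finsetSum _ fun m hm => ?_
    have hm := Finset.mem_range.1 hm
    exact ((tendsto_srcCoeff (τ := fun i ψ => jetTower (1 - 2 * (a : ℝ)) F i ψ 0 0)
      hts.left hts.left_eq (hφ _) hψ hlim hm).mul_const _).add
      ((tendsto_srcCoeff (τ := fun i ψ => jetTower (1 + 2 * (a : ℝ)) G i ψ 0 0)
      hts.right hts.right_eq (hφ _) hψ hlim hm).mul_const _)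
  refine tendsto_nhds_unique ?_ hR
  simp only [← testLoc_equation h hk (hψ _) hy]
  refine tendsto_finsetSum _ fun q hq => Tendsto.const_mul _ ?_
  have hq := Finset.mem_range.1 hq
  set D := C * (1 + y) ^ P
  have hb : ∀ j, ‖((normalInv a ^ q) (testLoc h 0 (hasCompactSupport_negLap_iterate (hψ j) q)) :
      ℝ → ℂ) y - ((normalInv a ^ q) (sliceLoc h hV (memLp_freq_pow_mul_of_forall hφ q)) :
        ℝ → ℂ) y‖ ≤
      D * ‖weightedFourierInv (K + k) (ψ j) - (hφ (K + k)).toLp‖ * powFun a 0 q y := by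
    intro j
    rw [← Pi.sub_apply, ← Submodule.coe_sub, ← map_sub]
    refine norm_normalInv_pow_le a (fun x hx => ?_) q hy le_rfl
    have hD0 : 0 ≤ D := mul_nonneg hV.nonneg (by positivity)
    rcases le_or_gt x 0 with h0 | h0
    · rw [Subtype.prop (testLoc h 0 (hasCompactSupport_negLap_iterate (hψ j) q) -
        sliceLoc h hV (memLp_freq_pow_mul_of_forall hφ q)) |>.2.1 x h0, norm_zero]
      positivity
    · rw [Submodule.coe_sub, Pi.sub_apply, testLoc_zero_apply h hV _ h0, sliceLoc_apply h hV _ h0]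
      have e : (fun ξ => (fweight ξ : ℂ) ^ (K + k) * ((𝓕⁻ (ψ j) : 𝓢(Rn n, ℂ)) ξ - φ ξ)) =ᵐ[volume]
          (weightedFourierInv (K + k) (ψ j) - (hφ (K + k)).toLp :
            Lp ℂ 2 (volume : Measure (Rn n))) := by
        filter_upwards [weightedFourierInv_ae (K + k) (ψ j), (hφ (K + k)).coeFn_toLp,
          Lp.coeFn_sub (weightedFourierInv (K + k) (ψ j)) (hφ (K + k)).toLp] with ξ h1 h2 h3
        rw [h3, Pi.sub_apply, h1, h2]; ring
      obtain ⟨m1, m2⟩ := memLp_freq_pow_mul (K := 0) (q := q) (L := K + k)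
        (φ := fun ξ => (𝓕⁻ (ψ j) : 𝓢(Rn n, ℂ)) ξ - φ ξ) (by omega) ((Lp.memLp _).ae_eq e.symm)
      rw [eLpNorm_congr_ae e, ← Lp.norm_def] at m2
      simp only [pow_zero, one_mul] at m1 m2
      have i1 := (symbolClass_sliceFourier V 0 x).integrable_mul
        (memLp_fourierInv 0 ((negLap ^ q) (ψ j)))
      have i2 := (symbolClass_sliceFourier V 0 x).integrable_mul (φ := fun ξ =>
        (freq ξ : ℂ) ^ (2 * q) * φ ξ) (by simpa using memLp_freq_pow_mul_of_forall hφ q)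
      have e3 : (∫ ξ, sliceFourier V x ξ * (𝓕⁻ ((negLap ^ q) (ψ j)) : 𝓢(Rn n, ℂ)) ξ) -
          ∫ ξ, sliceFourier V x ξ * ((freq ξ : ℂ) ^ (2 * q) * φ ξ) =
          ∫ ξ, sliceFourier V x ξ *
            ((freq ξ : ℂ) ^ (2 * q) * ((𝓕⁻ (ψ j) : 𝓢(Rn n, ℂ)) ξ - φ ξ)) := by
        rw [← integral_sub i1 i2]
        refine integral_congr_ae (Eventually.of_forall fun ξ => ?_)
        simp only [fourierInv_negLap_pow]; ring
      rw [e3]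
      refine (hV.bound x h0 _ m1).trans ?_
      have := hV.nonneg
      refine mul_le_mul ?_ m2 ENNReal.toReal_nonneg hD0
      simp only [D]
      gcongr
  rw [tendsto_iff_norm_sub_tendsto_zero]
  refine squeeze_zero (fun _ => norm_nonneg _) hb ?_
  simpa using ((tendsto_iff_norm_sub_tendsto_zero.1 hlim).const_mul D).mul_const (powFun a 0 q y)

end Extension

/-! ### The power series of a solution at almost every frequency -/

section Pointwise

variable {n : ℕ} {V F G : Rn n → ℝ → ℂ} {a : UnitExp}

/-- The coefficients of the power series at the frequency `ξ`. -/
def freqCoeff (t : ℕ → Rn n → ℂ) (m : ℕ) (ξ : Rn n) : ℂ :=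
  pascal (fun i l => (freq ξ : ℂ) ^ (2 * l) * t i ξ) m 0 0

/-- The power series at the frequency `ξ`. -/
def freqSeries (a b : ℝ) (t : ℕ → Rn n → ℂ) (y : ℝ) (ξ : Rn n) : ℂ :=
  ∑' m, freqCoeff t m ξ * (powFun a b m y : ℂ)

lemma SymbolClass.integrableOn {K : ℕ} {t : Rn n → ℂ} (ht : SymbolClass K t) {B : Set (Rn n)}
    (hB : IsCompact B) {φ : Rn n → ℂ} (hφ : Continuous φ) :
    IntegrableOn (fun ξ => t ξ * φ ξ) B := by
  have h := ht.integrable_mul (memLp_fweight_mul_indicator K hB hφ)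
  rw [← integrable_indicator_iff hB.measurableSet]
  refine h.congr (Eventually.of_forall fun ξ => ?_)
  by_cases hξ : ξ ∈ B <;> simp [hξ]

lemma integral_mul_indicator {B : Set (Rn n)} (hB : MeasurableSet B) (t φ : Rn n → ℂ) :
    ∫ ξ, t ξ * B.indicator φ ξ = ∫ ξ in B, t ξ * φ ξ := by
  rw [← integral_indicator hB]
  refine integral_congr_ae (Eventually.of_forall fun ξ => ?_)
  by_cases hξ : ξ ∈ B <;> simp [hξ]

lemma continuous_freq_pow (l : ℕ) : Continuous fun ξ : Rn n => (freq ξ : ℂ) ^ l :=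
  (Complex.continuous_ofReal.comp continuous_freq).pow l

section Compact

variable {K k : ℕ} {t : ℕ → Rn n → ℂ} {B : Set (Rn n)} {ρ : ℝ}

lemma integrableOn_pascal (ht : ∀ i, SymbolClass K (t i)) (hB : IsCompact B) (m i l : ℕ) :
    IntegrableOn (fun ξ => pascal (fun i l => (freq ξ : ℂ) ^ (2 * l) * t i ξ) m i l) B ∧
    pascal (fun i l => ∫ ξ in B, t i ξ * (freq ξ : ℂ) ^ (2 * l)) m i l =
      ∫ ξ in B, pascal (fun i l => (freq ξ : ℂ) ^ (2 * l) * t i ξ) m i l := by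
  induction m generalizing i l with
  | zero =>
    have h := (ht i).integrableOn hB (continuous_freq_pow (2 * l))
    simp only [pascal, mul_comm _ (t i _)]
    exact ⟨h, trivial⟩
  | succ m ih =>
    simp only [pascal]
    exact ⟨(ih _ _).1.add (ih _ _).1, by
      rw [integral_add (ih _ _).1 (ih _ _).1, (ih _ _).2, (ih _ _).2]⟩

lemma norm_freqCoeff_le (ht0 : ∀ i, k ≤ i → t i = 0) {ξ : Rn n} (hξ : freq ξ ≤ ρ) (m : ℕ) :
    ‖freqCoeff t m ξ‖ ≤ (∑ i ∈ Finset.range k, ‖t i ξ‖) * (1 + ρ ^ 2) ^ m := by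
  have h0 := freq_nonneg ξ
  have h1 : ∀ i, ‖t i ξ‖ ≤ ∑ i ∈ Finset.range k, ‖t i ξ‖ := by
    intro i
    rcases lt_or_ge i k with hi | hi
    · exact Finset.single_le_sum (f := fun i => ‖t i ξ‖) (fun _ _ => norm_nonneg _)
        (Finset.mem_range.2 hi)
    · rw [ht0 i hi]; simpa using Finset.sum_nonneg fun i _ => norm_nonneg (t i ξ)
  have h2 := norm_pascal_le (t := fun i l => (freq ξ : ℂ) ^ (2 * l) * t i ξ)
    (M := ∑ i ∈ Finset.range k, ‖t i ξ‖) (θ := ρ ^ 2) (fun i l => by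
      rw [norm_mul, norm_pow, Complex.norm_real, Real.norm_of_nonneg h0, mul_comm, pow_mul]
      have := h1 i
      have := (norm_nonneg _).trans this
      gcongr) m 0 0
  simpa [freqCoeff] using h2

/-- On a compact set the frequency is at most `ρ`, so the `m`-th coefficient is bounded by an
integrable function times `(1+ρ²)^m`. This justifies integrating the series termwise. -/
theorem freqSeries_compact (a : UnitExp) {b : ℝ} (hb : 0 ≤ b) (ht : ∀ i, SymbolClass K (t i))
    (ht0 : ∀ i, k ≤ i → t i = 0) (hB : IsCompact B) (hρ : ∀ ξ ∈ B, freq ξ ≤ ρ) {y : ℝ}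
    (hy : 0 < y) : IntegrableOn (freqSeries a b t y) B ∧
      ∑' m, pascal (fun i l => ∫ ξ in B, t i ξ * (freq ξ : ℂ) ^ (2 * l)) m 0 0 *
        (powFun a b m y : ℂ) = ∫ ξ in B, freqSeries a b t y ξ := by
  set g : Rn n → ℝ := fun ξ => ∑ i ∈ Finset.range k, ‖t i ξ‖ with hg
  have hgi : IntegrableOn g B := by
    refine integrable_finsetSum _ fun i _ => ?_
    have := (ht i).integrableOn hB (φ := fun _ => 1) continuous_const
    simp only [mul_one] at this
    exact this.norm
  have hp : ∀ m, 0 ≤ powFun a b m y := fun m => powFun_nonneg a.2.1 a.2.2 hb m hy.le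
  have hsum : Summable fun m => (1 + ρ ^ 2) ^ m * powFun a b m y := by
    refine (summable_powFun a.2.1 a.2.2 hb (c := fun m => (((1 + ρ ^ 2) ^ m : ℝ) : ℂ)) (M := 1)
      (θ := 1 + ρ ^ 2) (fun m => ?_) 0 hy).congr fun m => ?_
    · rw [Complex.norm_real, Real.norm_of_nonneg (by positivity), one_mul]
    · rw [Complex.norm_real, Real.norm_of_nonneg (by positivity)]; rfl
  have hterm : ∀ m, IntegrableOn (fun ξ => freqCoeff t m ξ * (powFun a b m y : ℂ)) B := fun m =>
    (integrableOn_pascal ht hB m 0 0).1.mul_const _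
  have hle : ∀ m, ∀ ξ ∈ B, ‖freqCoeff t m ξ * (powFun a b m y : ℂ)‖ ≤
      g ξ * ((1 + ρ ^ 2) ^ m * powFun a b m y) := by
    intro m ξ hξ
    rw [norm_mul, Complex.norm_real, Real.norm_of_nonneg (hp m), ← mul_assoc]
    exact mul_le_mul_of_nonneg_right (norm_freqCoeff_le ht0 (hρ ξ hξ) m) (hp m)
  have hle' : ∀ m, ∀ᵐ ξ ∂volume.restrict B, ‖freqCoeff t m ξ * (powFun a b m y : ℂ)‖ ≤
      g ξ * ((1 + ρ ^ 2) ^ m * powFun a b m y) := fun m =>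
    (ae_restrict_iff' hB.measurableSet).2 (Eventually.of_forall (hle m))
  have hI : Summable fun m => ∫ ξ in B, ‖freqCoeff t m ξ * (powFun a b m y : ℂ)‖ := by
    refine Summable.of_nonneg_of_le (fun m => integral_nonneg fun ξ => norm_nonneg _) (fun m => ?_)
      (hsum.mul_left (∫ ξ in B, g ξ))
    rw [← integral_mul_const]
    exact integral_mono_ae (hterm m).norm (hgi.mul_const _) (hle' m)
  have h1 := hasSum_integral_of_summable_integral_norm hterm hI
  constructor
  · refine (hgi.mul_const (∑' m, (1 + ρ ^ 2) ^ m * powFun a b m y)).mono' ?_ ?_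
    · refine aestronglyMeasurable_of_tendsto_ae atTop
        (f := fun M ξ => ∑ m ∈ Finset.range M, freqCoeff t m ξ * (powFun a b m y : ℂ))
        (fun M => (integrable_finsetSum _ fun m _ => hterm m).1) ?_
      refine (ae_restrict_iff' hB.measurableSet).2 (Eventually.of_forall fun ξ hξ => ?_)
      exact (Summable.of_norm_bounded (hsum.mul_left (g ξ)) fun m =>
        hle m ξ hξ).hasSum.tendsto_sum_nat
    · refine (ae_restrict_iff' hB.measurableSet).2 (Eventually.of_forall fun ξ hξ => ?_)
      exact tsum_of_norm_bounded (hsum.hasSum.mul_left (g ξ)) fun m => hle m ξ hξ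
  · simp only [freqSeries]
    rw [← h1.tsum_eq]
    refine tsum_congr fun m => ?_
    rw [integral_mul_const, (integrableOn_pascal ht hB m 0 0).2]
    rfl

lemma exists_norm_setIntegral_le (ht : ∀ i, SymbolClass K (t i)) (ht0 : ∀ i, k ≤ i → t i = 0)
    (hB : IsCompact B) (hρ : ∀ ξ ∈ B, freq ξ ≤ ρ) :
    ∃ M, 0 ≤ M ∧ ∀ i l, ‖∫ ξ in B, t i ξ * (freq ξ : ℂ) ^ (2 * l)‖ ≤ M * (ρ ^ 2) ^ l := by
  refine ⟨∑ i ∈ Finset.range k, ∫ ξ in B, ‖t i ξ‖,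
    Finset.sum_nonneg fun i _ => integral_nonneg fun ξ => norm_nonneg _, fun i l => ?_⟩
  rcases lt_or_ge i k with hi | hi
  · have h1 := (ht i).integrableOn hB (φ := fun _ => 1) continuous_const
    simp only [mul_one] at h1
    have h2 : ∫ ξ in B, ‖t i ξ‖ ≤ ∑ i ∈ Finset.range k, ∫ ξ in B, ‖t i ξ‖ :=
      Finset.single_le_sum (f := fun i => ∫ ξ in B, ‖t i ξ‖)
        (fun i _ => integral_nonneg fun ξ => norm_nonneg _) (Finset.mem_range.2 hi)
    refine le_trans ?_ (mul_le_mul_of_nonneg_right h2 (by positivity))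
    rw [← integral_mul_const]
    refine norm_integral_le_of_norm_le (h1.norm.mul_const _)
      ((ae_restrict_iff' hB.measurableSet).2 (Eventually.of_forall fun ξ hξ => ?_))
    rw [norm_mul, norm_pow, Complex.norm_real, Real.norm_of_nonneg (freq_nonneg ξ), pow_mul]
    have := freq_nonneg ξ
    have := hρ ξ hξ
    gcongr
  · rw [ht0 i hi]
    simpa using mul_nonneg (Finset.sum_nonneg fun i _ => integral_nonneg fun ξ =>
      norm_nonneg (t i ξ)) (by positivity)

end Compact

/-- Taking the indicator of `B` times `freq^(2l)` as test function gives geometric growth in `l`,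
which test functions with compact support in `x` need not do. The uniqueness theorem thus becomes
available. -/
theorem setIntegral_sliceFourier (h : IsSmoothPair a V F G) {C : ℝ} {P : ℕ} (hV : SliceBound V C P)
    {k : ℕ} (hk : ∀ x y, 0 < y → ((weightedLaplacian (1 - 2 * (a : ℝ)))^[k] V) x y = 0) {K : ℕ}
    {t s : ℕ → Rn n → ℂ} (hts : TraceSymbols a F G k K t s) {B : Set (Rn n)} (hB : IsCompact B)
    {ρ : ℝ} (hρ : ∀ ξ ∈ B, freq ξ ≤ ρ) {y : ℝ} (hy : 0 < y) :
    ∫ ξ in B, sliceFourier V y ξ =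
      (∫ ξ in B, freqSeries a 0 t y ξ) + ∫ ξ in B, freqSeries a (2 * a) s y ξ := by
  have hφ : ∀ l K : ℕ, MemLp (fun ξ : Rn n => (fweight ξ : ℂ) ^ K *
      B.indicator (fun ξ => (freq ξ : ℂ) ^ (2 * l)) ξ) 2 volume := fun l K =>
    memLp_fweight_mul_indicator K hB (continuous_freq_pow (2 * l))
  have hφ0 : ∀ l : ℕ, MemLp (B.indicator fun ξ : Rn n => (freq ξ : ℂ) ^ (2 * l)) 2 volume :=
    fun l => by simpa using hφ l 0
  set u : ℕ → LocBdd := fun l => sliceLoc h hV (hφ0 l) with hu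
  have hmul : ∀ (l q : ℕ) (ξ : Rn n), (freq ξ : ℂ) ^ (2 * q) *
      B.indicator (fun ξ => (freq ξ : ℂ) ^ (2 * l)) ξ =
      B.indicator (fun ξ => (freq ξ : ℂ) ^ (2 * (l + q))) ξ := by
    intro l q ξ
    by_cases hξ : ξ ∈ B
    · simp only [Set.indicator_of_mem hξ]; ring
    · simp [hξ]
  obtain ⟨M, hM0, hM⟩ := exists_norm_setIntegral_le hts.left hts.left_zero hB hρ
  obtain ⟨M', hM0', hM'⟩ := exists_norm_setIntegral_le hts.right hts.right_zero hB hρ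
  have hgeom : GeomSeq u := by
    intro Y
    refine ⟨C * (1 + |Y|) ^ P * (eLpNorm (B.indicator fun _ : Rn n => (1 : ℂ)) 2 volume).toReal,
      ρ ^ 2, fun l y hy => ?_⟩
    have hC := hV.nonneg
    rcases le_or_gt y 0 with h0 | h0
    · rw [(u l).2.2.1 y h0, norm_zero]
      positivity
    · rw [sliceLoc_apply h hV _ h0, mul_assoc]
      have h1 : (eLpNorm (B.indicator fun ξ : Rn n => (freq ξ : ℂ) ^ (2 * l)) 2 volume).toReal ≤
          (eLpNorm (B.indicator fun _ : Rn n => (1 : ℂ)) 2 volume).toReal * (ρ ^ 2) ^ l := by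
        have e := hφ0 0
        simp only [mul_zero, pow_zero] at e
        have h2 := eLpNorm_mono_real (p := 2) (μ := volume)
          (f := B.indicator fun ξ : Rn n => (freq ξ : ℂ) ^ (2 * l))
          (g := (((ρ ^ 2) ^ l : ℝ)) • fun ξ => ‖B.indicator (fun _ : Rn n => (1 : ℂ)) ξ‖) (fun ξ => by
            by_cases hξ : ξ ∈ B
            · simp only [Set.indicator_of_mem hξ, Pi.smul_apply, norm_one, smul_eq_mul, mul_one]
              rw [norm_pow, Complex.norm_real, Real.norm_of_nonneg (freq_nonneg ξ), pow_mul]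
              have := freq_nonneg ξ
              have := hρ ξ hξ
              gcongr
            · simp [hξ])
        rw [eLpNorm_const_smul, eLpNorm_norm] at h2
        have h3 := ENNReal.toReal_mono (ENNReal.mul_ne_top (by simp) e.2.ne) h2
        rw [ENNReal.toReal_mul, toReal_enorm, Real.norm_of_nonneg (by positivity)] at h3
        exact h3.trans_eq (mul_comm _ _)
      refine (hV.bound y h0 _ (hφ0 l)).trans (mul_le_mul ?_ h1 ENNReal.toReal_nonneg (by positivity))
      have := hy.trans (le_abs_self Y)
      gcongr
  have heq : ((1 - invShift a) ^ k) u = ∑ i ∈ Finset.range k, (invSeq a ^ i)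
      (((1 - invShift a) ^ (k - 1 - i)) (srcSeq a
        (fun i l => ∫ ξ in B, t i ξ * (freq ξ : ℂ) ^ (2 * l))
        (fun i l => ∫ ξ in B, s i ξ * (freq ξ : ℂ) ^ (2 * l)) i)) := by
    funext l
    refine LocBdd.ext_pos fun y hy => ?_
    have e := sliceLoc_equation h hV hk hts (hφ l) hy
    rw [one_sub_invShift_pow_apply, source_apply a k _ _ l hy, Submodule.coe_sum, Finset.sum_apply]
    simp only [hmul, integral_mul_indicator hB.measurableSet] at e
    rw [← e]
    rfl
  have key := hasSum_of_one_sub_invShift_pow a k (M := max M M') (θ := ρ ^ 2)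
    (fun i l => (hM i l).trans (by gcongr; exact le_max_left _ _))
    (fun i l => (hM' i l).trans (by gcongr; exact le_max_right _ _)) (sq_nonneg ρ)
    (fun i l hi => by simp [hts.left_zero i hi]) (fun i l hi => by simp [hts.right_zero i hi])
    hgeom heq 0 hy
  rw [(freqSeries_compact a le_rfl hts.left hts.left_zero hB hρ hy).2,
    (freqSeries_compact a (two_mul_nonneg a) hts.right hts.right_zero hB hρ hy).2,
    sliceLoc_apply h hV _ hy, integral_mul_indicator hB.measurableSet] at key
  simpa using key

theorem sliceFourier_ae_eq (h : IsSmoothPair a V F G) {C : ℝ} {P : ℕ} (hV : SliceBound V C P)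
    {k : ℕ} (hk : ∀ x y, 0 < y → ((weightedLaplacian (1 - 2 * (a : ℝ)))^[k] V) x y = 0) {K : ℕ}
    {t s : ℕ → Rn n → ℂ} (hts : TraceSymbols a F G k K t s) {y : ℝ} (hy : 0 < y) :
    ∀ᵐ ξ ∂volume, sliceFourier V y ξ = freqSeries a 0 t y ξ + freqSeries a (2 * a) s y ξ := by
  have hρ : ∀ B : Set (Rn n), IsCompact B → ∃ ρ, ∀ ξ ∈ B, freq ξ ≤ ρ := by
    intro B hB
    obtain ⟨ρ, hρ⟩ := hB.exists_bound_of_continuousOn continuous_freq.continuousOn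
    exact ⟨ρ, fun ξ hξ => (le_abs_self _).trans (hρ ξ hξ)⟩
  have hint : ∀ B : Set (Rn n), IsCompact B → IntegrableOn (sliceFourier V y) B ∧
      IntegrableOn (freqSeries a 0 t y) B ∧ IntegrableOn (freqSeries a (2 * a) s y) B := by
    intro B hB
    obtain ⟨ρ, hρ⟩ := hρ B hB
    have h1 := (symbolClass_sliceFourier V 0 y).integrableOn hB (φ := fun _ => 1) continuous_const
    simp only [mul_one] at h1
    exact ⟨h1, (freqSeries_compact a le_rfl hts.left hts.left_zero hB hρ hy).1,
      (freqSeries_compact a (two_mul_nonneg a) hts.right hts.right_zero hB hρ hy).1⟩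
  have h0 := ae_eq_zero_of_forall_setIntegral_isCompact_eq_zero' (μ := volume)
    (f := fun ξ => sliceFourier V y ξ - (freqSeries a 0 t y ξ + freqSeries a (2 * a) s y ξ))
    (locallyIntegrable_iff.2 fun B hB => (hint B hB).1.sub ((hint B hB).2.1.add (hint B hB).2.2))
    (fun B hB => by
      obtain ⟨ρ, hρ⟩ := hρ B hB
      obtain ⟨i1, i2, i3⟩ := hint B hB
      have e2 := integral_sub i1 (i2.add i3)
      simp only [Pi.add_apply] at e2
      rw [e2, integral_add i2 i3, setIntegral_sliceFourier h hV hk hts hB hρ hy, sub_self])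
  filter_upwards [h0] with ξ hξ using sub_eq_zero.1 hξ

/-- Almost every frequency component grows at most polynomially along the integers. -/
theorem HasModerateL2Growth.ae_bounded (hV : HasModerateL2Growth V) : ∃ P : ℕ,
    ∀ᵐ ξ ∂volume, ∃ D : ℝ, ∀ m : ℕ, ‖sliceFourier V (m + 1) ξ‖ ≤ D * (m + 2) ^ P := by
  obtain ⟨C, P, hC⟩ := hV
  refine ⟨P + 1, ?_⟩
  -- One power more than the growth exponent, so that the squared norms of the rescaled slices are
  -- `O((m+2)⁻²)` and hence summable.
  set c : ℕ → ℝ := fun m => ((m : ℝ) + 2) ^ (P + 1) with hc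
  have hc0 : ∀ m, 0 < c m := fun m => by positivity
  set g : ℕ → Rn n → ℂ := fun m ξ => ((c m)⁻¹ : ℝ) • sliceFourier V (m + 1) ξ with hg
  have hm : ∀ m : ℕ, ∫⁻ ξ, ‖g m ξ‖ₑ ^ 2 ≤ ENNReal.ofReal (C ^ 2 * (((m : ℝ) + 2) ^ 2)⁻¹) := by
    intro m
    obtain ⟨h1, h2⟩ := hC (m + 1) (by positivity)
    rw [← eLpNorm_sliceFourier h1] at h2
    have h3 := eLpNorm_nnreal_pow_eq_lintegral (μ := volume) (f := g m) (p := 2) two_ne_zero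
    simp only [NNReal.coe_ofNat, ENNReal.rpow_ofNat, ENNReal.coe_ofNat] at h3
    rw [← h3]
    have h4 : eLpNorm (g m) 2 volume ≤ ENNReal.ofReal (|C| * ((m : ℝ) + 2)⁻¹) := by
      have e : g m = ((c m)⁻¹ : ℝ) • sliceFourier V (m + 1) := rfl
      rw [e, eLpNorm_const_smul, Real.enorm_eq_ofReal (inv_nonneg.2 (hc0 m).le)]
      refine (mul_le_mul_right h2 _).trans ?_
      rw [← ENNReal.ofReal_mul (inv_nonneg.2 (hc0 m).le)]
      refine ENNReal.ofReal_le_ofReal ?_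
      have e2 : (c m)⁻¹ * (|C| * (1 + ((m : ℝ) + 1)) ^ P) = |C| * ((m : ℝ) + 2)⁻¹ := by
        rw [hc, show 1 + ((m : ℝ) + 1) = m + 2 by ring]
        have : (m : ℝ) + 2 ≠ 0 := by positivity
        field_simp
        ring
      rw [← e2]
      have := (inv_pos.2 (hc0 m)).le
      gcongr
      exact le_abs_self C
    refine (pow_le_pow_left' h4 2).trans_eq ?_
    rw [← ENNReal.ofReal_pow (by positivity), mul_pow, sq_abs, inv_pow]
  have hsum : Summable fun m : ℕ => C ^ 2 * (((m : ℝ) + 2) ^ 2)⁻¹ := by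
    refine Summable.mul_left _ ?_
    have := (summable_nat_add_iff 2).2 (Real.summable_nat_pow_inv (p := 2).2 one_lt_two)
    simpa using this
  have hmeas : ∀ m, AEMeasurable (fun ξ => ‖g m ξ‖ₑ ^ 2) volume := fun m =>
    ((memLp_sliceFourier V ((m : ℝ) + 1)).1.const_smul ((c m)⁻¹ : ℝ)).enorm.pow_const 2
  have hfin : ∫⁻ ξ, ∑' m, ‖g m ξ‖ₑ ^ 2 ≠ ⊤ := by
    rw [lintegral_tsum hmeas]
    refine ne_top_of_le_ne_top ?_ (ENNReal.tsum_le_tsum hm)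
    rw [← ENNReal.ofReal_tsum_of_nonneg (fun m => by positivity) hsum]
    exact ENNReal.ofReal_ne_top
  have hae := ae_lt_top' (AEMeasurable.tsum hmeas) hfin
  filter_upwards [hae] with ξ hξ
  refine ⟨√(∑' m, ‖g m ξ‖ₑ ^ 2).toReal, fun m => ?_⟩
  have h1 : ‖g m ξ‖ₑ ^ 2 ≤ ∑' m, ‖g m ξ‖ₑ ^ 2 := ENNReal.le_tsum m
  have h2 := ENNReal.toReal_mono hξ.ne h1
  rw [ENNReal.toReal_pow, toReal_enorm] at h2
  have h3 := Real.le_sqrt_of_sq_le h2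
  rw [hg, norm_smul, Real.norm_of_nonneg (inv_nonneg.2 (hc0 m).le), inv_mul_le_iff₀ (hc0 m)] at h3
  exact h3.trans_eq (mul_comm _ _)

end Pointwise

/-! ### The symbols of the boundary operators -/

section BoundarySymbols

variable {n : ℕ}

/-- The smooth function `g` is the inverse Fourier transform of `A`. -/
structure HasSymbol (g A : Rn n → ℂ) : Prop where
  smooth : ContDiff ℝ ∞ g
  symbolClass : ∃ K, SymbolClass K A
  eq : ∀ ψ : 𝓢(Rn n, ℂ), HasCompactSupport ψ →
    ∫ x, g x * ψ x = ∫ ξ, A ξ * (𝓕⁻ ψ : 𝓢(Rn n, ℂ)) ξ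

lemma contDiff_laplacian {g : Rn n → ℂ} (hg : ContDiff ℝ ∞ g) : ContDiff ℝ ∞ (Δ g) := by
  have h2 : ContDiff ℝ 2 g := hg.of_le (WithTop.coe_le_coe.2 le_top)
  have e : Δ g = fun x => ∑ i, fderiv ℝ (fun x' => fderiv ℝ g x'
      (EuclideanSpace.basisFun (Fin n) ℝ i)) x (EuclideanSpace.basisFun (Fin n) ℝ i) :=
    funext fun x => laplacian_eq_sum_fderiv h2 x
  rw [e]
  refine ContDiff.sum fun i _ => ?_
  have h3 : ∀ {f : Rn n → ℂ} (v : Rn n), ContDiff ℝ ∞ f → ContDiff ℝ ∞ fun x => fderiv ℝ f x v :=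
    fun v hf => (hf.fderiv_right (m := ∞) (by simp)).clm_apply contDiff_const
  exact h3 _ (h3 _ hg)

lemma ContDiff.integrable_mul_schwartz {g : Rn n → ℂ} (hg : ContDiff ℝ ∞ g) {ψ : 𝓢(Rn n, ℂ)}
    (hψ : HasCompactSupport ψ) : Integrable fun x => g x * ψ x :=
  (hg.continuous.mul ψ.continuous).integrable_of_hasCompactSupport hψ.mul_left

namespace HasSymbol

variable {g g' A A' : Rn n → ℂ}

lemma integrable (h : HasSymbol g A) (ψ : 𝓢(Rn n, ℂ)) :
    Integrable fun ξ => A ξ * (𝓕⁻ ψ : 𝓢(Rn n, ℂ)) ξ := by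
  obtain ⟨K, hK⟩ := h.symbolClass
  exact hK.integrable_mul (memLp_fourierInv K ψ)

lemma const_mul (h : HasSymbol g A) (c : ℂ) :
    HasSymbol (fun x => c * g x) fun ξ => c * A ξ where
  smooth := contDiff_const.mul h.smooth
  symbolClass := h.symbolClass.imp fun _ hK => hK.const_mul c
  eq ψ hψ := by
    simp only [mul_assoc, integral_const_mul, h.eq ψ hψ]

lemma sub (h : HasSymbol g A) (h' : HasSymbol g' A') :
    HasSymbol (fun x => g x - g' x) fun ξ => A ξ - A' ξ where
  smooth := h.smooth.sub h'.smooth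
  symbolClass := by
    obtain ⟨K, hK⟩ := h.symbolClass
    obtain ⟨K', hK'⟩ := h'.symbolClass
    exact ⟨K + K', (hK.weaken (by omega)).sub (hK'.weaken (by omega))⟩
  eq ψ hψ := by
    simp only [sub_mul]
    rw [integral_sub (h.smooth.integrable_mul_schwartz hψ) (h'.smooth.integrable_mul_schwartz hψ),
      integral_sub (h.integrable ψ) (h'.integrable ψ), h.eq ψ hψ, h'.eq ψ hψ]

lemma sum {ι : Type*} {g A : ι → Rn n → ℂ} (I : Finset ι) (h : ∀ i ∈ I, HasSymbol (g i) (A i)) :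
    HasSymbol (fun x => ∑ i ∈ I, g i x) fun ξ => ∑ i ∈ I, A i ξ where
  smooth := ContDiff.sum fun i hi => (h i hi).smooth
  symbolClass := by
    choose! K hK using fun i hi => (h i hi).symbolClass
    exact ⟨∑ i ∈ I, K i, SymbolClass.sum I fun i hi =>
      (hK i hi).weaken (Finset.single_le_sum (f := K) (fun _ _ => Nat.zero_le _) hi)⟩
  eq ψ hψ := by
    simp only [Finset.sum_mul]
    rw [integral_finsetSum _ fun i hi => (h i hi).smooth.integrable_mul_schwartz hψ,
      integral_finsetSum _ fun i hi => (h i hi).integrable ψ]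
    exact Finset.sum_congr rfl fun i hi => (h i hi).eq ψ hψ

lemma laplacian (h : HasSymbol g A) : HasSymbol (Δ g) fun ξ => -(freq ξ : ℂ) ^ 2 * A ξ where
  smooth := contDiff_laplacian h.smooth
  symbolClass := by
    obtain ⟨K, hK⟩ := h.symbolClass
    refine ⟨K + 1, ?_⟩
    simpa using (hK.freq_pow_mul (L := K + 1) 1 le_rfl).const_mul (-1)
  eq ψ hψ := by
    rw [integral_laplacian_mul h.smooth hψ, h.eq _ (hasCompactSupport_negLap hψ), ← integral_neg]
    refine integral_congr_ae (Eventually.of_forall fun ξ => ?_)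
    have := fourierInv_negLap_pow ψ 1 ξ
    rw [pow_one, mul_one] at this
    simp only [this]
    ring

lemma laplacian_iterate (h : HasSymbol g A) (l : ℕ) :
    HasSymbol ((fun g : Rn n → ℂ => Δ g)^[l] g) fun ξ => (-(freq ξ : ℂ) ^ 2) ^ l * A ξ := by
  induction l with
  | zero => simpa using h
  | succ l ih =>
    rw [Function.iterate_succ_apply']
    convert ih.laplacian using 2 with ξ
    ring

lemma ae_eq (h : HasSymbol g A) (h' : HasSymbol g A') : A =ᵐ[volume] A' := by
  obtain ⟨K, hK⟩ := h.symbolClass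
  obtain ⟨K', hK'⟩ := h'.symbolClass
  have h0 := ((hK.weaken (Nat.le_add_right K K')).sub
    (hK'.weaken (Nat.le_add_left K' K))).ae_eq_zero fun ψ hψ => by
      simp only [sub_mul]
      rw [integral_sub (h.integrable ψ) (h'.integrable ψ), ← h.eq ψ hψ, ← h'.eq ψ hψ, sub_self]
  filter_upwards [h0] with ξ hξ using sub_eq_zero.1 hξ

end HasSymbol

lemma MemHs.hasSymbol {s : ℝ} {f : Rn n → ℂ} (h : MemHs s f) (hf : ContDiff ℝ ∞ f) :
    HasSymbol f (𝓕 h.toL2 : Lp ℂ 2 (volume : Measure (Rn n))) where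
  smooth := hf
  symbolClass := ⟨0, symbolClass_of_memLp (Lp.memLp _)⟩
  eq ψ hψ := by
    rw [← integral_mul_eq_integral_fourier_mul]
    refine integral_congr_ae ?_
    filter_upwards [h.choose.coeFn_toLp] with x hx
    rw [MemHs.toL2, hx]

/-- The symbols obtained by the recursion which defines the boundary operators. -/
def boundarySymbol (b : ℝ) (N : ℕ) (A : ℕ → Rn n → ℂ) (j : ℕ) (ξ : Rn n) : ℂ :=
  A j ξ - ∑ i : Fin j, (gammaCoeff b N j i : ℂ) *
    ((-(freq ξ : ℂ) ^ 2) ^ (j - (i : ℕ)) * boundarySymbol b N A i ξ)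
termination_by j
decreasing_by exact i.isLt

/-- The Laplacian acts on symbols by `-freq²`, so the recursion between functions becomes a scalar
recursion at each frequency. -/
lemma hasSymbol_boundarySymbol {b : ℝ} {N : ℕ} {T A B : ℕ → Rn n → ℂ}
    (hT : ∀ j, HasSymbol (T j) (A j))
    (hB : ∀ j, B j = T j - ∑ i : Fin j, gammaCoeff b N j i •
      (fun g : Rn n → ℂ => Δ g)^[j - i] (B i)) (j : ℕ) :
    HasSymbol (B j) (boundarySymbol b N A j) := by
  induction j using Nat.strong_induction_on with
  | _ j ih =>
    have h := (hT j).sub (HasSymbol.sum Finset.univ fun (i : Fin j) _ =>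
      (((ih i i.isLt).laplacian_iterate (j - i)).const_mul (gammaCoeff b N j i)))
    convert h using 1
    · rw [hB j]
      funext x
      simp [Finset.sum_apply]
    · funext ξ
      rw [boundarySymbol]

lemma symbolClass_pascal {K : ℕ} {t : ℕ → Rn n → ℂ} (ht : ∀ i, SymbolClass K (t i)) (m i l : ℕ) :
    SymbolClass (K + l + m)
      fun ξ => pascal (fun i l => (freq ξ : ℂ) ^ (2 * l) * t i ξ) m i l := by
  induction m generalizing i l with
  | zero => exact (ht i).freq_pow_mul l le_rfl
  | succ m ih =>
    exact ((ih (i + 1) l).weaken (by omega)).add ((ih i (l + 1)).weaken (by omega))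

lemma pascal_integral {K : ℕ} {t : ℕ → Rn n → ℂ} (ht : ∀ i, SymbolClass K (t i)) (ψ : 𝓢(Rn n, ℂ))
    (m i l : ℕ) :
    pascal (fun i l => ∫ ξ, t i ξ * (𝓕⁻ ((negLap ^ l) ψ) : 𝓢(Rn n, ℂ)) ξ) m i l =
      ∫ ξ, pascal (fun i l => (freq ξ : ℂ) ^ (2 * l) * t i ξ) m i l *
        (𝓕⁻ ψ : 𝓢(Rn n, ℂ)) ξ := by
  induction m generalizing i l with
  | zero =>
    refine integral_congr_ae (Eventually.of_forall fun ξ => ?_)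
    simp only [fourierInv_negLap_pow, pascal]
    ring
  | succ m ih =>
    simp only [pascal, add_mul]
    rw [ih, ih, integral_add ((symbolClass_pascal ht m (i + 1) l).integrable_mul (memLp_fourierInv _ ψ))
      ((symbolClass_pascal ht m i (l + 1)).integrable_mul (memLp_fourierInv _ ψ))]

/-- The Pascal rule applied to the trace functionals and applied to their symbols agree. The
pointwise traces of iterates of `T`, which enter the boundary operators, thus have the power series
coefficients as symbols. -/
lemma hasSymbol_normalJet {F : Rn n → ℝ → ℂ} (hF : IsSmoothEven F) {μ : ℝ} {K : ℕ}
    {t : ℕ → Rn n → ℂ} (ht : ∀ i, SymbolClass K (t i))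
    (hτ : ∀ i (ψ : 𝓢(Rn n, ℂ)), HasCompactSupport ψ →
      jetTower μ F i ψ 0 0 = ∫ ξ, t i ξ * (𝓕⁻ ψ : 𝓢(Rn n, ℂ)) ξ) (j : ℕ) :
    HasSymbol (fun x => jetConst μ j * normalJet F (2 * j) x 0) (freqCoeff t j) where
  smooth := contDiff_const.mul (hF.contDiff_normalJet_zero _)
  symbolClass := ⟨_, symbolClass_pascal ht j 0 0⟩
  eq ψ hψ := by
    have h1 := pascal_jetTower μ F ψ j 0 0
    have h2 : (fun i l => jetTower μ F i ((negLap ^ l) ψ) 0 0) =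
        fun i l => ∫ ξ, t i ξ * (𝓕⁻ ((negLap ^ l) ψ) : 𝓢(Rn n, ℂ)) ξ := by
      funext i l
      exact hτ i _ (hasCompactSupport_negLap_iterate hψ l)
    rw [h2, pascal_integral ht ψ] at h1
    simp only [mul_assoc, integral_const_mul]
    exact h1.symm

end BoundarySymbols

end

/-! ### The relation between the boundary symbols and the theorem -/

theorem HasModerateL2Growth.ae_isBigO {n : ℕ} {a : UnitExp} {V F G : Rn n → ℝ → ℂ}
    (h : IsSmoothPair a V F G) (hV : HasModerateL2Growth V) {k : ℕ}
    (hk : ∀ x y, 0 < y → ((weightedLaplacian (1 - 2 * (a : ℝ)))^[k] V) x y = 0) {K : ℕ}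
    {t s : ℕ → Rn n → ℂ} (hts : TraceSymbols a F G k K t s) :
    ∃ P : ℕ, ∀ᵐ ξ ∂volume, (fun m : ℕ => freqSeries a 0 t m ξ + freqSeries a (2 * a) s m ξ)
      =O[atTop] fun m : ℕ => (m : ℝ) ^ P := by
  obtain ⟨C, Q, hS⟩ := hV.exists_sliceBound
  obtain ⟨P, hP⟩ := hV.ae_bounded
  refine ⟨P, ?_⟩
  -- The exceptional null set depends on the height. Restricting to integer heights makes the union
  -- countable, and the scalar argument needs growth only along a sequence.
  have hall : ∀ᵐ ξ ∂volume, ∀ m : ℕ, sliceFourier V (m + 1) ξ =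
      freqSeries a 0 t (m + 1) ξ + freqSeries a (2 * a) s (m + 1) ξ :=
    ae_all_iff.2 fun m => sliceFourier_ae_eq h hS hk hts (by positivity)
  filter_upwards [hP, hall] with ξ h1 h2
  obtain ⟨D, hD⟩ := h1
  refine Asymptotics.IsBigO.of_bound (|D| * 2 ^ P) ?_
  filter_upwards [eventually_ge_atTop 1] with m hm
  obtain ⟨p, rfl⟩ := Nat.exists_eq_add_of_le' hm
  have h3 := hD p
  rw [h2 p] at h3
  push_cast
  refine h3.trans ?_
  rw [Real.norm_of_nonneg (by positivity), mul_assoc, ← mul_pow]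
  have : (p : ℝ) + 2 ≤ 2 * (p + 1) := by have : (0 : ℝ) ≤ p := Nat.cast_nonneg p; linarith
  have h4 : D ≤ |D| := le_abs_self D
  gcongr

/-- The symbols of the boundary operators of a solution of moderate growth. -/
theorem exists_boundarySymbols {n : ℕ} (hn : 1 ≤ n) {γ : ℝ} (hγ : 0 < γ)
    (ha : 0 < Int.fract γ) {V : Rn n → ℝ → ℂ} (hC : MemC γ V) (hV : HasModerateL2Growth V)
    (heq : ∀ (x : Rn n) (y : ℝ), 0 < y → polyLaplacian γ V x y = 0) :
    ∃ bE bO : ℕ → Rn n → ℂ, (∀ j, HasSymbol (bEven γ j V) (bE j)) ∧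
      (∀ j, HasSymbol (bOdd γ j V) (bO j)) ∧ ∀ j ≤ ⌊γ⌋₊, ∀ᵐ ξ ∂volume,
        0 < freq ξ ∧ bO (⌊γ⌋₊ - j) ξ =
          ((cConst γ j * freq ξ ^ (2 * (γ - 2 * j)) : ℝ) : ℂ) * bE j ξ := by
  obtain ⟨F, G, hF, hG, hFG⟩ := hC
  set a : UnitExp := ⟨Int.fract γ, ha, Int.fract_lt_one γ⟩ with hadef
  have haγ : (a : ℝ) = Int.fract γ := rfl
  have hfl : γ = ⌊γ⌋₊ + Int.fract γ := by
    rw [natCast_floor_eq_intCast_floor hγ.le]; exact (Int.floor_add_fract γ).symm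
  have h : IsSmoothPair a V F G := ⟨hF, hG, hFG⟩
  obtain ⟨K, t, s, ht⟩ := exists_trace_symbols h hV heq
  have hts : TraceSymbols a F G (⌊γ⌋₊ + 1) K t s :=
    ⟨ht.1, ht.2.1, ht.2.2.1, ht.2.2.2.1, ht.2.2.2.2.1, ht.2.2.2.2.2⟩
  set N := ⌊γ⌋₊ with hN
  refine ⟨boundarySymbol (-a) N fun j ξ => (-1) ^ j * freqCoeff t j ξ, boundarySymbol a N fun j ξ =>
      (-1) ^ (j + 1) * (2 * a * freqCoeff s j ξ), ?_, ?_, fun j hj => ?_⟩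
  · refine hasSymbol_boundarySymbol
      (T := fun j x => (-1) ^ j * (jetConst (1 - 2 * a) j * normalJet F (2 * j) x 0))
      (fun j => (hasSymbol_normalJet hF hts.left hts.left_eq j).const_mul _) fun j => ?_
    rw [bEven, weight, ← haγ, h.boundaryTrace_normalOp a.2.1]
    congr 1
    · funext x; simp
    · refine Finset.sum_congr rfl fun i _ => ?_
      -- Writing `γ = N + a` brings the even recursion to the common form with `b = -a`.
      have e1 : (1 : ℝ) + 2 * (i : ℕ) - γ = 1 + 2 * (i : ℕ) - N + -a := by
        rw [haγ]; linear_combination -hfl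
      have e2 : (1 : ℝ) + j + (i : ℕ) - γ = 1 + j + (i : ℕ) - N + -a := by
        rw [haγ]; linear_combination -hfl
      rw [gammaCoeff, e1, e2]
      rfl
  · refine hasSymbol_boundarySymbol
      (T := fun j x => (-1) ^ (j + 1) * (2 * a * (jetConst (1 + 2 * a) j * normalJet G (2 * j) x 0)))
      (fun j => ((hasSymbol_normalJet hG hts.right hts.right_eq j).const_mul _).const_mul _)
      fun j => ?_
    rw [bOdd, weight, ← haγ, h.boundaryTrace_smul_deriv a.2.2]
    congr 1
    · funext x; simp
  · have : Nonempty (Fin n) := ⟨⟨0, hn⟩⟩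
    obtain ⟨P, hP⟩ := hV.ae_isBigO h heq hts
    -- The zero frequency must be discarded since the scalar argument divides by `R`; it is a null
    -- set because `n ≥ 1`.
    have h0 : ∀ᵐ ξ : Rn n ∂volume, ξ ≠ 0 := by
      rw [ae_iff]; simp
    filter_upwards [hP, h0] with ξ h1 h2
    have hR : 0 < freq ξ := by
      have := norm_pos_iff.2 h2
      unfold freq; positivity
    refine ⟨hR, ?_⟩
    rw [← dnConst_eq_cConst hγ ha hj]
    have h3 := odd_symbol_eq a.2.1 a.2.2 N hR (t := fun i => t i ξ) (s := fun i => s i ξ)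
      (fun i hi => by simp [hts.left_zero i hi]) (fun i hi => by simp [hts.right_zero i hi])
      (bE := fun j => boundarySymbol (-a) N (fun j ξ => (-1) ^ j * freqCoeff t j ξ) j ξ)
      (bO := fun j => boundarySymbol a N (fun j ξ => (-1) ^ (j + 1) *
        (2 * a * freqCoeff s j ξ)) j ξ)
      (fun j _ => by rw [boundarySymbol]; rfl)
      (fun j _ => by rw [boundarySymbol]; rfl) h1 hj
    rw [haγ] at h3
    have e : (N : ℝ) + Int.fract γ - 2 * j = γ - 2 * j := by rw [← hfl]
    rw [e] at h3
    exact h3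

theorem EqSmulFractionalLaplacian.of_hasSymbol {n : ℕ} {g f A : Rn n → ℂ} {c s : ℝ}
    {h : MemHs s f} (hg : HasSymbol g A)
    (hA : ∀ᵐ ξ ∂volume, A ξ = ((c * freq ξ ^ (2 * s) : ℝ) : ℂ) *
      (𝓕 h.toL2 : Lp ℂ 2 (volume : Measure (Rn n))) ξ) : EqSmulFractionalLaplacian g c s f h := by
  refine ⟨hg.smooth, fun ψ hψ => ?_⟩
  rw [hg.eq ψ hψ, fractionalLaplacian, ← integral_const_mul]
  refine integral_congr_ae ?_
  filter_upwards [hA] with ξ hξ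
  rw [hξ, Complex.real_smul]
  simp only [freq]
  push_cast
  ring

theorem mainTheorem3 (n : ℕ) (hn : 1 ≤ n) (γ : ℝ) (hγ : 0 < γ) (hγN : ∀ N : ℕ, γ ≠ N)
    (f φ : ℕ → Rn n → ℂ)
    (hf : ∀ j : ℕ, j ≤ ⌊γ / 2⌋₊ → ContDiff ℝ ∞ (f j))
    (hfH : ∀ j : ℕ, j ≤ ⌊γ / 2⌋₊ → MemHs (γ - 2 * j) (f j))
    (hφ : ∀ j : ℕ, j < ⌊γ⌋₊ - ⌊γ / 2⌋₊ → ContDiff ℝ ∞ (φ j))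
    (hφH : ∀ j : ℕ, j < ⌊γ⌋₊ - ⌊γ / 2⌋₊ → MemHs (⌊γ⌋₊ - Int.fract γ - 2 * j) (φ j))
    (V : Rn n → ℝ → ℂ) (hV : IsDirichletSolution γ f φ V) :
    (∀ (j : ℕ) (hj : j ≤ ⌊γ / 2⌋₊),
      EqSmulFractionalLaplacian (bOdd γ (⌊γ⌋₊ - j) V) (cConst γ j) (γ - 2 * j) (f j) (hfH j hj)) ∧
    (∀ (j : ℕ) (hj : j < ⌊γ⌋₊ - ⌊γ / 2⌋₊),
      EqSmulFractionalLaplacian (bEven γ (⌊γ⌋₊ - j) V) (-dConst γ j)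
        (⌊γ⌋₊ - Int.fract γ - 2 * j) (φ j) (hφH j hj)) := by
  have hfloor : ((⌊γ⌋₊ : ℝ)) = (⌊γ⌋ : ℝ) := natCast_floor_eq_intCast_floor hγ.le
  have hfl : γ = ⌊γ⌋₊ + Int.fract γ := by rw [hfloor]; exact (Int.floor_add_fract γ).symm
  -- The only use of the non-integrality of `γ`.
  have ha : 0 < Int.fract γ := by
    refine lt_of_le_of_ne (Int.fract_nonneg γ) fun h => hγN ⌊γ⌋₊ ?_
    rw [← h, add_zero] at hfl
    exact hfl
  obtain ⟨bE, bO, hE, hO, hrel⟩ := exists_boundarySymbols hn hγ ha hV.memC hV.growth hV.eqn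
  have hhalf : ⌊γ / 2⌋₊ ≤ ⌊γ⌋₊ := Nat.floor_mono (by linarith)
  refine ⟨fun j hj => ?_, fun j hj => ?_⟩
  · have h1 := hE j
    rw [hV.bEven_eq j hj] at h1
    refine .of_hasSymbol (hO _) ?_
    filter_upwards [hrel j (hj.trans hhalf), h1.ae_eq ((hfH j hj).hasSymbol (hf j hj))] with ξ e1 e2
    rw [e1.2, e2]
  · have h1 := hO j
    rw [hV.bOdd_eq j hj] at h1
    have hjN : j ≤ ⌊γ⌋₊ := by omega
    refine .of_hasSymbol (hE _) ?_
    -- The relation at index `N - j` expresses `bO j`, whose value is the transform of `φ j`,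
    -- through `bE (N - j)`. Solving for the latter uses that the frequency is positive and that the
    -- exponents `2(γ - 2(N-j))` and `2(N - a - 2j)` are opposite.
    filter_upwards [hrel (⌊γ⌋₊ - j) (Nat.sub_le _ _),
      h1.ae_eq ((hφH j hj).hasSymbol (hφ j hj))] with ξ e1 e2
    obtain ⟨hR, e1⟩ := e1
    rw [Nat.sub_sub_self hjN, e2] at e1
    rw [e1, ← mul_assoc, ← Complex.ofReal_mul]
    have e3 : freq ξ ^ (2 * ((⌊γ⌋₊ : ℝ) - Int.fract γ - 2 * j)) *
        freq ξ ^ (2 * (γ - 2 * ((⌊γ⌋₊ - j : ℕ) : ℝ))) = 1 := by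
      rw [← Real.rpow_add hR, Nat.cast_sub hjN]
      rw [show 2 * ((⌊γ⌋₊ : ℝ) - Int.fract γ - 2 * j) + 2 * (γ - 2 * ((⌊γ⌋₊ : ℝ) - j)) = 0 by
        linear_combination 2 * hfl, Real.rpow_zero]
    have e4 := cConst_mul_dConst hγ ha hjN
    have e5 : -dConst γ j * freq ξ ^ (2 * ((⌊γ⌋₊ : ℝ) - Int.fract γ - 2 * j)) *
        (cConst γ (⌊γ⌋₊ - j) * freq ξ ^ (2 * (γ - 2 * ((⌊γ⌋₊ - j : ℕ) : ℝ)))) = 1 := by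
      linear_combination (-dConst γ j * cConst γ (⌊γ⌋₊ - j)) * e3 + e4
    rw [e5, Complex.ofReal_one, one_mul]
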